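/- **Setting.** Let $G$ be a finite-dimensional real Lie group with Lie algebra $\mathfrak g$, let $J_1,\dots,J_d$ be a basis of $\mathfrak g$ with $[J_a,J_b]=f_{ab}{}^{c}J_c$ (summation convention), and write $\mathrm{Ad}(h)J_a=\mathrm{Ad}^*(h)_a{}^bJ_b$. Let $n,g\ge 0$. Elements of $G^{n+2g}$ are written $(u_{M_1},\dots,u_{M_n},u_{A_1},u_{B_1},\dots,u_{A_g},u_{B_g})$, and the labels are partially ordered by $M_1<\dots<M_n<A_1,B_1<A_2,B_2<\dots<A_g,B_g$ ($A_i$ and $B_i$ are not comparable). For $F\in C^\infty(G^{n+2g})$ let $J_a^{R_X}F$ and $J_a^{L_X}F$ be the derivatives at $t=0$ of $F$ with $u_X$ replaced by $u_Xe^{tJ_a}$, respectively $e^{-tJ_a}u_X$. The flower algebra is the commutative algebra $\mathcal F=S\big(\bigoplus_{k=1}^{n+2g}\mathfrak g\big)\otimes C^\infty(G^{n+2g})$, i.e. the polynomials in generators $j_a^X$ with coefficients in $C^\infty(G^{n+2g})$, with the bracket that is a derivation in each argument, is antisymmetric, and satisfies $\{F,F'\}=0$ and $$\{j_a^X,j_b^X\}=-f_{ab}{}^cj_c^X,\qquad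 \{j_a^X,j_b^Y\}=-f_{db}{}^c\,j_c^Y\,(\delta_a^d-\mathrm{Ad}^*(u_X)_a{}^d)\ \ (X<Y),\qquad \{j_a^{A_i},j_b^{B_i}\}=-f_{ab}{}^cj_c^{B_i},$$ $$\{j_a^{M_i},F\}=-(J_a^{R_{M_i}}+J_a^{L_{M_i}})F-T_a^{M_i}F,$$ $$\{j_a^{A_i},F\}=-(J_a^{R_{A_i}}+J_a^{L_{A_i}})F-(J_a^{R_{B_i}}+J_a^{L_{B_i}})F-\mathrm{Ad}^*(u_{B_i}^{-1}u_{A_i})_a{}^bJ_b^{R_{B_i}}F-T_a^{A_i}F,$$ $$\{j_a^{B_i},F\}=-J_a^{L_{A_i}}F-(J_a^{R_{B_i}}+J_a^{L_{B_i}})F-T_a^{B_i}F,$$ where $T_a^XF=(\delta_a^b-\mathrm{Ad}^*(u_X)_a{}^b)\sum_{Y>X}(J_b^{R_Y}+J_b^{L_Y})F$. Put $u_{K_i}=u_{B_i}u_{A_i}^{-1}u_{B_i}^{-1}u_{A_i}$, let $$\Phi_\infty:G^{n+2g}\to G,\qquad \Phi_\infty(u)=u_{K_g}\cdots u_{K_1}u_{M_n}\cdots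 u_{M_1}$$ be the total holonomy map, and let $$j_a^{H_i}=\big(\delta_a^b-\mathrm{Ad}^*(u_{A_i}^{-1}u_{B_i}^{-1}u_{A_i})_a{}^b\big)j_b^{A_i}+\big(\mathrm{Ad}^*(u_{A_i}^{-1}u_{B_i}^{-1}u_{A_i})-\mathrm{Ad}^*(u_{B_i}^{-1}u_{A_i})\big)_a{}^b\,j_b^{B_i},$$ $$j_a^{tot}=\sum_{i=1}^n\mathrm{Ad}^*(u_{M_{i-1}}\cdots u_{M_1})_a{}^b\,j_b^{M_i}+\sum_{i=1}^g\mathrm{Ad}^*(u_{K_{i-1}}\cdots u_{K_1}u_{M_n}\cdots u_{M_1})_a{}^b\,j_b^{H_i}.$$ Let $G\ltimes C^\infty(G)$ be the group with multiplication $(h_1,f_1)(h_2,f_2)=(h_1h_2,\ f_1+f_2\circ\mathrm{Ad}_{h_1^{-1}})$, where $\mathrm{Ad}_h(x)=hxh^{-1}$. **Theorem (Action of $G\ltimes C^\infty(G)$).** 1. The group $G\ltimes C^\infty(G)$ acts on the algebra $\mathcal F$ by algebra automorphisms such that $$(h,f):\quad j_a^X\mapsto \mathrm{Ad}^*(h)_a{}^b\,j_b^X+\mathrm{Ad}^*(h)_a{}^b\,\{j_b^X,f\circ\Phi_\infty\},\qquad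 F\mapsto F\circ\mathrm{Ad}^{n+2g}_{h^{-1}},$$ where $\mathrm{Ad}^{n+2g}_{h}(u)=(hu_Xh^{-1})_X$ is the global conjugation by $h$. 2. This is a Poisson action: every $(h,f)$ preserves the bracket of $\mathcal F$. The infinitesimal generators of the action of $G$ are the elements $j_a^{tot}$, and the action of $C^\infty(G)$ is generated by the functions $f\circ\Phi_\infty$: for all $\varphi\in\mathcal F$, $a=1,\dots,d$ and $f\in C^\infty(G)$, $$\tfrac{d}{dt}\Big|_{t=0}(e^{-tJ_a},0)(\varphi)=\{j_a^{tot},\varphi\},\qquad \tfrac{d}{dt}\Big|_{t=0}(1,-tf)(\varphi)=\{f\circ\Phi_\infty,\varphi\},$$ where elements of $\mathcal F$ are viewed as functions on $G^{n+2g}\times(\mathfrak g^*)^{n+2g}$ and the derivatives are taken pointwise. Moreover $$j_a^{tot}=\sum_{i=1}^nj_a^{M_i'}+\sum_{k=1}^g\Big((\delta_a^b-\mathrm{Ad}^*(u_{A_k}^{-1})_a{}^b)\,j_b^{A_k'}+\big(\mathrm{Ad}^*(u_{A_k}^{-1})-\mathrm{Ad}^*(u_{B_k}^{-1}u_{A_k})\big)_a{}^b\,j_b^{B_k'}\Big),$$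 where, with $S^i_b=\sum_{k=i+1}^g\mathrm{Ad}^*(u_{K_{k-1}}\cdots u_{K_{i+1}})_b{}^c\,j_c^{H_k}$, $$j_a^{M_i'}=j_a^{M_i}-(\delta_a^b-\mathrm{Ad}^*(u_{M_i})_a{}^b)\Big(\sum_{k=i+1}^n\mathrm{Ad}^*(u_{M_{k-1}}\cdots u_{M_{i+1}})_b{}^c\,j_c^{M_k}+\sum_{k=1}^g\mathrm{Ad}^*(u_{K_{k-1}}\cdots u_{K_1}u_{M_n}\cdots u_{M_{i+1}})_b{}^c\,j_c^{H_k}\Big),$$ $$j_a^{A_i'}=j_a^{A_i}+\mathrm{Ad}^*(u_{A_i}^{-1})_a{}^b(j_b^{A_i}-j_b^{B_i})+(\mathrm{Ad}^*(u_{A_i})-\mathrm{Ad}^*(u_{B_i}u_{A_i}^{-1}))_a{}^b\,S^i_b,$$ $$j_a^{B_i'}=j_a^{B_i}+\mathrm{Ad}^*(u_{A_i}^{-1})_a{}^b(j_b^{A_i}-j_b^{B_i})+(\mathrm{Ad}^*(u_{B_i})-\mathrm{Ad}^*(u_{B_i}u_{A_i}^{-1}))_a{}^b\,S^i_b.$$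 -/

import Mathlib

open scoped Manifold ContDiff TensorProduct

noncomputable section
namespace FlowerAlgebra

section Smooth

variable {E : Type*} [NormedAddCommGroup E] [NormedSpace ℝ E]
  {G : Type*} [TopologicalSpace G] [ChartedSpace E G]
  {κ : Type*} [Fintype κ]

variable (E κ) in
/-- The model of the product manifold `G^κ`, for `G` modelled on `E`. -/
abbrev piModel : ModelWithCorners ℝ (κ → E) (ModelPi fun _ : κ => E) :=
  ModelWithCorners.pi fun _ : κ => 𝓘(ℝ, E)

theorem range_piModel : Set.range (piModel E κ) = Set.univ :=
  Set.range_eq_univ.2 fun y => ⟨y, rfl⟩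

theorem contMDiff_proj (k : κ) :
    ContMDiff (piModel E κ) 𝓘(ℝ, E) ∞ (fun u : κ → G => u k) := by
  intro u
  rw [contMDiffAt_iff]
  refine ⟨(continuous_apply k).continuousAt, ?_⟩
  have h1 : ContDiffWithinAt ℝ ∞ (fun x : κ → E => x k) (Set.range (piModel E κ))
      (extChartAt (piModel E κ) u u) := (contDiff_apply ℝ E k).contDiffWithinAt
  have key : ∀ y ∈ (extChartAt (piModel E κ) u).target,
      (extChartAt 𝓘(ℝ, E) (u k) ∘ (fun u : κ → G => u k) ∘ (extChartAt (piModel E κ) u).symm) y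
        = y k := by
    intro y hy
    have hy' : ∀ k, y k ∈ (chartAt E (u k)).target := by
      have h2 := hy.2
      exact fun k => h2 k (Set.mem_univ k)
    exact (chartAt E (u k)).right_inv (hy' k)
  refine h1.congr_of_eventuallyEq ?_ (key _ (mem_extChartAt_target u))
  filter_upwards [extChartAt_target_mem_nhdsWithin (I := piModel E κ) u] with y hy
  exact key y hy

theorem contMDiff_pi_of {F : Type*} [NormedAddCommGroup F] [NormedSpace ℝ F] {H : Type*}
    [TopologicalSpace H] {J : ModelWithCorners ℝ F H} {M : Type*} [TopologicalSpace M]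
    [ChartedSpace H M] {f : M → κ → G}
    (hf : ∀ k, ContMDiff J 𝓘(ℝ, E) ∞ fun x => f x k) : ContMDiff J (piModel E κ) ∞ f := by
  intro x
  rw [contMDiffAt_iff]
  refine ⟨(continuous_pi fun k => (hf k).continuous).continuousAt, ?_⟩
  refine contDiffWithinAt_pi.2 fun k => ?_
  exact (contMDiffAt_iff.1 (hf k x)).2

instance isManifold_pi [IsManifold 𝓘(ℝ, E) ∞ G] : IsManifold (piModel E κ) ∞ (κ → G) := by
  refine isManifold_of_contDiffOn _ _ _ ?_
  rintro _ _ ⟨e, he, rfl⟩ ⟨e', he', rfl⟩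
  refine contDiffOn_pi.2 fun k => ?_
  have h := (contDiffGroupoid ∞ 𝓘(ℝ, E)).compatible (he k trivial) (he' k trivial)
  rw [contDiffGroupoid, mem_groupoid_of_pregroupoid] at h
  have h1 : ContDiffOn ℝ ∞ ((e k).symm.trans (e' k)) ((e k).symm.trans (e' k)).source := by
    simpa [contDiffPregroupoid] using h.1
  refine h1.comp (contDiff_apply ℝ E k).contDiffOn ?_
  intro y hy
  have hy1 := hy.1
  exact ⟨hy1.1 k trivial, hy1.2 k trivial⟩

end Smooth
section Lie
variable {E : Type*} [NormedAddCommGroup E] [NormedSpace ℝ E]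
  {G : Type*} [TopologicalSpace G] [ChartedSpace E G] [Group G]

/-- The derivative at the unit in the direction `ξ`. -/
def dirDeriv (f : G → ℝ) (ξ : GroupLieAlgebra 𝓘(ℝ, E) G) : ℝ :=
  mfderiv 𝓘(ℝ, E) 𝓘(ℝ, ℝ) f (1 : G) ξ

/-- The adjoint action `Ad(g)` on the Lie algebra: the derivative of `x ↦ g x g⁻¹` at the unit. -/
def Ad (g : G) (ξ : GroupLieAlgebra 𝓘(ℝ, E) G) : GroupLieAlgebra 𝓘(ℝ, E) G :=
  mfderiv 𝓘(ℝ, E) 𝓘(ℝ, E) (fun x : G => g * x * g⁻¹) (1 : G) ξ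

variable  [LieGroup 𝓘(ℝ, E) ∞ G]

theorem contMDiff_dirDeriv {F : Type*} [NormedAddCommGroup F] [NormedSpace ℝ F] {H : Type*}
    [TopologicalSpace H] {J : ModelWithCorners ℝ F H} {M : Type*} [TopologicalSpace M]
    [ChartedSpace H M] [IsManifold J ∞ M] {Φ : M → G → ℝ}
    (hΦ : ContMDiff (J.prod 𝓘(ℝ, E)) 𝓘(ℝ, ℝ) ∞ (Function.uncurry Φ))
    (ξ : GroupLieAlgebra 𝓘(ℝ, E) G) :
    ContMDiff J 𝓘(ℝ, ℝ) ∞ fun x => dirDeriv (Φ x) ξ := by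
  have : IsManifold J 1 M := IsManifold.of_le (n := ∞) (by simp)
  have : ContMDiffMul 𝓘(ℝ, E) ∞ G := LieGroup.toContMDiffMul
  have : IsManifold 𝓘(ℝ, E) ∞ G := ContMDiffMul.toIsManifold
  have : IsManifold 𝓘(ℝ, E) 1 G := IsManifold.of_le (n := ∞) (by simp)
  intro x
  have := ContMDiffAt.mfderiv (x₀ := x) (m := ∞) (n := ∞) Φ (fun _ => (1 : G)) (hΦ (x, 1)) contMDiffAt_const (by simp)
  have h2 := this.clm_apply (contMDiffAt_const (c := (show E from ξ)))
  refine h2.congr_of_eventuallyEq ?_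
  filter_upwards with y
  refine Eq.trans ?_ (congrArg (fun L : E →L[ℝ] ℝ => L ξ) (inTangentCoordinates_eq (I := 𝓘(ℝ, E))
    (I' := 𝓘(ℝ, ℝ)) (fun _ : M => (1 : G)) (fun x => Φ x 1) (x₀ := x) (x := y)
    (fun x => mfderiv 𝓘(ℝ, E) 𝓘(ℝ, ℝ) (Φ x) (1 : G)) (mem_chart_source E _) trivial)).symm
  symm
  refine ((tangentBundleCore 𝓘(ℝ, ℝ) ℝ).coordChange_self (achart ℝ (0 : ℝ)) (Φ y 1) trivial _).trans ?_
  exact congrArg (mfderiv 𝓘(ℝ, E) 𝓘(ℝ, ℝ) (Φ y) (1 : G))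
    ((tangentBundleCore 𝓘(ℝ, E) G).coordChange_self (achart E (1 : G)) 1
      (mem_achart_source E (1 : G)) ξ)

theorem contMDiff_Ad (ξ : GroupLieAlgebra 𝓘(ℝ, E) G) :
    ContMDiff 𝓘(ℝ, E) 𝓘(ℝ, E) ∞ fun g : G => (show E from Ad g ξ) := by
  have : ContMDiffMul 𝓘(ℝ, E) ∞ G := LieGroup.toContMDiffMul
  have : IsManifold 𝓘(ℝ, E) ∞ G := ContMDiffMul.toIsManifold
  have : IsManifold 𝓘(ℝ, E) 1 G := IsManifold.of_le (n := ∞) (by simp)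
  have : ContMDiffMul 𝓘(ℝ, E) ∞ G := LieGroup.toContMDiffMul
  intro g
  have hΦ : ContMDiff (𝓘(ℝ, E).prod 𝓘(ℝ, E)) 𝓘(ℝ, E) ∞
      (Function.uncurry fun g x : G => g * x * g⁻¹) :=
    (contMDiff_fst.mul contMDiff_snd).mul contMDiff_fst.inv
  have := ContMDiffAt.mfderiv (x₀ := g) (m := ∞) (n := ∞) _ (fun _ => (1 : G)) (hΦ (g, 1)) contMDiffAt_const (by simp)
  have h2 := this.clm_apply (contMDiffAt_const (c := (show E from ξ)))
  refine h2.congr_of_eventuallyEq ?_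
  filter_upwards with y
  have e1 : ∀ y : G, y * 1 * y⁻¹ = 1 := by simp
  refine Eq.trans ?_ (congrArg (fun L : E →L[ℝ] E => L ξ) (inTangentCoordinates_eq (I := 𝓘(ℝ, E))
    (I' := 𝓘(ℝ, E)) (fun _ : G => (1 : G)) (fun x : G => x * 1 * x⁻¹) (x₀ := g) (x := y)
    (fun x => mfderiv 𝓘(ℝ, E) 𝓘(ℝ, E) (fun z : G => x * z * x⁻¹) (1 : G)) (mem_chart_source E _)
    (by rw [e1, e1]; exact mem_chart_source E _))).symm
  rw [e1 y, e1 g]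
  symm
  refine ((tangentBundleCore 𝓘(ℝ, E) G).coordChange_self (achart E (1 : G)) 1
      (mem_achart_source E (1 : G)) _).trans ?_
  exact congrArg (mfderiv 𝓘(ℝ, E) 𝓘(ℝ, E) (fun z : G => y * z * y⁻¹) (1 : G))
    ((tangentBundleCore 𝓘(ℝ, E) G).coordChange_self (achart E (1 : G)) 1
      (mem_achart_source E (1 : G)) ξ)


theorem exists_expCurve [FiniteDimensional ℝ E] [T2Space G] (ξ : GroupLieAlgebra 𝓘(ℝ, E) G) :
    ∃ γ : ℝ → G, γ 0 = 1 ∧ IsMIntegralCurve (I := 𝓘(ℝ, E)) γ (mulInvariantVectorField ξ) := by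
  have : CompleteSpace E := FiniteDimensional.complete ℝ E
  have : LieGroup 𝓘(ℝ, E) (minSmoothness ℝ 3) G := LieGroup.of_le (n := ∞) (by
    rw [minSmoothness_of_isRCLikeNormedField]; exact WithTop.coe_le_coe.2 (le_top : (3 : ℕ∞) ≤ ⊤))
  have : LieGroup 𝓘(ℝ, E) 1 G := LieGroup.of_le (n := ∞) (by exact_mod_cast le_top)
  have : ContMDiffMul 𝓘(ℝ, E) 1 G := LieGroup.toContMDiffMul
  have : IsManifold 𝓘(ℝ, E) 1 G := ContMDiffMul.toIsManifold
  have hv := (contMDiff_mulInvariantVectorField (I := 𝓘(ℝ, E)) ξ).of_le (m := 1) (by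
    rw [minSmoothness_of_isRCLikeNormedField]; exact_mod_cast one_le_two)
  have hd : ∀ x y : G, MDifferentiableAt 𝓘(ℝ, E) 𝓘(ℝ, E) (x * ·) y := fun x y =>
    (contMDiff_mul_left (I := 𝓘(ℝ, E)) (n := 1) (a := x)).mdifferentiableAt one_ne_zero
  obtain ⟨γ, h0, hγ⟩ := exists_isMIntegralCurveAt_of_contMDiffAt_boundaryless
    (t₀ := 0) (hv.contMDiffAt (x := 1))
  obtain ⟨ε, hε, hγ⟩ := isMIntegralCurveAt_iff'.1 hγ
  refine exists_isMIntegralCurve_of_isMIntegralCurveOn hv hε (fun x => ?_) 1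
  refine ⟨fun t => x * γ t, by simp [h0], fun t ht => ?_⟩
  have ht' : t ∈ Metric.ball (0 : ℝ) ε := by
    rw [Real.ball_eq_Ioo]; simpa using ht
  have h1 := ((hγ t ht').hasMFDerivAt (Metric.isOpen_ball.mem_nhds ht'))
  have h2 := ((hd x (γ t)).hasMFDerivAt.comp t h1).hasMFDerivWithinAt (s := Set.Ioo (-ε) ε)
  have h3 : mfderiv 𝓘(ℝ, E) 𝓘(ℝ, E) (x * ·) (γ t) (mulInvariantVectorField ξ (γ t)) =
      mulInvariantVectorField ξ (x * γ t) := by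
    have e : ((x * γ t) * ·) = (x * ·) ∘ (γ t * ·) := by ext z; simp [mul_assoc]
    have := mfderiv_comp (I := 𝓘(ℝ, E)) (I' := 𝓘(ℝ, E)) (I'' := 𝓘(ℝ, E)) (1 : G)
      (g := (x * ·)) (f := (γ t * ·)) (hd _ _) (hd _ _)
    rw [mulInvariantVectorField, mulInvariantVectorField, e, this, mul_one]
    rfl
  refine h2.congr_mfderiv ?_
  have h4 : (mfderiv 𝓘(ℝ, E) 𝓘(ℝ, E) (x * ·) (γ t)) ((1 : ℝ) • mulInvariantVectorField ξ (γ t)) =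
      (1 : ℝ) • mulInvariantVectorField ξ (x * γ t) := by rw [one_smul, one_smul, h3]
  exact ContinuousLinearMap.ext_ring h4

/-- The one-parameter subgroup `t ↦ exp (t ξ)`: the integral curve through the unit of the
left-invariant vector field with value `ξ` at the unit. -/
def expCurve [FiniteDimensional ℝ E] [T2Space G] (ξ : GroupLieAlgebra 𝓘(ℝ, E) G) : ℝ → G :=
  Classical.choose (exists_expCurve ξ)

theorem expCurve_zero [FiniteDimensional ℝ E] [T2Space G] (ξ : GroupLieAlgebra 𝓘(ℝ, E) G) :
    expCurve ξ 0 = 1 :=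
  (Classical.choose_spec (exists_expCurve ξ)).1

theorem isMIntegralCurve_expCurve [FiniteDimensional ℝ E] [T2Space G]
    (ξ : GroupLieAlgebra 𝓘(ℝ, E) G) :
    IsMIntegralCurve (I := 𝓘(ℝ, E)) (expCurve ξ) (mulInvariantVectorField ξ) :=
  (Classical.choose_spec (exists_expCurve ξ)).2

end Lie

section Curves

/-- The generators `m_1, …, m_n, a_1, b_1, …, a_g, b_g` of the fundamental group of the surface
of genus `g` with `n` punctures and a disc removed. -/
inductive Curve (n g : ℕ) : Type
  | M (i : Fin n)
  | A (k : Fin g)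
  | B (k : Fin g)
  deriving DecidableEq, Fintype

namespace Curve

variable {n g : ℕ}

/-- The order `M_1 < … < M_n < A_1, B_1 < … < A_g, B_g`, in which `A_k` and `B_k` are not
comparable: `X` comes before `Y` if and only if `X.rank < Y.rank`. -/
def rank : Curve n g → ℕ
  | M i => i
  | A k => n + k
  | B k => n + k

/-- The word of the curve `X`. -/
abbrev word (X : Curve n g) : FreeGroup (Curve n g) := FreeGroup.of X

/-- The word `K_k`, that is `u_{K_k} = u_{B_k} u_{A_k}⁻¹ u_{B_k}⁻¹ u_{A_k}`. -/
def wordK (n : ℕ) (k : Fin g) : FreeGroup (Curve n g) :=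
  word (B k) * (word (A k))⁻¹ * (word (B k))⁻¹ * word (A k)

/-- The product `u_{M_{hi-1}} ⋯ u_{M_{lo+1}} u_{M_lo}`, with indices starting at `0`. -/
def prodM (n g lo hi : ℕ) : FreeGroup (Curve n g) :=
  ((((List.finRange n).filter fun i => lo ≤ i.val ∧ i.val < hi).map fun i => word (M i)).reverse).prod

/-- The product `u_{K_{hi-1}} ⋯ u_{K_{lo+1}} u_{K_lo}`, with indices starting at `0`. -/
def prodK (n g lo hi : ℕ) : FreeGroup (Curve n g) :=
  ((((List.finRange g).filter fun k => lo ≤ k.val ∧ k.val < hi).map (wordK n)).reverse).prod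

/-- The word `K_g ⋯ K_1 M_n ⋯ M_1` of the total holonomy. -/
def wordTot (n g : ℕ) : FreeGroup (Curve n g) := prodK n g 0 g * prodM n g 0 n

end Curve

end Curves

section Flower

variable (E : Type*) [NormedAddCommGroup E] [NormedSpace ℝ E] (n g : ℕ)
  (G : Type*) [TopologicalSpace G] [ChartedSpace E G] (ι : Type*)

/-- The algebra `C^∞(G)` of real-valued smooth functions on `G`. -/
abbrev SmoothFn := C^∞⟮𝓘(ℝ, E), G; ℝ⟯

/-- The algebra `C^∞(G^{n+2g})`. -/
abbrev Coeff := C^∞⟮piModel E (Curve n g), Curve n g → G; ℝ⟯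

/-- The commutative algebra `S(⨁ 𝔤) ⊗ C^∞(G^{n+2g})` underlying the flower algebra, as polynomials
with coefficients in `C^∞(G^{n+2g})` in the variables `j_a^X`, where `X` is a curve and `a : ι`
is an index of the basis of `𝔤`. -/
abbrev Flower := MvPolynomial (Curve n g × ι) (Coeff E n g G)

end Flower

section FlowerBasics

variable {E : Type*} [NormedAddCommGroup E] [NormedSpace ℝ E] {n g : ℕ}
  {G : Type*} [TopologicalSpace G] [ChartedSpace E G] {ι : Type*}

variable (E G) in
/-- The generator `j_a^X ⊗ 1` of the flower algebra. -/
def gen (X : Curve n g) (a : ι) : Flower E n g G ι := MvPolynomial.X (X, a)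

variable (ι) in
/-- The element `1 ⊗ F` of the flower algebra. -/
def fn (F : Coeff E n g G) : Flower E n g G ι := MvPolynomial.C F

/-- Apply a map `V` of `C^∞(G^{n+2g})` to all coefficients of an element of the flower algebra. -/
def mapCoeff (V : Coeff E n g G → Coeff E n g G) (φ : Flower E n g G ι) : Flower E n g G ι :=
  ∑ m ∈ φ.support, MvPolynomial.monomial m (V (φ.coeff m))

variable (n g) in
/-- The identification of the polynomial model with `S(⨁ 𝔤) ⊗ C^∞(G^{n+2g})` given by a basis
of `𝔤`. -/
def flowerEquiv [Fintype ι] [Group G] (b : Module.Basis ι ℝ (GroupLieAlgebra 𝓘(ℝ, E) G)) :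
    SymmetricAlgebra ℝ (Curve n g → GroupLieAlgebra 𝓘(ℝ, E) G) ⊗[ℝ] Coeff E n g G ≃ₐ[ℝ]
      Flower E n g G ι :=
  ((Algebra.TensorProduct.congr (SymmetricAlgebra.equivMvPolynomial
      ((Pi.basis fun _ : Curve n g => b).reindex (Equiv.sigmaEquivProd (Curve n g) ι)))
      AlgEquiv.refl).trans (Algebra.TensorProduct.comm ℝ _ _)).trans
    ((MvPolynomial.algebraTensorAlgEquiv ℝ (Coeff E n g G)).restrictScalars ℝ)

/-- The value of an element of the flower algebra, as a function on `G^{n+2g} × (𝔤^*)^{n+2g}`, at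
the point with components `u_X ∈ G` and `j_X = ∑_a y_{X,a} P^a ∈ 𝔤^*`. -/
def evalAt (u : Curve n g → G) (y : Curve n g × ι → ℝ) (φ : Flower E n g G ι) : ℝ :=
  MvPolynomial.eval₂ (ContMDiffMap.evalRingHom u) y φ

end FlowerBasics

section Symmetry

variable {E : Type*} [NormedAddCommGroup E] [NormedSpace ℝ E] {n g : ℕ}
  {G : Type*} [TopologicalSpace G] [ChartedSpace E G] [Group G] [LieGroup 𝓘(ℝ, E) ∞ G]

theorem contMDiffMul : ContMDiffMul 𝓘(ℝ, E) ∞ G := LieGroup.toContMDiffMul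

/-- The smooth map `G^{n+2g} → G`, `u ↦ w(u)`, given by a word `w` in the holonomies. -/
def wordMap (w : FreeGroup (Curve n g)) :
    C^∞⟮piModel E (Curve n g), Curve n g → G; 𝓘(ℝ, E), G⟯ where
  val u := FreeGroup.lift u w
  property := by
    have := contMDiffMul (E := E) (G := G)
    induction w using FreeGroup.induction_on with
    | C1 => simpa using contMDiff_const
    | of X => simpa using contMDiff_proj X
    | inv_of X h => simpa using h.inv
    | mul x y hx hy =>
      have h := hx.mul hy
      simp only [map_mul]
      exact h

/-- Conjugation `x ↦ h x h⁻¹` on `G`. -/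
def conj (h : G) : C^∞⟮𝓘(ℝ, E), G; 𝓘(ℝ, E), G⟯ where
  val x := h * x * h⁻¹
  property := by
    have := contMDiffMul (E := E) (G := G)
    exact (contMDiff_const.mul contMDiff_id).mul contMDiff_const

/-- The global conjugation `u ↦ (h u_X h⁻¹)_X` on `G^{n+2g}`. -/
def conjAll (h : G) :
    C^∞⟮piModel E (Curve n g), Curve n g → G; piModel E (Curve n g), Curve n g → G⟯ where
  val u X := h * u X * h⁻¹
  property := by
    exact contMDiff_pi_of fun X => (conj h).contMDiff.comp (contMDiff_proj X)

variable (E n g G) in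
/-- The total holonomy `Φ_∞ : G^{n+2g} → G`. -/
def PhiInf : C^∞⟮piModel E (Curve n g), Curve n g → G; 𝓘(ℝ, E), G⟯ :=
  wordMap (Curve.wordTot n g)

variable (E G) in
/-- The action `(h, f) ↦ f ∘ Ad_{h⁻¹}` of `G` on the additive group `C^∞(G)`. -/
def conjAut : G →* MulAut (Multiplicative (SmoothFn E G)) where
  toFun h :=
    { toFun := fun f => Multiplicative.ofAdd (f.toAdd.comp (conj h⁻¹))
      invFun := fun f => Multiplicative.ofAdd (f.toAdd.comp (conj h))
      left_inv := fun f => by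
        refine congrArg Multiplicative.ofAdd (ContMDiffMap.ext fun x => ?_)
        exact congrArg f.toAdd (by group : h⁻¹ * (h * x * h⁻¹) * h⁻¹⁻¹ = x)
      right_inv := fun f => by
        refine congrArg Multiplicative.ofAdd (ContMDiffMap.ext fun x => ?_)
        exact congrArg f.toAdd (by group : h * (h⁻¹ * x * h⁻¹⁻¹) * h⁻¹ = x)
      map_mul' := fun _ _ => rfl }
  map_one' := by
    ext f x
    exact congrArg f.toAdd (by simp : (1 : G)⁻¹ * x * (1 : G)⁻¹⁻¹ = x)
  map_mul' h k := by
    ext f x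
    exact congrArg f.toAdd (by group :
      (h * k)⁻¹ * x * (h * k)⁻¹⁻¹ = k⁻¹ * (h⁻¹ * x * h⁻¹⁻¹) * k⁻¹⁻¹)

variable (E G) in
/-- The group `G ⋉ C^∞(G)`. -/
abbrev SymmGroup := Multiplicative (SmoothFn E G) ⋊[conjAut E G] G

/-- The element `(h, f)` of `G ⋉ C^∞(G)`. -/
def SymmGroup.mk (h : G) (f : SmoothFn E G) : SymmGroup E G := ⟨Multiplicative.ofAdd f, h⟩

/-- The multiplication is `(h₁, f₁) (h₂, f₂) = (h₁ h₂, f₁ + f₂ ∘ Ad_{h₁⁻¹})`. -/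
theorem SymmGroup.mk_mul_mk (h₁ h₂ : G) (f₁ f₂ : SmoothFn E G) :
    SymmGroup.mk h₁ f₁ * SymmGroup.mk h₂ f₂ =
      SymmGroup.mk (h₁ * h₂) (f₁ + f₂.comp (conj h₁⁻¹)) := rfl

end Symmetry

section Action

variable {E : Type*} [NormedAddCommGroup E] [NormedSpace ℝ E] {n g : ℕ}
  {G : Type*} [TopologicalSpace G] [ChartedSpace E G] [Group G] [LieGroup 𝓘(ℝ, E) ∞ G]
  {ι : Type*}

/-- The left-invariant vector field `J^{R_X}` on the copy of `G` labelled by `X`: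
`(J^{R_X}_ξ F)(u)` is the derivative at `t = 0` of `F` at `u` with `u_X` replaced by
`u_X e^{tξ}`. -/
def JR (X : Curve n g) (ξ : GroupLieAlgebra 𝓘(ℝ, E) G) (F : Coeff E n g G) : Coeff E n g G where
  val u := dirDeriv (fun x : G => F (Function.update u X (u X * x))) ξ
  property := by
    have := contMDiffMul (E := E) (G := G)
    have : IsManifold 𝓘(ℝ, E) ∞ G := ContMDiffMul.toIsManifold
    refine contMDiff_dirDeriv (F.contMDiff.comp (contMDiff_pi_of fun Y => ?_)) ξ
    by_cases hY : Y = X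
    · subst hY
      have h := ((contMDiff_proj (E := E) (G := G) Y).comp contMDiff_fst).mul
        (contMDiff_snd (I := piModel E (Curve n g)) (J := 𝓘(ℝ, E)) (M := Curve n g → G) (N := G))
      simp only [Function.update_self]
      exact h
    · simp only [Function.update_of_ne hY]
      exact (contMDiff_proj Y).comp contMDiff_fst

/-- The right-invariant vector field `J^{L_X}` on the copy of `G` labelled by `X`:
`(J^{L_X}_ξ F)(u)` is the derivative at `t = 0` of `F` at `u` with `u_X` replaced by
`e^{-tξ} u_X`. -/
def JL (X : Curve n g) (ξ : GroupLieAlgebra 𝓘(ℝ, E) G) (F : Coeff E n g G) : Coeff E n g G where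
  val u := -dirDeriv (fun x : G => F (Function.update u X (x * u X))) ξ
  property := by
    have := contMDiffMul (E := E) (G := G)
    have : IsManifold 𝓘(ℝ, E) ∞ G := ContMDiffMul.toIsManifold
    refine (contMDiff_dirDeriv (F.contMDiff.comp (contMDiff_pi_of fun Y => ?_)) ξ).neg
    by_cases hY : Y = X
    · subst hY
      have h := (contMDiff_snd (I := piModel E (Curve n g)) (J := 𝓘(ℝ, E)) (M := Curve n g → G)
        (N := G)).mul ((contMDiff_proj (E := E) (G := G) Y).comp contMDiff_fst)
      simp only [Function.update_self]
      exact h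
    · simp only [Function.update_of_ne hY]
      exact (contMDiff_proj Y).comp contMDiff_fst

variable [Fintype ι] [DecidableEq ι] (b : Module.Basis ι ℝ (GroupLieAlgebra 𝓘(ℝ, E) G))

/-- The structure constants: `[J_a, J_c] = ∑_d f_{ac}^d J_d`. -/
def strConst (a c d : ι) : ℝ := b.repr ⁅b a, b c⁆ d

/-- The matrix entries of `Ad^*`: `Ad(h) J_a = ∑_c Ad^*(h)_a^c J_c`. -/
def adCoeff (a c : ι) : SmoothFn E G where
  val h := b.repr (Ad h (b a)) c
  property := by
    have : FiniteDimensional ℝ E := Module.Finite.of_basis (show Module.Basis ι ℝ E from b)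
    have h : ContDiff ℝ ∞ (show E →ₗ[ℝ] ℝ from b.coord c) :=
      (LinearMap.toContinuousLinearMap (show E →ₗ[ℝ] ℝ from b.coord c)).contDiff
    exact h.contMDiff.comp (contMDiff_Ad (b a))

/-- The function `u ↦ Ad^*(w(u))_a^c` on `G^{n+2g}`. -/
def adW (w : FreeGroup (Curve n g)) (a c : ι) : Coeff E n g G := (adCoeff b a c).comp (wordMap w)

/-- The function `u ↦ δ_a^c - Ad^*(w(u))_a^c` on `G^{n+2g}`. -/
def oneSubAdW (w : FreeGroup (Curve n g)) (a c : ι) : Coeff E n g G :=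
  (if a = c then 1 else 0) - adW b w a c


/-- The derivation `{j_a^X ⊗ 1, 1 ⊗ ·}` of `C^∞(G^{n+2g})`. The sum over the curves `Y > X` is
contained in `later`. -/
def jField (X : Curve n g) (a : ι) (F : Coeff E n g G) : Coeff E n g G :=
  let J (Y : Curve n g) (c : ι) : Coeff E n g G := JR Y (b c) F + JL Y (b c) F
  let later : Coeff E n g G :=
    ∑ c, oneSubAdW b X.word a c * ∑ Y : Curve n g with X.rank < Y.rank, J Y c
  match X with
  | .M i => -J (.M i) a - later
  | .A k => -J (.A k) a - J (.B k) a
      - ∑ c, adW b ((Curve.word (.B k))⁻¹ * Curve.word (.A k)) a c * JR (.B k) (b c) F - later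
  | .B k => -JL (.A k) (b a) F - J (.B k) a - later

/-- The brackets `{j_a^X ⊗ 1, j_c^Y ⊗ 1}`. If neither of `X` and `Y` comes before the other, then
`X = Y` or `{X, Y} = {A_k, B_k}`. -/
def genBracket (X : Curve n g) (a : ι) (Y : Curve n g) (c : ι) : Flower E n g G ι :=
  let mixed (X : Curve n g) (a : ι) (Y : Curve n g) (c : ι) : Flower E n g G ι :=
    -∑ d, ∑ e, strConst b d c e • (gen E G Y e * fn ι (oneSubAdW b X.word a d))
  if X.rank < Y.rank then mixed X a Y c
  else if Y.rank < X.rank then -mixed Y c X a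
  else match X with
    | .B k => -∑ e, strConst b a c e • gen E G (.B k) e
    | _ => -∑ e, strConst b a c e • gen E G Y e

/-- The Poisson bracket of the flower algebra: the extension, as a derivation in each argument,
of the brackets `{j_a^X ⊗ 1, j_c^Y ⊗ 1}`, `{j_a^X ⊗ 1, 1 ⊗ F}` and `{1 ⊗ F, 1 ⊗ F'} = 0`. -/
def bracket (φ ψ : Flower E n g G ι) : Flower E n g G ι :=
  (∑ p : Curve n g × ι, ∑ q : Curve n g × ι,
    MvPolynomial.pderiv p φ * MvPolynomial.pderiv q ψ * genBracket b p.1 p.2 q.1 q.2)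
  + ∑ p : Curve n g × ι,
    (MvPolynomial.pderiv p φ * mapCoeff (jField b p.1 p.2) ψ
      - MvPolynomial.pderiv p ψ * mapCoeff (jField b p.1 p.2) φ)

theorem jField_of_const (X : Curve n g) (a : ι) {F : Coeff E n g G} (r : ℝ) (hF : ∀ u, F u = r) :
    jField b X a F = 0 := by
  have hR : ∀ Y ξ, JR Y ξ F = 0 := fun Y ξ => by
    ext u
    have h : dirDeriv (E := E) (fun _ : G => r) ξ = 0 := by
      rw [dirDeriv, mfderiv_const]; rfl
    simpa [JR, hF] using h
  have hL : ∀ Y ξ, JL Y ξ F = 0 := fun Y ξ => by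
    ext u
    have h : dirDeriv (E := E) (fun _ : G => r) ξ = 0 := by
      rw [dirDeriv, mfderiv_const]; rfl
    simpa [JL, hF] using h
  cases X <;> simp [jField, hR, hL]

theorem mapCoeff_gen (X Y : Curve n g) (a c : ι) :
    mapCoeff (jField b X a) (gen E G Y c) = 0 := by
  refine Finset.sum_eq_zero fun m _ => ?_
  rw [gen, MvPolynomial.coeff_X]
  split_ifs
  · rw [jField_of_const b X a 1 (fun _ => rfl), map_zero]
  · rw [jField_of_const b X a 0 (fun _ => rfl), map_zero]

theorem mapCoeff_fn (X : Curve n g) (a : ι) (F : Coeff E n g G) :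
    mapCoeff (jField b X a) (fn ι F) = fn ι (jField b X a F) := by
  classical
  rw [mapCoeff, Finset.sum_subset (Finset.subset_insert 0 _) (fun m _ hm => ?_)]
  · rw [Finset.sum_eq_single 0]
    · rw [fn, MvPolynomial.coeff_zero_C]; rfl
    · intro m _ hm
      rw [fn, MvPolynomial.coeff_C, if_neg (Ne.symm hm), jField_of_const b X a 0 (fun _ => rfl),
        map_zero]
    · intro h; exact absurd (Finset.mem_insert_self _ _) h
  · rw [MvPolynomial.notMem_support_iff.1 hm, jField_of_const b X a 0 (fun _ => rfl), map_zero]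

theorem bracket_gen_gen (X Y : Curve n g) (a c : ι) :
    bracket b (gen E G X a) (gen E G Y c) = genBracket b X a Y c := by
  simp only [bracket, mapCoeff_gen, mul_zero, sub_zero, Finset.sum_const_zero, add_zero]
  simp only [gen, MvPolynomial.pderiv_X, Pi.single_apply, ite_mul, one_mul, zero_mul]
  simp [Finset.sum_ite_eq]

theorem bracket_gen_fn (X : Curve n g) (a : ι) (F : Coeff E n g G) :
    bracket b (gen E G X a) (fn ι F) = fn ι (jField b X a F) := by
  simp only [bracket, mapCoeff_gen, mapCoeff_fn]
  simp only [gen, fn, MvPolynomial.pderiv_X, MvPolynomial.pderiv_C, Pi.single_apply]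
  simp

theorem bracket_fn_fn (F F' : Coeff E n g G) : bracket b (fn ι F) (fn ι F') = 0 := by
  simp [bracket, fn]

/-- The element `j_a^{H_k}` attached to the `k`-th handle:
`(δ_a^c - Ad^*(u_A⁻¹ u_B⁻¹ u_A)_a^c) j_c^A + (Ad^*(u_A⁻¹ u_B⁻¹ u_A) - Ad^*(u_B⁻¹ u_A))_a^c j_c^B`
with `A = A_k` and `B = B_k`. -/
def jH (k : Fin g) (a : ι) : Flower E n g G ι :=
  let A : FreeGroup (Curve n g) := Curve.word (.A k)
  let B : FreeGroup (Curve n g) := Curve.word (.B k)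
  (∑ c, fn ι (oneSubAdW b (A⁻¹ * B⁻¹ * A) a c) * gen E G (.A k) c)
  + ∑ c, fn ι (adW b (A⁻¹ * B⁻¹ * A) a c - adW b (B⁻¹ * A) a c) * gen E G (.B k) c

/-- The element `j_a^{tot}`: the sum of `Ad^*(u_{M_{i-1}} ⋯ u_{M_1})_a^c j_c^{M_i}` over the
punctures and of `Ad^*(u_{K_{k-1}} ⋯ u_{K_1} u_{M_n} ⋯ u_{M_1})_a^c j_c^{H_k}` over the handles. -/
def jTot (n g : ℕ) (a : ι) : Flower E n g G ι :=
  (∑ i : Fin n, ∑ c, gen E G (.M i) c * fn ι (adW b (Curve.prodM n g 0 i) a c))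
  + ∑ k : Fin g, ∑ c, fn ι (adW b (Curve.prodK n g 0 k * Curve.prodM n g 0 n) a c) * jH b k c

/-- The decoupled generator `j_a^{M_i'}`. -/
def jM' (i : Fin n) (a : ι) : Flower E n g G ι :=
  gen E G (.M i) a - ∑ c, fn ι (oneSubAdW b (Curve.word (.M i)) a c) *
    ((∑ k : Fin n with i < k, ∑ d, fn ι (adW b (Curve.prodM n g (i + 1) k) c d) * gen E G (.M k) d)
    + ∑ k : Fin g, ∑ d,
        fn ι (adW b (Curve.prodK n g 0 k * Curve.prodM n g (i + 1) n) c d) * jH b k d)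

/-- The sum over the handles after the `k`-th one that enters the decoupled generators of the
`k`-th handle. -/
def handleTail (k : Fin g) (a : ι) : Flower E n g G ι :=
  ∑ l : Fin g with k < l, ∑ c, fn ι (adW b (Curve.prodK n g (k + 1) l) a c) * jH b l c

/-- The decoupled generator `j_a^{A_k'}`. -/
def jA' (k : Fin g) (a : ι) : Flower E n g G ι :=
  let A : FreeGroup (Curve n g) := Curve.word (.A k)
  let B : FreeGroup (Curve n g) := Curve.word (.B k)
  gen E G (.A k) a + (∑ c, fn ι (adW b A⁻¹ a c) * (gen E G (.A k) c - gen E G (.B k) c))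
  + ∑ c, fn ι (adW b A a c - adW b (B * A⁻¹) a c) * handleTail b k c

/-- The decoupled generator `j_a^{B_k'}`. -/
def jB' (k : Fin g) (a : ι) : Flower E n g G ι :=
  let A : FreeGroup (Curve n g) := Curve.word (.A k)
  let B : FreeGroup (Curve n g) := Curve.word (.B k)
  gen E G (.B k) a + (∑ c, fn ι (adW b A⁻¹ a c) * (gen E G (.A k) c - gen E G (.B k) c))
  + ∑ c, fn ι (adW b B a c - adW b (B * A⁻¹) a c) * handleTail b k c

end Action
end FlowerAlgebra

end

open FlowerAlgebra

/-! Everything is expressed through left translations of the holonomies. Since `J^R_ξ` at `u` is, up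
to convention, left translation by `Ad(u)ξ`, the derivation `{j^X(x), ·}` with `j^X(x) = ∑ x_a
j_a^X` moves every `u_Y` from the left by a vector `anchor X Y x`, built from the operators
`Ad(u_Z)`. Letters before the block of `X` stay fixed. A later `u_Y` moves by `(1 - Ad u_Y)(1 - Ad
u_X)x`, that is, it is conjugated infinitesimally by `(1 - Ad u_X)x`. Inside a handle there are a
few explicit terms. `FlowerCalculus` isolates what is needed about `G`: `Ad` is multiplicative and
respects the Lie bracket, left translations commute up to minus the bracket, and `Ad(u)`
differentiates to `[ξ, Ad(u) ·]`. `calculus` shows that `G^{n+2g}` satisfies this, and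
`bracket_eq_bra` identifies the two brackets.

The automorphism for `(h, f)` is the conjugation by `h` followed by the shift `j ↦ j + {j, F}` with
`F = f ∘ Φ_∞`. The shift is the time-one flow of `{·, F}`, which stops at first order because
functions commute with each other. It therefore respects the bracket once the Jacobi identity holds
for two generators and one function (`map_linBracket`); the identity for three generators is never
needed. This identity says that the commutator of two anchor fields is again an anchor field. It is
proved component by component (`commAt_of_lt`, `commAt_of_rank_eq`), using that all letters after
`X` are twisted by one common vector. Conjugation respects the bracket because all its ingredients
are equivariant (`symm_conj`). The composition law of the semidirect product comes from `Φ_∞(huh⁻¹)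
= h Φ_∞(u) h⁻¹`.

That `j^{tot}` generates conjugation is a telescoping argument. The coefficients of each block
satisfy `∑ (1 - Ad u_Y) c_Y = 1 - Ad(block)`, so the contributions of the earlier blocks add up to
`1 - Ad(prefix)` and the block of the letter itself supplies the missing prefix term
(`sum_anchor_totCoeff`, `bra_X_tot`). On functions this gives infinitesimal global conjugation, and
on generators the adjoint action. Both sides of the derivative formula obey the Leibniz rule, so
checking coefficients and generators suffices (`hasDerivAt_evalAt`). The decoupled formula for
`j^{tot}` is a second, purely linear telescoping (`tot_eq_decoupled`). -/

noncomputable section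
namespace FlowerAlgebra

/-! ### Derivatives at the unit of a Lie group, and the Lie bracket as a second derivative. -/

section DirDeriv

variable {E : Type*} [NormedAddCommGroup E] [NormedSpace ℝ E]
  {G : Type*} [TopologicalSpace G] [ChartedSpace E G]

theorem contMDiff_uncurry_left {Φ : G → G → ℝ}
    (hΦ : ContMDiff (𝓘(ℝ, E).prod 𝓘(ℝ, E)) 𝓘(ℝ, ℝ) ∞ (Function.uncurry Φ)) (x : G) :
    ContMDiff 𝓘(ℝ, E) 𝓘(ℝ, ℝ) ∞ (Φ x) :=
  hΦ.comp (contMDiff_const.prodMk contMDiff_id)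

theorem contMDiff_uncurry_swap {Φ : G → G → ℝ}
    (hΦ : ContMDiff (𝓘(ℝ, E).prod 𝓘(ℝ, E)) 𝓘(ℝ, ℝ) ∞ (Function.uncurry Φ)) :
    ContMDiff (𝓘(ℝ, E).prod 𝓘(ℝ, E)) 𝓘(ℝ, ℝ) ∞ (Function.uncurry fun y x => Φ x y) :=
  hΦ.comp (contMDiff_snd.prodMk contMDiff_fst)

variable [Group G]

theorem dirDeriv_eq_fderiv {f : G → ℝ} (hf : ContMDiff 𝓘(ℝ, E) 𝓘(ℝ, ℝ) ∞ f)
    (ξ : GroupLieAlgebra 𝓘(ℝ, E) G) :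
    dirDeriv f ξ = fderiv ℝ (f ∘ (extChartAt 𝓘(ℝ, E) (1 : G)).symm)
      (extChartAt 𝓘(ℝ, E) (1 : G) 1) ξ := by
  have h := (hf.mdifferentiable (by simp) 1).mfderiv
  rw [modelWithCornersSelf_coe, Set.range_id, fderivWithin_univ] at h
  exact congrArg (fun L => L ξ) h

theorem contDiffAt_comp_chart {f : G → ℝ} [IsManifold 𝓘(ℝ, E) ∞ G]
    (hf : ContMDiff 𝓘(ℝ, E) 𝓘(ℝ, ℝ) ∞ f) {w : E} (hw : w ∈ (extChartAt 𝓘(ℝ, E) (1 : G)).target) :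
    ContDiffAt ℝ ∞ (f ∘ (extChartAt 𝓘(ℝ, E) (1 : G)).symm) w := by
  rw [← contMDiffAt_iff_contDiffAt]
  exact (hf _).comp w ((contMDiffOn_extChartAt_symm (I := 𝓘(ℝ, E)) (n := ∞) (1 : G)).contMDiffAt
    ((isOpen_extChartAt_target (I := 𝓘(ℝ, E)) (1 : G)).mem_nhds hw))

/-- Chain rule along the diagonal. The later product rules in the group (inverses, conjugation,
several coordinates at once) are obtained by separating the occurrences of `x` in this way. -/
theorem dirDeriv_diag [IsManifold 𝓘(ℝ, E) ∞ G] {Φ : G → G → ℝ}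
    (hΦ : ContMDiff (𝓘(ℝ, E).prod 𝓘(ℝ, E)) 𝓘(ℝ, ℝ) ∞ (Function.uncurry Φ))
    (ξ : GroupLieAlgebra 𝓘(ℝ, E) G) :
    dirDeriv (fun x => Φ x x) ξ = dirDeriv (fun x => Φ x 1) ξ + dirDeriv (fun x => Φ 1 x) ξ := by
  have h1 : MDifferentiableAt (𝓘(ℝ, E).prod 𝓘(ℝ, E)) 𝓘(ℝ, ℝ) (Function.uncurry Φ) ((1, 1) : G × G) :=
    hΦ.mdifferentiable (by simp) _
  have h2 : MDifferentiableAt 𝓘(ℝ, E) (𝓘(ℝ, E).prod 𝓘(ℝ, E)) (fun x : G => (x, x)) 1 :=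
    mdifferentiableAt_id.prodMk mdifferentiableAt_id
  have e := mfderiv_comp (1 : G) (g := Function.uncurry Φ) (f := fun x : G => (x, x)) h1 h2
  have e2 := mfderiv_prod_eq_add_apply h1 (v := mfderiv 𝓘(ℝ, E) (𝓘(ℝ, E).prod 𝓘(ℝ, E)) (fun x : G => (x, x)) 1 ξ)
  have e3 : mfderiv 𝓘(ℝ, E) (𝓘(ℝ, E).prod 𝓘(ℝ, E)) (fun x : G => (x, x)) 1 ξ = (ξ, ξ) := by
    have := (mdifferentiableAt_id (I := 𝓘(ℝ, E)) (x := (1 : G))).mfderiv_prod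
      (mdifferentiableAt_id (I := 𝓘(ℝ, E)) (x := (1 : G)))
    exact (congrArg (fun L => L ξ) this).trans (by simp [mfderiv_id]; rfl)
  rw [e3] at e2
  exact (congrArg (fun L => L ξ) e).trans ((congrArg _ e3).trans e2)

/-- Both sides are values of the second Fréchet derivative of `Ψ` on `(ξ, 0)` and `(0, η)`, so
symmetry of that derivative gives the claim. -/
theorem fderiv_fst_snd_comm {E : Type*} [NormedAddCommGroup E] [NormedSpace ℝ E]
    {Ψ : E × E → ℝ} {a c : E} (h : ContDiffAt ℝ ∞ Ψ (a, c)) (ξ η : E) :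
    fderiv ℝ (fun w => fderiv ℝ (fun z => Ψ (w, z)) c η) a ξ =
      fderiv ℝ (fun z => fderiv ℝ (fun w => Ψ (w, z)) a ξ) c η := by
  have hs := h.isSymmSndFDerivAt (by
    rw [minSmoothness_of_isRCLikeNormedField]
    exact WithTop.coe_le_coe.2 (le_top : (2 : ℕ∞) ≤ ⊤))
  have hd : ∀ᶠ p in nhds (a, c), DifferentiableAt ℝ Ψ p := by
    have := (h.of_le (m := 1) (by exact_mod_cast le_top)).eventually (by simp)
    filter_upwards [this] with p hp using hp.differentiableAt (by simp)
  have hd2 : DifferentiableAt ℝ (fderiv ℝ Ψ) (a, c) :=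
    (h.fderiv_right (m := 1) (by norm_cast)).differentiableAt (by simp)
  have ev1 : (fun w => fderiv ℝ (fun z => Ψ (w, z)) c η) =ᶠ[nhds a]
      fun w => fderiv ℝ Ψ (w, c) (0, η) := by
    have : Filter.Tendsto (fun w : E => (w, c)) (nhds a) (nhds (a, c)) :=
      (by fun_prop : Continuous fun w : E => (w, c)).continuousAt
    filter_upwards [this.eventually hd] with w hw
    have h2 : HasFDerivAt (fun z : E => (w, z)) (ContinuousLinearMap.inr ℝ E E) c := hasFDerivAt_prodMk_right w c
    have := hw.hasFDerivAt.comp c h2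
    rw [show (fun z => Ψ (w, z)) = Ψ ∘ (fun z => (w, z)) from rfl, this.fderiv]
    simp
  have ev2 : (fun z => fderiv ℝ (fun w => Ψ (w, z)) a ξ) =ᶠ[nhds c]
      fun z => fderiv ℝ Ψ (a, z) (ξ, 0) := by
    have : Filter.Tendsto (fun z : E => (a, z)) (nhds c) (nhds (a, c)) :=
      (by fun_prop : Continuous fun z : E => (a, z)).continuousAt
    filter_upwards [this.eventually hd] with w hw
    have h2 : HasFDerivAt (fun z : E => (z, w)) (ContinuousLinearMap.inl ℝ E E) a := hasFDerivAt_prodMk_left a w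
    have := hw.hasFDerivAt.comp a h2
    rw [show (fun z => Ψ (z, w)) = Ψ ∘ (fun z => (z, w)) from rfl, this.fderiv]
    simp
  rw [ev1.fderiv_eq, ev2.fderiv_eq]
  have k1 := (hd2.hasFDerivAt.comp a (hasFDerivAt_prodMk_left (𝕜 := ℝ) a c)).clm_apply (hasFDerivAt_const ((0, η) : E × E) a)
  have k2 := (hd2.hasFDerivAt.comp c (hasFDerivAt_prodMk_right (𝕜 := ℝ) a c)).clm_apply (hasFDerivAt_const ((ξ, 0) : E × E) c)
  have k1' := congrArg (fun L => L ξ) k1.fderiv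
  have k2' := congrArg (fun L => L η) k2.fderiv
  simp only [Function.comp_def] at k1' k2'
  rw [k1', k2']
  simpa using hs (ξ, 0) (0, η)

variable [LieGroup 𝓘(ℝ, E) ∞ G]

variable (E G) in
theorem isManifold_lieGroup : IsManifold 𝓘(ℝ, E) ∞ G :=
  have := contMDiffMul (E := E) (G := G)
  ContMDiffMul.toIsManifold

theorem dirDeriv_comm {Φ : G → G → ℝ}
    (hΦ : ContMDiff (𝓘(ℝ, E).prod 𝓘(ℝ, E)) 𝓘(ℝ, ℝ) ∞ (Function.uncurry Φ))
    (ξ η : GroupLieAlgebra 𝓘(ℝ, E) G) :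
    dirDeriv (fun x => dirDeriv (fun y => Φ x y) η) ξ =
      dirDeriv (fun y => dirDeriv (fun x => Φ x y) ξ) η := by
  have := isManifold_lieGroup E G
  have hΦ' := contMDiff_uncurry_swap hΦ
  rw [dirDeriv_eq_fderiv (contMDiff_dirDeriv hΦ η), dirDeriv_eq_fderiv (contMDiff_dirDeriv hΦ' ξ)]
  set φ := extChartAt 𝓘(ℝ, E) (1 : G) with hφ
  have e1 : (fun x => dirDeriv (fun y => Φ x y) η) ∘ φ.symm = fun w => fderiv ℝ
      (fun z => Function.uncurry Φ (φ.symm w, φ.symm z)) (φ 1) η := by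
    ext w
    exact dirDeriv_eq_fderiv (contMDiff_uncurry_left hΦ _) η
  have e2 : (fun y => dirDeriv (fun x => Φ x y) ξ) ∘ φ.symm = fun z => fderiv ℝ
      (fun w => Function.uncurry Φ (φ.symm w, φ.symm z)) (φ 1) ξ := by
    ext w
    exact dirDeriv_eq_fderiv (contMDiff_uncurry_left hΦ' _) ξ
  rw [e1, e2]
  refine fderiv_fst_snd_comm (Ψ := fun p => Function.uncurry Φ (φ.symm p.1, φ.symm p.2)) ?_ ξ η
  have hs : ContMDiffAt 𝓘(ℝ, E) 𝓘(ℝ, E) ∞ φ.symm (φ 1) :=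
    (contMDiffOn_extChartAt_symm (I := 𝓘(ℝ, E)) (n := ∞) (1 : G)).contMDiffAt
    ((isOpen_extChartAt_target (I := 𝓘(ℝ, E)) (1 : G)).mem_nhds (mem_extChartAt_target 1))
  rw [← contMDiffAt_iff_contDiffAt]
  have h1 : ContMDiffAt 𝓘(ℝ, E × E) 𝓘(ℝ, E) ∞ (fun p : E × E => φ.symm p.1) (φ 1, φ 1) :=
    ContMDiffAt.comp (φ 1, φ 1) (f := Prod.fst) hs contDiff_fst.contMDiff.contMDiffAt
  have h2 : ContMDiffAt 𝓘(ℝ, E × E) 𝓘(ℝ, E) ∞ (fun p : E × E => φ.symm p.2) (φ 1, φ 1) :=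
    ContMDiffAt.comp (φ 1, φ 1) (f := Prod.snd) hs contDiff_snd.contMDiff.contMDiffAt
  exact (hΦ _).comp (φ 1, φ 1) (h1.prodMk h2)

/-- The derivative of `f` along a left-invariant vector field. -/
theorem dirDeriv_mul_left {f : G → ℝ} (hf : ContMDiff 𝓘(ℝ, E) 𝓘(ℝ, ℝ) ∞ f) (x : G)
    (ξ : GroupLieAlgebra 𝓘(ℝ, E) G) :
    dirDeriv (fun y => f (x * y)) ξ =
      mfderiv 𝓘(ℝ, E) 𝓘(ℝ, ℝ) f x (mulInvariantVectorField ξ x) := by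
  have := contMDiffMul (E := E) (G := G)
  have h1 : MDifferentiableAt 𝓘(ℝ, E) 𝓘(ℝ, E) (x * ·) (1 : G) :=
    (contMDiff_mul_left (I := 𝓘(ℝ, E)) (n := ∞) (a := x)).mdifferentiableAt (by simp)
  have e := mfderiv_comp_of_eq (x := (1 : G)) (y := x) (g := f) (f := (x * ·))
    (hf.mdifferentiable (by simp) _) h1 (mul_one x)
  -- Tangent spaces depend on the base point, so `x * 1 = x` is substituted at a variable point,
  -- with vectors typed in the model space. The same device recurs below.
  have e2 : ∀ z, z = x → ∀ v : E, (mfderiv 𝓘(ℝ, E) 𝓘(ℝ, ℝ) f z : E →L[ℝ] ℝ) v =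
      (mfderiv 𝓘(ℝ, E) 𝓘(ℝ, ℝ) f x : E →L[ℝ] ℝ) v := by
    rintro z rfl v
    rfl
  exact (congrArg (fun L => L ξ) e).trans (e2 _ (mul_one x) _)

theorem contMDiff_uncurry_mul {f : G → ℝ} (hf : ContMDiff 𝓘(ℝ, E) 𝓘(ℝ, ℝ) ∞ f) :
    ContMDiff (𝓘(ℝ, E).prod 𝓘(ℝ, E)) 𝓘(ℝ, ℝ) ∞ (Function.uncurry fun x y : G => f (x * y)) := by
  have := contMDiffMul (E := E) (G := G)
  exact hf.comp (contMDiff_fst.mul contMDiff_snd)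

/-- The function `x ↦ dirDeriv (fun y => f (x * y)) η` is the derivative of `f` along the
left-invariant field of `η`, and the bracket on the Lie algebra is that of left-invariant fields.
The formula is the commutator of these fields, computed in the chart at the unit. -/
theorem dirDeriv_lie [CompleteSpace E] {f : G → ℝ} (hf : ContMDiff 𝓘(ℝ, E) 𝓘(ℝ, ℝ) ∞ f)
    (ξ η : GroupLieAlgebra 𝓘(ℝ, E) G) :
    dirDeriv f ⁅ξ, η⁆ = dirDeriv (fun x => dirDeriv (fun y => f (x * y)) η) ξ
      - dirDeriv (fun x => dirDeriv (fun y => f (x * y)) ξ) η := by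
  have hM := isManifold_lieGroup E G
  have hM2 : IsManifold 𝓘(ℝ, E) 2 G :=
    IsManifold.of_le (n := ∞) (WithTop.coe_le_coe.2 (le_top : (2 : ℕ∞) ≤ ⊤))
  have hM1 : IsManifold 𝓘(ℝ, E) 1 G := IsManifold.of_le (n := ∞) (by exact_mod_cast le_top)
  have : LieGroup 𝓘(ℝ, E) (minSmoothness ℝ 3) G := LieGroup.of_le (n := ∞) (by
    rw [minSmoothness_of_isRCLikeNormedField]; exact WithTop.coe_le_coe.2 (le_top : (3 : ℕ∞) ≤ ⊤))
  rw [dirDeriv_eq_fderiv hf, dirDeriv_eq_fderiv (contMDiff_dirDeriv (contMDiff_uncurry_mul hf) η),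
    dirDeriv_eq_fderiv (contMDiff_dirDeriv (contMDiff_uncurry_mul hf) ξ)]
  set φ := extChartAt 𝓘(ℝ, E) (1 : G) with hφ
  let V (ζ : GroupLieAlgebra 𝓘(ℝ, E) G) : E → E :=
    VectorField.mpullbackWithin 𝓘(ℝ, E) 𝓘(ℝ, E) φ.symm (mulInvariantVectorField ζ)
      (Set.range 𝓘(ℝ, E))
  have hU : φ.symm ⁻¹' Set.univ ∩ Set.range 𝓘(ℝ, E) = Set.univ := by
    rw [Set.preimage_univ, Set.univ_inter, modelWithCornersSelf_coe, Set.range_id]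
  have hV1 (ζ) : V ζ (φ 1) = ζ := by
    refine (congrArg (mfderivWithin 𝓘(ℝ, E) 𝓘(ℝ, E) φ.symm (Set.range 𝓘(ℝ, E)) (φ 1)).inverse
      ?_).trans (mfderivWithin_extChartAt_symm_inverse_apply (I := 𝓘(ℝ, E)) (x := (1 : G)) ζ)
    have e1 : (mulInvariantVectorField ζ (1 : G) : E) = ζ := by
      have : ((1 : G) * ·) = id := by ext; simp
      rw [mulInvariantVectorField, this, mfderiv_id]
      rfl
    have e2 : ∀ z : G, z = 1 → (mulInvariantVectorField ζ z : E) = ζ := by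
      rintro z rfl
      exact e1
    exact e2 _ (extChartAt_to_inv (I := 𝓘(ℝ, E)) (1 : G))
  have hV (ζ) : DifferentiableAt ℝ (V ζ) (φ 1) := by
    have h0 := (mdifferentiable_mulInvariantVectorField (I := 𝓘(ℝ, E)) (G := G) ζ 1)
    have := h0.mdifferentiableWithinAt (s := Set.univ) |>.differentiableWithinAt_mpullbackWithin_vectorField
    exact differentiableWithinAt_univ.1 (hU ▸ this)
  -- Agreement on a whole neighbourhood is needed, since both sides are differentiated once more.
  have ev (ζ) : (fun x => dirDeriv (fun y => f (x * y)) ζ) ∘ φ.symm =ᶠ[nhds (φ 1)]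
      fun w => fderiv ℝ (f ∘ φ.symm) w (V ζ w) := by
    filter_upwards [(isOpen_extChartAt_target (I := 𝓘(ℝ, E)) (1 : G)).mem_nhds
      (mem_extChartAt_target (1 : G))] with w hw
    refine (dirDeriv_mul_left hf _ ζ).trans ?_
    have hi := isInvertible_mfderivWithin_extChartAt_symm (I := 𝓘(ℝ, E)) hw
    have hs := mdifferentiableWithinAt_extChartAt_symm (I := 𝓘(ℝ, E)) hw
    have hs' : MDifferentiableAt 𝓘(ℝ, E) 𝓘(ℝ, E) φ.symm w := by
      rwa [modelWithCornersSelf_coe, Set.range_id, mdifferentiableWithinAt_univ] at hs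
    have e := mfderiv_comp w (hf.mdifferentiable (by simp) _) hs'
    have e2 : mfderiv 𝓘(ℝ, E) 𝓘(ℝ, E) φ.symm w (V ζ w) = mulInvariantVectorField ζ (φ.symm w) := by
      rw [modelWithCornersSelf_coe, Set.range_id, mfderivWithin_univ] at hi
      obtain ⟨L, hL⟩ := hi
      simp only [V, VectorField.mpullbackWithin_apply, modelWithCornersSelf_coe, Set.range_id,
        mfderivWithin_univ]
      rw [← hL, ContinuousLinearMap.inverse_equiv]
      exact L.apply_symm_apply _
    have e3 := congrArg (fun L => L (V ζ w)) e
    rw [mfderiv_eq_fderiv] at e3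
    exact (e3.trans (congrArg (mfderiv 𝓘(ℝ, E) 𝓘(ℝ, ℝ) f (φ.symm w)) e2)).symm
  have key := VectorField.fderiv_apply_lieBracket (V := V ξ) (W := V η)
    (contDiffAt_comp_chart hf (mem_extChartAt_target (1 : G)))
    (by rw [minSmoothness_of_isRCLikeNormedField]
        exact WithTop.coe_le_coe.2 (le_top : (2 : ℕ∞) ≤ ⊤)) (hV η) (hV ξ)
  rw [(ev ξ).fderiv_eq, (ev η).fderiv_eq]
  -- The derivative of the preferred chart at its own base point is the identity, so the bracket in
  -- the chart is the Lie algebra bracket without a correction.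
  have hb : ⁅ξ, η⁆ = VectorField.lieBracket ℝ (V ξ) (V η) (φ 1) := by
    refine (VectorField.mlieBracketWithin_apply (I := 𝓘(ℝ, E)) (s := Set.univ) (x₀ := (1 : G))).trans ?_
    refine (congrArg (fun L => ContinuousLinearMap.inverse L _)
      (mfderiv_extChartAt_self (I := 𝓘(ℝ, E)) (x := (1 : G)))).trans ?_
    refine (congrArg (fun L : E →L[ℝ] E => L _) ContinuousLinearMap.inverse_id).trans ?_
    rw [← VectorField.lieBracketWithin_univ, ← hU]
    rfl
  rw [hV1, hV1] at key
  rw [hb]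
  exact key

end DirDeriv

/-! ### The adjoint action: multiplicativity, compatibility with the bracket, derivative. -/

section AdjointAction

variable {E : Type*} [NormedAddCommGroup E] [NormedSpace ℝ E]
  {G : Type*} [TopologicalSpace G] [ChartedSpace E G] [Group G]

theorem dirDeriv_vec_add (f : G → ℝ) (ξ η : GroupLieAlgebra 𝓘(ℝ, E) G) :
    dirDeriv f (ξ + η) = dirDeriv f ξ + dirDeriv f η :=
  map_add (mfderiv 𝓘(ℝ, E) 𝓘(ℝ, ℝ) f (1 : G)) ξ η

theorem dirDeriv_vec_smul (f : G → ℝ) (r : ℝ) (ξ : GroupLieAlgebra 𝓘(ℝ, E) G) :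
    dirDeriv f (r • ξ) = r * dirDeriv f ξ :=
  map_smul (mfderiv 𝓘(ℝ, E) 𝓘(ℝ, ℝ) f (1 : G)) r ξ

/-- `dirDeriv f` as a linear form on the Lie algebra. -/
def dirDerivLin (f : G → ℝ) : GroupLieAlgebra 𝓘(ℝ, E) G →ₗ[ℝ] ℝ where
  toFun := dirDeriv f
  map_add' := dirDeriv_vec_add f
  map_smul' := dirDeriv_vec_smul f

theorem dirDeriv_vec_sum {κ : Type*} (s : Finset κ) (f : G → ℝ) (r : κ → ℝ)
    (ξ : κ → GroupLieAlgebra 𝓘(ℝ, E) G) :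
    dirDeriv f (∑ k ∈ s, r k • ξ k) = ∑ k ∈ s, r k * dirDeriv f (ξ k) :=
  (map_sum (dirDerivLin f) _ s).trans (Finset.sum_congr rfl fun _ _ => dirDeriv_vec_smul f _ _)

theorem dirDeriv_add {f f' : G → ℝ} (hf : ContMDiff 𝓘(ℝ, E) 𝓘(ℝ, ℝ) ∞ f)
    (hf' : ContMDiff 𝓘(ℝ, E) 𝓘(ℝ, ℝ) ∞ f') (ξ : GroupLieAlgebra 𝓘(ℝ, E) G) :
    dirDeriv (fun x => f x + f' x) ξ = dirDeriv f ξ + dirDeriv f' ξ :=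
  congrArg (fun L : E →L[ℝ] ℝ => L ξ)
    (mfderiv_add (hf.mdifferentiable (by simp) 1) (hf'.mdifferentiable (by simp) 1))

theorem dirDeriv_mul {f f' : G → ℝ} (hf : ContMDiff 𝓘(ℝ, E) 𝓘(ℝ, ℝ) ∞ f)
    (hf' : ContMDiff 𝓘(ℝ, E) 𝓘(ℝ, ℝ) ∞ f') (ξ : GroupLieAlgebra 𝓘(ℝ, E) G) :
    dirDeriv (fun x => f x * f' x) ξ = f 1 * dirDeriv f' ξ + dirDeriv f ξ * f' 1 := by
  have := (hf.mdifferentiable (by simp) 1).hasMFDerivAt.mul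
    (hf'.mdifferentiable (by simp) 1).hasMFDerivAt
  exact (congrArg (fun L : E →L[ℝ] ℝ => L ξ) this.mfderiv).trans (by
    change f 1 * dirDeriv f' ξ + f' 1 * dirDeriv f ξ = _
    ring)

theorem dirDeriv_const (r : ℝ) (ξ : GroupLieAlgebra 𝓘(ℝ, E) G) :
    dirDeriv (fun _ : G => r) ξ = 0 := by
  rw [dirDeriv, mfderiv_const]
  rfl

theorem dirDeriv_sum {κ : Type*} (s : Finset κ) {f : κ → G → ℝ}
    (hf : ∀ k, ContMDiff 𝓘(ℝ, E) 𝓘(ℝ, ℝ) ∞ (f k)) (ξ : GroupLieAlgebra 𝓘(ℝ, E) G) :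
    dirDeriv (fun x => ∑ k ∈ s, f k x) ξ = ∑ k ∈ s, dirDeriv (f k) ξ := by
  classical
  induction s using Finset.induction_on with
  | empty => simpa using dirDeriv_const 0 ξ
  | insert k s hk ih =>
    simp only [Finset.sum_insert hk]
    rw [dirDeriv_add (hf k) (contMDiff_finsetSum fun i _ => hf i), ih]

theorem dirDeriv_comp_of_map_one {f : G → ℝ} (hf : ContMDiff 𝓘(ℝ, E) 𝓘(ℝ, ℝ) ∞ f) {k : G → G}
    (hk : ContMDiff 𝓘(ℝ, E) 𝓘(ℝ, E) ∞ k) (h1 : k 1 = 1) (ξ : GroupLieAlgebra 𝓘(ℝ, E) G) :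
    dirDeriv (fun x => f (k x)) ξ =
      dirDeriv f (show E from mfderiv 𝓘(ℝ, E) 𝓘(ℝ, E) k (1 : G) ξ) := by
  have e := mfderiv_comp (x := (1 : G)) (g := f) (f := k)
    (hf.mdifferentiable (by simp) _) (hk.mdifferentiable (by simp) _)
  have e2 : ∀ z : G, z = 1 → ∀ v : E, (mfderiv 𝓘(ℝ, E) 𝓘(ℝ, ℝ) f z : E →L[ℝ] ℝ) v =
      (mfderiv 𝓘(ℝ, E) 𝓘(ℝ, ℝ) f (1 : G) : E →L[ℝ] ℝ) v := by
    rintro z rfl v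
    rfl
  exact (congrArg (fun L => L ξ) e).trans (e2 _ h1 _)

variable [LieGroup 𝓘(ℝ, E) ∞ G]

theorem contMDiff_comp_conj {f : G → ℝ} (hf : ContMDiff 𝓘(ℝ, E) 𝓘(ℝ, ℝ) ∞ f) (h : G) :
    ContMDiff 𝓘(ℝ, E) 𝓘(ℝ, ℝ) ∞ (fun x => f (h * x * h⁻¹)) :=
  hf.comp (conj h).contMDiff

theorem dirDeriv_conj {f : G → ℝ} (hf : ContMDiff 𝓘(ℝ, E) 𝓘(ℝ, ℝ) ∞ f) (h : G)
    (ξ : GroupLieAlgebra 𝓘(ℝ, E) G) :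
    dirDeriv (fun x => f (h * x * h⁻¹)) ξ = dirDeriv f (Ad h ξ) :=
  dirDeriv_comp_of_map_one hf (conj h).contMDiff (by change h * 1 * h⁻¹ = 1; simp) ξ

theorem contMDiff_comp_mul_right {f : G → ℝ} (hf : ContMDiff 𝓘(ℝ, E) 𝓘(ℝ, ℝ) ∞ f) (u : G) :
    ContMDiff 𝓘(ℝ, E) 𝓘(ℝ, ℝ) ∞ (fun x => f (x * u)) := by
  have := contMDiffMul (E := E) (G := G)
  exact hf.comp (contMDiff_id.mul contMDiff_const)

theorem contMDiff_comp_mul_left {f : G → ℝ} (hf : ContMDiff 𝓘(ℝ, E) 𝓘(ℝ, ℝ) ∞ f) (u : G) :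
    ContMDiff 𝓘(ℝ, E) 𝓘(ℝ, ℝ) ∞ (fun x => f (u * x)) := by
  have := contMDiffMul (E := E) (G := G)
  exact hf.comp (contMDiff_const.mul contMDiff_id)

/-- Since `f (x * x⁻¹)` is constant, its two partial contributions cancel. -/
theorem dirDeriv_inv {f : G → ℝ} (hf : ContMDiff 𝓘(ℝ, E) 𝓘(ℝ, ℝ) ∞ f)
    (ξ : GroupLieAlgebra 𝓘(ℝ, E) G) :
    dirDeriv (fun x => f x⁻¹) ξ = - dirDeriv f ξ := by
  have := contMDiffMul (E := E) (G := G)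
  have := isManifold_lieGroup E G
  have h := dirDeriv_diag (Φ := fun x y : G => f (x * y⁻¹))
    (hf.comp (contMDiff_fst.mul contMDiff_snd.inv)) ξ
  simp only [mul_inv_cancel, inv_one, mul_one, one_mul, dirDeriv_const] at h
  linarith

/-- Derivative of `f(k · u)` along a left factor written as a right factor. -/
theorem dirDeriv_mul_right {f : G → ℝ} (hf : ContMDiff 𝓘(ℝ, E) 𝓘(ℝ, ℝ) ∞ f) (u : G)
    (ξ : GroupLieAlgebra 𝓘(ℝ, E) G) :
    dirDeriv (fun x => f (u * x)) ξ = dirDeriv (fun x => f (x * u)) (Ad u ξ) := by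
  rw [← dirDeriv_conj (contMDiff_comp_mul_right hf u)]
  simp

variable [FiniteDimensional ℝ E] [T2Space G]

/-- A linear form on the model space composed with the chart becomes a global smooth function after
multiplication by a bump function, and linear forms separate points. Identities in the Lie algebra
can thus be tested on functions. -/
theorem dirDeriv_ext {ξ η : GroupLieAlgebra 𝓘(ℝ, E) G}
    (h : ∀ f : G → ℝ, ContMDiff 𝓘(ℝ, E) 𝓘(ℝ, ℝ) ∞ f → dirDeriv f ξ = dirDeriv f η) : ξ = η := by
  have := isManifold_lieGroup E G
  have : IsManifold 𝓘(ℝ, E) 1 G := IsManifold.of_le (n := ∞) (by exact_mod_cast le_top)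
  have key : ∀ l : E →L[ℝ] ℝ, l ξ = l η := by
    intro l
    let β : SmoothBumpFunction 𝓘(ℝ, E) (1 : G)   := Classical.arbitrary _
    set φ := extChartAt 𝓘(ℝ, E) (1 : G) with hφ
    have hsm : ContMDiffOn 𝓘(ℝ, E) 𝓘(ℝ, ℝ) ∞ (fun x => l (φ x)) (chartAt E (1 : G)).source :=
      l.contDiff.contMDiff.comp_contMDiffOn (contMDiffOn_extChartAt (I := 𝓘(ℝ, E)))
    have hf := β.contMDiff_smul hsm
    have key (ζ : GroupLieAlgebra 𝓘(ℝ, E) G) : dirDeriv (fun x => β x • l (φ x)) ζ = l ζ := by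
      have e : (fun x => β x • l (φ x)) =ᶠ[nhds (1 : G)] (l ∘ φ) := by
        filter_upwards [β.eventuallyEq_one] with x hx
        simp [hx]
      have h1 : MDifferentiableAt 𝓘(ℝ, E) 𝓘(ℝ, E) φ (1 : G) :=
        mdifferentiableAt_extChartAt (mem_chart_source E (1 : G))
      have h2 := mfderiv_comp (x := (1 : G)) (g := l) (f := φ) (l.differentiableAt.mdifferentiableAt) h1
      rw [dirDeriv, e.mfderiv_eq]
      refine (congrArg (fun L => L ζ) h2).trans ?_
      refine (congrArg (mfderiv 𝓘(ℝ, E) 𝓘(ℝ, ℝ) l (φ 1)) (congrArg (fun L => L ζ)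
        (mfderiv_extChartAt_self (I := 𝓘(ℝ, E)) (x := (1 : G))))).trans ?_
      exact congrArg (fun L : E →L[ℝ] ℝ => L ζ) (mfderiv_eq_fderiv.trans l.fderiv)
    rw [← key ξ, ← key η, h _ hf]
  have : ∀ a b : E, (∀ l : E →L[ℝ] ℝ, l a = l b) → a = b := fun a b h => by
    by_contra hne
    obtain ⟨l, hl⟩ := SeparatingDual.exists_separating_of_ne (R := ℝ) hne
    exact hl (h l)
  exact this _ _ key

theorem Ad_mul (h k : G) (ξ : GroupLieAlgebra 𝓘(ℝ, E) G) : Ad (h * k) ξ = Ad h (Ad k ξ) := by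
  refine dirDeriv_ext fun f hf => ?_
  rw [← dirDeriv_conj hf, ← dirDeriv_conj hf, ← dirDeriv_conj (contMDiff_comp_conj hf h)]
  refine congrArg (fun F => dirDeriv F ξ) (funext fun x => ?_)
  exact congrArg f (by simp [mul_assoc])

theorem Ad_one (ξ : GroupLieAlgebra 𝓘(ℝ, E) G) : Ad (1 : G) ξ = ξ := by
  refine dirDeriv_ext fun f hf => ?_
  rw [← dirDeriv_conj hf]
  simp

/-- Tested on `f`, each bracket is a difference of second derivatives of `f (x * y)`; conjugation by
`h` is a homomorphism and can be substituted in `x` and `y` separately. -/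
theorem Ad_lie (h : G) (ξ η : GroupLieAlgebra 𝓘(ℝ, E) G) : Ad h ⁅ξ, η⁆ = ⁅Ad h ξ, Ad h η⁆ := by
  have := FiniteDimensional.complete ℝ E
  refine dirDeriv_ext fun f hf => ?_
  have key (ξ η : GroupLieAlgebra 𝓘(ℝ, E) G) :
      dirDeriv (fun x => dirDeriv (fun y => f (h * (x * y) * h⁻¹)) η) ξ =
        dirDeriv (fun x => dirDeriv (fun y => f (x * y)) (Ad h η)) (Ad h ξ) := by
    rw [← dirDeriv_conj (contMDiff_dirDeriv (contMDiff_uncurry_mul hf) _)]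
    congr! 2 with x
    rw [← dirDeriv_conj (contMDiff_comp_mul_left hf _)]
    simp [mul_assoc]
  rw [← dirDeriv_conj hf, dirDeriv_lie (contMDiff_comp_conj hf h), dirDeriv_lie hf]
  exact congrArg₂ _ (key ξ η) (key η ξ)

/-- Tested on `f`, the left side differentiates `f (x * y * x⁻¹)`. The factors `x` and `x⁻¹` produce
the two terms of `dirDeriv_lie`, the inverse giving the sign and symmetry of mixed derivatives the
order. -/
theorem dirDeriv_Ad {f : G → ℝ} (hf : ContMDiff 𝓘(ℝ, E) 𝓘(ℝ, ℝ) ∞ f) (u : G)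
    (ξ ζ : GroupLieAlgebra 𝓘(ℝ, E) G) :
    dirDeriv (fun x => dirDeriv f (Ad (x * u) ζ)) ξ = dirDeriv f ⁅ξ, Ad u ζ⁆ := by
  have := FiniteDimensional.complete ℝ E
  have := contMDiffMul (E := E) (G := G)
  have := isManifold_lieGroup E G
  rw [dirDeriv_lie hf]
  have e : (fun x => dirDeriv f (Ad (x * u) ζ)) =
      fun x => dirDeriv (fun y => f (x * y * x⁻¹)) (Ad u ζ) := by
    ext x
    rw [Ad_mul, dirDeriv_conj hf]
  rw [e, dirDeriv_diag (Φ := fun x z => dirDeriv (fun y => f (x * y * z⁻¹)) (Ad u ζ))]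
  · simp only [inv_one, mul_one, one_mul]
    rw [sub_eq_add_neg, add_right_inj,
      dirDeriv_inv (f := fun z => dirDeriv (fun y => f (y * z)) (Ad u ζ)), dirDeriv_comm]
    · exact (contMDiff_uncurry_swap (contMDiff_uncurry_mul hf))
    · exact contMDiff_dirDeriv (contMDiff_uncurry_swap (contMDiff_uncurry_mul hf)) _
  · exact contMDiff_dirDeriv (J := 𝓘(ℝ, E).prod 𝓘(ℝ, E)) (M := G × G)
      (Φ := fun p y => f (p.1 * y * p.2⁻¹)) (hf.comp
      (((contMDiff_fst.comp contMDiff_fst).mul contMDiff_snd).mul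
        (contMDiff_snd.comp contMDiff_fst).inv)) _

end AdjointAction

/-! ### Vectors of functions and the axioms of the abstract calculus. -/

section VectorCalculus

variable {A : Type*} [CommRing A] [Algebra ℝ A] {ι : Type*}

/-- A derivation acting componentwise on vectors. -/
def vecDer (δ : Derivation ℝ A A) : (ι → A) →ₗ[ℝ] (ι → A) :=
  (δ : A →ₗ[ℝ] A).compLeft ι

@[simp]
theorem vecDer_apply (δ : Derivation ℝ A A) (x : ι → A) (a : ι) : vecDer δ x a = δ (x a) := rfl

theorem vecDer_smul (δ : Derivation ℝ A A) (r : A) (x : ι → A) :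
    vecDer δ (r • x) = δ r • x + r • vecDer δ x := by
  ext a
  simp [mul_comm, add_comm]

/-- A vector is constant if all derivations annihilate its components. -/
def IsConstVec (x : ι → A) : Prop := ∀ δ : Derivation ℝ A A, vecDer δ x = 0

theorem isConstVec_single [DecidableEq ι] (a : ι) : IsConstVec (Pi.single a (1 : A)) := by
  intro δ
  ext c
  by_cases h : c = a
  · subst h; simp
  · simp [h]

variable [Fintype ι]

/-- The Lie bracket on vectors with the structure constants `f`. -/
def lieVec (f : ι → ι → ι → ℝ) : (ι → A) →ₗ[A] (ι → A) →ₗ[A] (ι → A) :=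
  LinearMap.mk₂ A (fun x y e => ∑ a, ∑ c, f a c e • (x a * y c))
    (fun x x' y => by ext e; simp [add_mul, Finset.sum_add_distrib])
    (fun r x y => by
      ext e
      simp only [Pi.smul_apply, smul_eq_mul, Finset.mul_sum, Algebra.smul_def]
      exact Finset.sum_congr rfl fun a _ => Finset.sum_congr rfl fun c _ => by ring)
    (fun x y y' => by ext e; simp [mul_add, Finset.sum_add_distrib])
    (fun r x y => by
      ext e
      simp only [Pi.smul_apply, smul_eq_mul, Finset.mul_sum, Algebra.smul_def]
      exact Finset.sum_congr rfl fun a _ => Finset.sum_congr rfl fun c _ => by ring)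

theorem lieVec_apply (f : ι → ι → ι → ℝ) (x y : ι → A) (e : ι) :
    lieVec f x y e = ∑ a, ∑ c, f a c e • (x a * y c) := rfl

theorem eq_sum_single {A ι : Type*} [CommRing A] [Fintype ι] [DecidableEq ι] (x : ι → A) :
    x = ∑ a, x a • Pi.single a (1 : A) := by
  ext c
  simp [Pi.single_apply]

end VectorCalculus

theorem sum_comm_pairs {M α β γ δ : Type*} [AddCommMonoid M] [Fintype α] [Fintype β] [Fintype γ]
    [Fintype δ] (f : α → β → γ → δ → M) :
    ∑ a, ∑ b, ∑ c, ∑ d, f a b c d = ∑ c, ∑ d, ∑ a, ∑ b, f a b c d := by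
  have h1 := Finset.sum_comm (s := (Finset.univ : Finset (α × β)))
    (t := (Finset.univ : Finset (γ × δ))) (f := fun p q => f p.1 p.2 q.1 q.2)
  simpa only [Fintype.sum_prod_type] using h1

/-- The structure on an algebra `A` of coefficients that enters the flower algebra: structure
constants, the adjoint action of the words in the holonomies on `A`-valued vectors, and the
derivations generating the left translations of the holonomies. -/
structure FlowerCalculus (A : Type*) [CommRing A] [Algebra ℝ A] (n g : ℕ) (ι : Type*)
    [Fintype ι] [DecidableEq ι] where
  str : ι → ι → ι → ℝ
  str_swap : ∀ a c e, str a c e = -str c a e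
  ad : FreeGroup (Curve n g) →* Module.End A (ι → A)
  der : Curve n g → ι → Derivation ℝ A A
  ad_lie : ∀ w x y, ad w (lieVec str x y) = lieVec str (ad w x) (ad w y)
  der_comm : ∀ X a Y c F, der X a (der Y c F) - der Y c (der X a F) =
    if X = Y then -∑ e, str a c e • der X e F else 0
  der_ad : ∀ Y d X a, vecDer (der Y d) (ad (FreeGroup.of X) (Pi.single a 1)) =
    if X = Y then lieVec str (Pi.single d 1) (ad (FreeGroup.of X) (Pi.single a 1)) else 0

/-! ### Derivations that translate all holonomies from the left. -/

namespace FlowerCalculus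

variable {A : Type*} [CommRing A] [Algebra ℝ A] {n g : ℕ} {ι : Type*}
    [Fintype ι] [DecidableEq ι] (𝓒 : FlowerCalculus A n g ι)

/-- The Lie bracket on vectors. -/
abbrev lie : (ι → A) →ₗ[A] (ι → A) →ₗ[A] (ι → A) := lieVec 𝓒.str

theorem lie_swap (x y : ι → A) : 𝓒.lie x y = -𝓒.lie y x := by
  ext e
  simp only [lieVec_apply, Pi.neg_apply]
  rw [Finset.sum_comm, ← Finset.sum_neg_distrib]
  refine Finset.sum_congr rfl fun a _ => ?_
  rw [← Finset.sum_neg_distrib]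
  refine Finset.sum_congr rfl fun c _ => ?_
  rw [𝓒.str_swap, neg_smul, mul_comm]

/-- The adjoint action of a single holonomy. -/
abbrev adL (X : Curve n g) : Module.End A (ι → A) := 𝓒.ad (FreeGroup.of X)

/-- The derivation that translates the holonomy `u_Y` from the left by `s Y`, for all `Y`. -/
def field : (Curve n g → ι → A) →ₗ[A] Derivation ℝ A A where
  toFun s := ∑ Y, ∑ a, s Y a • 𝓒.der Y a
  map_add' s t := by simp [add_smul, Finset.sum_add_distrib]
  map_smul' r s := by simp [mul_smul, Finset.smul_sum]

theorem field_apply (s : Curve n g → ι → A) (F : A) :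
    𝓒.field s F = ∑ Y, ∑ a, s Y a * 𝓒.der Y a F := by
  rw [field, LinearMap.coe_mk, AddHom.coe_mk]
  simp only [← Derivation.coeFnAddMonoidHom_apply, map_sum, Finset.sum_apply]
  simp

theorem vecDer_field (s : Curve n g → ι → A) (x : ι → A) :
    vecDer (𝓒.field s) x = ∑ Y, ∑ a, s Y a • vecDer (𝓒.der Y a) x := by
  ext c
  simp [field_apply, Finset.sum_apply]

/-- Only the component `s X` moves `u_X`, and it changes `Ad(u_X)` by a bracket from the left; the
second term is the Leibniz rule for the coefficients of `x`. -/
theorem vecDer_field_adL (s : Curve n g → ι → A) (X : Curve n g) (x : ι → A) :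
    vecDer (𝓒.field s) (𝓒.adL X x) =
      𝓒.lie (s X) (𝓒.adL X x) + 𝓒.adL X (vecDer (𝓒.field s) x) := by
  have key (a : ι) : vecDer (𝓒.field s) (𝓒.adL X (Pi.single a 1)) =
      𝓒.lie (s X) (𝓒.adL X (Pi.single a 1)) := by
    rw [vecDer_field, Finset.sum_eq_single X]
    · conv_rhs => rw [eq_sum_single (s X), map_sum, LinearMap.sum_apply]
      refine Finset.sum_congr rfl fun d _ => ?_
      rw [𝓒.der_ad, if_pos rfl, map_smul, LinearMap.smul_apply]
    · intro Y _ hY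
      refine Finset.sum_eq_zero fun d _ => ?_
      rw [𝓒.der_ad, if_neg hY.symm, smul_zero]
    · simp
  have e : vecDer (𝓒.field s) x = ∑ a, 𝓒.field s (x a) • Pi.single a 1 := eq_sum_single _
  conv_lhs => rw [eq_sum_single x]
  conv_rhs => rw [e]
  conv_rhs => enter [1]; rw [eq_sum_single x]
  simp only [map_sum, map_smul, vecDer_smul, key, Finset.sum_add_distrib]
  rw [add_comm]

/-- The first two terms differentiate the coefficients. The bracket has a minus sign because
generators of left translations are right-invariant fields. -/
theorem field_comm (s t : Curve n g → ι → A) (F : A) :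
    𝓒.field s (𝓒.field t F) - 𝓒.field t (𝓒.field s F) =
      𝓒.field (fun Y => vecDer (𝓒.field s) (t Y) - vecDer (𝓒.field t) (s Y)
        - 𝓒.lie (s Y) (t Y)) F := by
  have h1 (s t : Curve n g → ι → A) : 𝓒.field s (𝓒.field t F) =
      (∑ Y, ∑ a, 𝓒.field s (t Y a) * 𝓒.der Y a F) +
      ∑ Y, ∑ a, ∑ Z, ∑ c, s Y a * t Z c * 𝓒.der Y a (𝓒.der Z c F) := by
    rw [𝓒.field_apply t]
    simp only [map_sum, Derivation.leibniz, smul_eq_mul, Finset.sum_add_distrib]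
    rw [add_comm]
    congr 1
    · simp only [mul_comm]
    · simp only [field_apply, Finset.mul_sum]
      rw [sum_comm_pairs]
      exact Finset.sum_congr rfl fun Y _ => Finset.sum_congr rfl fun a _ =>
        Finset.sum_congr rfl fun Z _ => Finset.sum_congr rfl fun c _ => by ring
  -- The second-order parts cancel between different curves; for equal curves `der_comm` leaves a
  -- first-order term.
  have h2 : (∑ Y, ∑ a, ∑ Z, ∑ c, s Y a * t Z c * 𝓒.der Y a (𝓒.der Z c F)) -
      (∑ Y, ∑ a, ∑ Z, ∑ c, t Y a * s Z c * 𝓒.der Y a (𝓒.der Z c F)) =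
      -∑ Y, ∑ e, 𝓒.lie (s Y) (t Y) e * 𝓒.der Y e F := by
    rw [sum_comm_pairs (fun Y a Z c => t Y a * s Z c * 𝓒.der Y a (𝓒.der Z c F))]
    simp only [← Finset.sum_sub_distrib, ← Finset.sum_neg_distrib]
    refine Finset.sum_congr rfl fun Y _ => ?_
    have (a : ι) (Z : Curve n g) (c : ι) : s Y a * t Z c * 𝓒.der Y a (𝓒.der Z c F) -
        t Z c * s Y a * 𝓒.der Z c (𝓒.der Y a F) =
        if Y = Z then -∑ e, 𝓒.str a c e • (s Y a * t Y c) * 𝓒.der Y e F else 0 := by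
      rw [mul_comm (t Z c), ← mul_sub, 𝓒.der_comm]
      split_ifs with h
      · subst h
        simp [Finset.mul_sum]
      · simp
    simp only [this, Finset.sum_neg_distrib, lieVec_apply, Finset.sum_mul]
    rw [Finset.sum_comm (s := Finset.univ) (t := Finset.univ)
      (f := fun e a => ∑ c, 𝓒.str a c e • (s Y a * t Y c) * 𝓒.der Y e F)]
    rw [← Finset.sum_neg_distrib]
    refine Finset.sum_congr rfl fun a _ => ?_
    rw [Finset.sum_comm, ← Finset.sum_neg_distrib, Finset.sum_comm]
    simp [Finset.sum_neg_distrib]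
    exact Finset.sum_comm
  rw [h1, h1, field_apply]
  simp only [Pi.sub_apply, vecDer_apply, sub_mul, Finset.sum_sub_distrib]
  linear_combination h2

end FlowerCalculus

/-! ### Anchors of the generators and the commutators of their fields. -/

namespace FlowerCalculus
open Curve

variable {A : Type*} [CommRing A] [Algebra ℝ A] {n g : ℕ} {ι : Type*}
    [Fintype ι] [DecidableEq ι] (𝓒 : FlowerCalculus A n g ι)

/-- The part of `anchor` inside the block of `X`. -/
def ownAnchor : Curve n g → Curve n g → Module.End A (ι → A)
  | M i, M j => if i = j then 1 - 𝓒.adL (M i) else 0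
  | .A k, .A l => if k = l then 1 - 𝓒.adL (.A k) else 0
  | .A k, B l => if k = l then 1 - 𝓒.adL (.A k) - 𝓒.adL (B k) else 0
  | B k, .A l => if k = l then 1 else 0
  | B k, B l => if k = l then 1 - 𝓒.adL (B k) else 0
  | _, _ => 0

/-- The vector by which the derivation `{j^X(x), ·}` translates `u_Y` from the left. -/
def anchor (X Y : Curve n g) : Module.End A (ι → A) :=
  if X.rank < Y.rank then (1 - 𝓒.adL Y) * (1 - 𝓒.adL X) else 𝓒.ownAnchor X Y

/-- The derivation `{j^X(x), ·}` of the coefficients. -/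
def anchorField (X : Curve n g) : (ι → A) →ₗ[A] Derivation ℝ A A :=
  𝓒.field ∘ₗ LinearMap.pi fun Y => 𝓒.anchor X Y

theorem rank_eq_of_ownAnchor_ne_zero {X Y : Curve n g} (h : 𝓒.ownAnchor X Y ≠ 0) :
    X.rank = Y.rank := by
  cases X <;> cases Y <;> simp [ownAnchor] at h <;> simp [rank, h]

theorem ownAnchor_of_rank_ne {X Y : Curve n g} (h : X.rank ≠ Y.rank) : 𝓒.ownAnchor X Y = 0 := by
  by_contra h'
  exact h (𝓒.rank_eq_of_ownAnchor_ne_zero h')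

theorem anchor_of_lt {X Y : Curve n g} (h : X.rank < Y.rank) :
    𝓒.anchor X Y = (1 - 𝓒.adL Y) * (1 - 𝓒.adL X) := if_pos h

theorem anchor_of_le {X Y : Curve n g} (h : Y.rank ≤ X.rank) :
    𝓒.anchor X Y = 𝓒.ownAnchor X Y := if_neg h.not_gt

theorem anchor_of_gt {X Y : Curve n g} (h : Y.rank < X.rank) : 𝓒.anchor X Y = 0 := by
  rw [anchor_of_le _ h.le, ownAnchor_of_rank_ne _ h.ne']

/-- `ad w` commutes with the operator `vecDer δ - ad_z`. -/
def Twisted (δ : Derivation ℝ A A) (z : ι → A) (T : Module.End A (ι → A)) : Prop :=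
  ∀ y, vecDer δ (T y) = 𝓒.lie z (T y) - T (𝓒.lie z y) + T (vecDer δ y)

namespace Twisted

variable {𝓒} {δ : Derivation ℝ A A} {z : ι → A} {S T : Module.End A (ι → A)}

theorem one : 𝓒.Twisted δ z 1 := fun y => by simp

theorem zero : 𝓒.Twisted δ z 0 := fun y => by simp

theorem mul (hS : 𝓒.Twisted δ z S) (hT : 𝓒.Twisted δ z T) : 𝓒.Twisted δ z (S * T) := fun y => by
  rw [Module.End.mul_apply, hS, hT]
  simp only [map_add, map_sub, Module.End.mul_apply]
  abel

theorem sub (hS : 𝓒.Twisted δ z S) (hT : 𝓒.Twisted δ z T) : 𝓒.Twisted δ z (S - T) := fun y => by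
  simp only [LinearMap.sub_apply, map_sub, hS y, hT y]
  abel

theorem inv {w : FreeGroup (Curve n g)} (h : 𝓒.Twisted δ z (𝓒.ad w)) :
    𝓒.Twisted δ z (𝓒.ad w⁻¹) := fun y => by
  have e1 : ∀ v, 𝓒.ad w⁻¹ (𝓒.ad w v) = v := fun v => by
    rw [← Module.End.mul_apply, ← map_mul, inv_mul_cancel, map_one]; rfl
  have e2 : ∀ v, 𝓒.ad w (𝓒.ad w⁻¹ v) = v := fun v => by
    rw [← Module.End.mul_apply, ← map_mul, mul_inv_cancel, map_one]; rfl
  have := congrArg (𝓒.ad w⁻¹) (h (𝓒.ad w⁻¹ y))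
  simp only [e2, e1, map_add, map_sub] at this
  rw [this]
  abel

theorem ad_mul {v w : FreeGroup (Curve n g)} (hv : 𝓒.Twisted δ z (𝓒.ad v))
    (hw : 𝓒.Twisted δ z (𝓒.ad w)) : 𝓒.Twisted δ z (𝓒.ad (v * w)) := by
  rw [map_mul]; exact hv.mul hw

theorem apply_of_const (h : 𝓒.Twisted δ z T) {y : ι → A} (hy : IsConstVec y) :
    vecDer δ (T y) = 𝓒.lie z (T y) - T (𝓒.lie z y) := by
  rw [h y, hy δ, map_zero, add_zero]

theorem apply_zero (h : 𝓒.Twisted δ 0 T) {y : ι → A} (hy : vecDer δ y = 0) :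
    vecDer δ (T y) = 0 := by
  simp [h y, hy]

end Twisted

theorem vecDer_anchorField_adL (X Y : Curve n g) (x y : ι → A) :
    vecDer (𝓒.anchorField X x) (𝓒.adL Y y) =
      𝓒.lie (𝓒.anchor X Y x) (𝓒.adL Y y) + 𝓒.adL Y (vecDer (𝓒.anchorField X x) y) :=
  𝓒.vecDer_field_adL _ _ _

/-- Letters after `X` undergo infinitesimal conjugation by `(1 - Ad u_X)x`, and conjugating a letter
by `z` replaces its `Ad` by the commutator with `ad_z`. As `z` is the same for all later letters,
every operator built from them is twisted by it too. -/
theorem twisted_of_lt {X Y : Curve n g} (h : X.rank < Y.rank) (x : ι → A) :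
    𝓒.Twisted (𝓒.anchorField X x) ((1 - 𝓒.adL X) x) (𝓒.adL Y) := fun y => by
  rw [vecDer_anchorField_adL, anchor_of_lt _ h, Module.End.mul_apply, LinearMap.sub_apply 1,
    map_sub, LinearMap.sub_apply, 𝓒.ad_lie]
  rfl

theorem twisted_zero_of_gt {X Y : Curve n g} (h : Y.rank < X.rank) (x : ι → A) :
    𝓒.Twisted (𝓒.anchorField X x) 0 (𝓒.adL Y) := fun y => by
  rw [vecDer_anchorField_adL, anchor_of_gt _ h]
  simp

/-- If every letter of the block of `X` is twisted, then so are the anchors of `X`. -/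
theorem twisted_ownAnchor {δ : Derivation ℝ A A} {z : ι → A} {X Y : Curve n g}
    (h : ∀ Z : Curve n g, Z.rank = X.rank → 𝓒.Twisted δ z (𝓒.adL Z)) :
    𝓒.Twisted δ z (𝓒.ownAnchor X Y) := by
  cases X <;> cases Y <;> simp only [ownAnchor] <;> try exact Twisted.zero
  all_goals split_ifs; swap; exact Twisted.zero
  · exact Twisted.one.sub (h _ rfl)
  · exact Twisted.one.sub (h _ rfl)
  · exact (Twisted.one.sub (h _ rfl)).sub (h _ rfl)
  · exact Twisted.one
  · exact Twisted.one.sub (h _ rfl)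

/-- The component at `Z` of the commutator of `{j^X(x), ·}` and `{j^Y(y), ·}`. -/
def commAt (X : Curve n g) (x : ι → A) (Y : Curve n g) (y : ι → A) (Z : Curve n g) : ι → A :=
  vecDer (𝓒.anchorField X x) (𝓒.anchor Y Z y) - vecDer (𝓒.anchorField Y y) (𝓒.anchor X Z x)
    - 𝓒.lie (𝓒.anchor X Z x) (𝓒.anchor Y Z y)

theorem commAt_swap (X : Curve n g) (x : ι → A) (Y : Curve n g) (y : ι → A) (Z : Curve n g) :
    𝓒.commAt X x Y y Z = -𝓒.commAt Y y X x Z := by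
  rw [commAt, commAt, 𝓒.lie_swap (𝓒.anchor X Z x)]
  abel

theorem anchorField_comm (X : Curve n g) (x : ι → A) (Y : Curve n g) (y : ι → A) (F : A) :
    𝓒.anchorField X x (𝓒.anchorField Y y F) - 𝓒.anchorField Y y (𝓒.anchorField X x F) =
      𝓒.field (𝓒.commAt X x Y y) F :=
  𝓒.field_comm _ _ F

/-- For `Z` before the block of `Y` all three terms vanish. From that block on, the field of `X`
twists every letter by `z = (1 - Ad u_X)x`, so on the anchors of `Y` it acts as bracketing with `z`;
and `z` itself is not moved by the field of `Y`. -/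
theorem commAt_of_lt {X Y : Curve n g} (h : X.rank < Y.rank) {x y : ι → A}
    (hx : IsConstVec x) (hy : IsConstVec y) (Z : Curve n g) :
    𝓒.commAt X x Y y Z = -𝓒.anchor Y Z (𝓒.lie ((1 - 𝓒.adL X) x) y) := by
  have hc : vecDer (𝓒.anchorField Y y) ((1 - 𝓒.adL X) x) = 0 :=
    (Twisted.one.sub (𝓒.twisted_zero_of_gt h y)).apply_zero (hx _)
  rcases lt_or_ge Z.rank Y.rank with hZ | hZ
  · have h0 : 𝓒.anchor Y Z = 0 := 𝓒.anchor_of_gt hZ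
    have h1 : 𝓒.Twisted (𝓒.anchorField Y y) 0 (𝓒.anchor X Z) := by
      rw [anchor]
      split_ifs
      · exact (Twisted.one.sub (𝓒.twisted_zero_of_gt hZ y)).mul
          (Twisted.one.sub (𝓒.twisted_zero_of_gt h y))
      · exact 𝓒.twisted_ownAnchor fun W hW => 𝓒.twisted_zero_of_gt (hW ▸ h) y
    rw [commAt, h1.apply_zero (hx _), h0]
    simp
  · have hXZ : X.rank < Z.rank := h.trans_le hZ
    have h1 : 𝓒.Twisted (𝓒.anchorField X x) ((1 - 𝓒.adL X) x) (𝓒.anchor Y Z) := by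
      rw [anchor]
      split_ifs
      · exact (Twisted.one.sub (𝓒.twisted_of_lt hXZ x)).mul
          (Twisted.one.sub (𝓒.twisted_of_lt h x))
      · exact 𝓒.twisted_ownAnchor fun W hW => 𝓒.twisted_of_lt (hW ▸ h) x
    rw [commAt, h1.apply_of_const hy, 𝓒.anchor_of_lt hXZ, Module.End.mul_apply]
    generalize (1 - 𝓒.adL X) x = z at *
    rw [LinearMap.sub_apply 1, map_sub, Module.End.one_apply, hc, vecDer_anchorField_adL, hc,
      map_zero, map_sub, LinearMap.sub_apply, 𝓒.lie_swap (𝓒.anchor Y Z y) (𝓒.adL Z z)]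
    abel

/-- Both fields conjugate `u_Z`, and the commutator of two infinitesimal conjugations is a
conjugation by the corresponding vector `z`. This reduces all later components to one identity not
involving `Z`. -/
theorem commAt_of_gt_of_gt {X Y Z : Curve n g} (hX : X.rank < Z.rank) (hY : Y.rank < Z.rank)
    {x y : ι → A} {z : ι → A}
    (h : vecDer (𝓒.anchorField X x) ((1 - 𝓒.adL Y) y)
      - vecDer (𝓒.anchorField Y y) ((1 - 𝓒.adL X) x)
      - 𝓒.lie ((1 - 𝓒.adL X) x) ((1 - 𝓒.adL Y) y) = z) :
    𝓒.commAt X x Y y Z = (1 - 𝓒.adL Z) z := by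
  have h1 := (Twisted.one.sub (𝓒.twisted_of_lt hX x)) ((1 - 𝓒.adL Y) y)
  have h2 := (Twisted.one.sub (𝓒.twisted_of_lt hY y)) ((1 - 𝓒.adL X) x)
  rw [commAt, 𝓒.anchor_of_lt hX, 𝓒.anchor_of_lt hY, Module.End.mul_apply, Module.End.mul_apply,
    h1, h2, ← h]
  generalize (1 - 𝓒.adL X) x = c
  generalize (1 - 𝓒.adL Y) y = d
  simp only [LinearMap.sub_apply, Module.End.one_apply, map_sub, 𝓒.ad_lie]
  rw [𝓒.lie_swap d c, 𝓒.lie_swap d (𝓒.adL Z c), 𝓒.lie_swap (𝓒.adL Z d) (𝓒.adL Z c)]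
  abel

/-- This expression is both the component of the commutator at `X` itself and the vector by which it
conjugates all later letters. -/
theorem commAt_self {X : Curve n g} {x y : ι → A} (hx : IsConstVec x) (hy : IsConstVec y)
    (hX : 𝓒.ownAnchor X X = 1 - 𝓒.adL X) :
    vecDer (𝓒.anchorField X x) ((1 - 𝓒.adL X) y) - vecDer (𝓒.anchorField X y) ((1 - 𝓒.adL X) x)
      - 𝓒.lie ((1 - 𝓒.adL X) x) ((1 - 𝓒.adL X) y) = -(1 - 𝓒.adL X) (𝓒.lie x y) := by
  simp only [LinearMap.sub_apply, Module.End.one_apply, map_sub, vecDer_anchorField_adL,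
    𝓒.anchor_of_le le_rfl, hX, hx _, hy _, map_zero, 𝓒.ad_lie]
  rw [𝓒.lie_swap y (𝓒.adL X x), 𝓒.lie_swap (𝓒.adL X y) (𝓒.adL X x)]
  abel

theorem commAt_A_B (k : Fin g) {x y : ι → A} (hx : IsConstVec x) (hy : IsConstVec y) :
    vecDer (𝓒.anchorField (.A k) x) ((1 - 𝓒.adL (B k)) y)
      - vecDer (𝓒.anchorField (B k) y) ((1 - 𝓒.adL (.A k)) x)
      - 𝓒.lie ((1 - 𝓒.adL (.A k)) x) ((1 - 𝓒.adL (B k)) y) =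
      -(1 - 𝓒.adL (B k)) (𝓒.lie x y) := by
  have h1 : 𝓒.anchor (.A k) (B k) = 1 - 𝓒.adL (.A k) - 𝓒.adL (B k) := by
    simp [anchor, rank, ownAnchor]
  have h2 : 𝓒.anchor (B k) (.A k) = 1 := by simp [anchor, rank, ownAnchor]
  simp only [LinearMap.sub_apply, Module.End.one_apply, map_sub, vecDer_anchorField_adL,
    h1, h2, hx _, hy _, map_zero, 𝓒.ad_lie]
  rw [𝓒.lie_swap y (𝓒.adL (.A k) x)]
  abel

theorem commAt_M (i : Fin n) {x y : ι → A} (hx : IsConstVec x) (hy : IsConstVec y)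
    (Z : Curve n g) :
    𝓒.commAt (M i) x (M i) y Z = -𝓒.anchor (M i) Z (𝓒.lie x y) := by
  have h := 𝓒.commAt_self (X := M i) hx hy (by simp [ownAnchor])
  rcases lt_or_ge (M i : Curve n g).rank Z.rank with hZ | hZ
  · rw [𝓒.commAt_of_gt_of_gt hZ hZ h, 𝓒.anchor_of_lt hZ, map_neg, Module.End.mul_apply]
  · rw [commAt, 𝓒.anchor_of_le hZ]
    cases Z with
    | M j =>
      simp only [ownAnchor]
      split_ifs with hj
      · exact h
      · simp
    | A k => simp [ownAnchor]
    | B k => simp [ownAnchor]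

/-- Letters after the handle are covered by the conjugation vector, letters outside the handle that
are not later have zero anchors, and the two letters of the handle are a finite check. The pair with
the roles of `A_k` and `B_k` exchanged follows by antisymmetry. -/
theorem commAt_handle (X Y : Curve n g) (k : Fin g)
    (hXY : (X = .A k ∧ Y = .A k) ∨ (X = .A k ∧ Y = B k) ∨ (X = B k ∧ Y = B k))
    {x y : ι → A} (hx : IsConstVec x) (hy : IsConstVec y) (Z : Curve n g) :
    𝓒.commAt X x Y y Z = -𝓒.anchor Y Z (𝓒.lie x y) := by
  have hXk : X.rank = n + k := by rcases hXY with ⟨rfl, rfl⟩ | ⟨rfl, rfl⟩ | ⟨rfl, rfl⟩ <;> rfl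
  have hYk : Y.rank = n + k := by rcases hXY with ⟨rfl, rfl⟩ | ⟨rfl, rfl⟩ | ⟨rfl, rfl⟩ <;> rfl
  have hAA : 𝓒.anchor (.A k) (.A k) = 1 - 𝓒.adL (.A k) := by simp [anchor, ownAnchor]
  have hBB : 𝓒.anchor (B k) (B k) = 1 - 𝓒.adL (B k) := by simp [anchor, ownAnchor]
  have hAB : 𝓒.anchor (.A k) (B k) = 1 - 𝓒.adL (.A k) - 𝓒.adL (B k) := by
    simp [anchor, rank, ownAnchor]
  have hBA : 𝓒.anchor (B k) (.A k) = 1 := by simp [anchor, rank, ownAnchor]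
  rcases lt_or_ge (n + k : ℕ) Z.rank with hZ | hZ
  · have h : vecDer (𝓒.anchorField X x) ((1 - 𝓒.adL Y) y)
        - vecDer (𝓒.anchorField Y y) ((1 - 𝓒.adL X) x)
        - 𝓒.lie ((1 - 𝓒.adL X) x) ((1 - 𝓒.adL Y) y) = -(1 - 𝓒.adL Y) (𝓒.lie x y) := by
      rcases hXY with ⟨rfl, rfl⟩ | ⟨rfl, rfl⟩ | ⟨rfl, rfl⟩
      · exact 𝓒.commAt_self hx hy (by simp [ownAnchor])
      · exact 𝓒.commAt_A_B k hx hy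
      · exact 𝓒.commAt_self hx hy (by simp [ownAnchor])
    rw [𝓒.commAt_of_gt_of_gt (hXk ▸ hZ) (hYk ▸ hZ) h, 𝓒.anchor_of_lt (hYk ▸ hZ), map_neg,
      Module.End.mul_apply]
  · by_cases hZk : Z = .A k ∨ Z = B k
    · rcases hXY with ⟨rfl, rfl⟩ | ⟨rfl, rfl⟩ | ⟨rfl, rfl⟩ <;> rcases hZk with rfl | rfl <;>
      · simp only [commAt, hAA, hBB, hAB, hBA, LinearMap.sub_apply, Module.End.one_apply, map_sub,
          vecDer_anchorField_adL, hx _, hy _, map_zero, 𝓒.ad_lie]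
        -- Brackets are brought into the order with `x` on the left and `y` on the right, whichever
        -- of them occur; the rest is linear cancellation.
        try rw [𝓒.lie_swap y (𝓒.adL (.A k) x)]
        try rw [𝓒.lie_swap y (𝓒.adL (B k) x)]
        try rw [𝓒.lie_swap (𝓒.adL (.A k) y) (𝓒.adL (.A k) x)]
        try rw [𝓒.lie_swap (𝓒.adL (.A k) y) (𝓒.adL (B k) x)]
        try rw [𝓒.lie_swap (𝓒.adL (B k) y) (𝓒.adL (.A k) x)]
        try rw [𝓒.lie_swap (𝓒.adL (B k) y) (𝓒.adL (B k) x)]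
        abel
    · push Not at hZk
      have h0 : ∀ W : Curve n g, W = .A k ∨ W = B k → 𝓒.anchor W Z = 0 := by
        intro W hW
        have hWk : W.rank = n + k := by rcases hW with rfl | rfl <;> rfl
        rw [𝓒.anchor_of_le (hWk ▸ hZ)]
        rcases hW with rfl | rfl <;> cases Z <;> simp [ownAnchor] at hZk ⊢ <;> grind
      rw [commAt, h0 X (by grind), h0 Y (by grind)]
      simp

end FlowerCalculus

/-! ### Biderivations on polynomial algebras. -/

section PolyBracket
open MvPolynomial

/-- Two derivations along an algebra homomorphism agree if they agree on coefficients and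
variables. -/
theorem derivationAlong_ext {A κ P : Type*} [CommRing A] [CommRing P] (σ : MvPolynomial κ A →+* P)
    {D D' : MvPolynomial κ A → P}
    (hD : ∀ φ ψ, D (φ + ψ) = D φ + D ψ) (hD' : ∀ φ ψ, D' (φ + ψ) = D' φ + D' ψ)
    (hm : ∀ φ ψ, D (φ * ψ) = σ φ * D ψ + σ ψ * D φ)
    (hm' : ∀ φ ψ, D' (φ * ψ) = σ φ * D' ψ + σ ψ * D' φ)
    (hC : ∀ F, D (C F) = D' (C F)) (hX : ∀ p, D (X p) = D' (X p)) (φ : MvPolynomial κ A) :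
    D φ = D' φ := by
  induction φ using MvPolynomial.induction_on with
  | C F => exact hC F
  | add φ ψ h h' => rw [hD, hD', h, h']
  | mul_X φ p h => rw [hm, hm', h, hX]

variable {A : Type*} [CommRing A] [Algebra ℝ A] {κ : Type*}

/-- A derivation of `A` acting on the coefficients of polynomials. -/
def coeffDer (V : Derivation ℝ A A) : Derivation ℝ (MvPolynomial κ A) (MvPolynomial κ A) :=
  -- Since `V 0 = 0`, the sum over the support has `V` of the coefficient in every degree. The sum
  -- has the form of `mapCoeff`, so that the two agree by definition.
  have hc (φ : MvPolynomial κ A) (m : κ →₀ ℕ) :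
      coeff m (∑ m ∈ φ.support, monomial m (V (φ.coeff m))) = V (coeff m φ) := by
    classical
    rw [coeff_sum]
    simp only [coeff_monomial]
    rw [Finset.sum_ite_eq']
    split_ifs with h
    · rfl
    · rw [notMem_support_iff.1 h, map_zero]
  Derivation.mk'
    { toFun := fun φ => ∑ m ∈ φ.support, monomial m (V (φ.coeff m))
      map_add' := fun φ ψ => by
        ext m
        rw [coeff_add, hc, hc, hc, coeff_add, map_add]
      map_smul' := fun r φ => by
        ext m
        rw [RingHom.id_apply, coeff_smul, hc, hc, coeff_smul, Derivation.map_smul] }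
    fun φ ψ => by
      classical
      ext m
      change coeff m (∑ m ∈ (φ * ψ).support, monomial m (V ((φ * ψ).coeff m))) =
        coeff m (φ * (∑ m ∈ ψ.support, monomial m (V (ψ.coeff m))) +
          ψ * (∑ m ∈ φ.support, monomial m (V (φ.coeff m))))
      rw [mul_comm ψ, hc, coeff_add, coeff_mul, coeff_mul, coeff_mul]
      simp only [hc, map_sum, Derivation.leibniz, smul_eq_mul,
        Finset.sum_add_distrib]
      congr 1
      exact Finset.sum_congr rfl fun _ _ => mul_comm _ _

theorem coeffDer_apply (V : Derivation ℝ A A) (φ : MvPolynomial κ A) :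
    coeffDer V φ = ∑ m ∈ φ.support, monomial m (V (φ.coeff m)) := rfl

@[simp]
theorem coeffDer_C (V : Derivation ℝ A A) (F : A) :
    coeffDer V (C F : MvPolynomial κ A) = C (V F) := by
  classical
  rw [coeffDer_apply, Finset.sum_subset (Finset.subset_insert 0 _) (fun m _ hm => ?_)]
  · rw [Finset.sum_eq_single 0]
    · rw [coeff_zero_C]; rfl
    · intro m _ hm
      rw [coeff_C, if_neg (Ne.symm hm), map_zero, map_zero]
    · intro h; exact absurd (Finset.mem_insert_self _ _) h
  · rw [notMem_support_iff.1 hm, map_zero, map_zero]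

@[simp]
theorem coeffDer_X (V : Derivation ℝ A A) (p : κ) : coeffDer V (X p : MvPolynomial κ A) = 0 := by
  classical
  refine Finset.sum_eq_zero fun m _ => ?_
  rw [coeff_X]
  split_ifs <;> simp

variable [Fintype κ]

/-- The extension, as a derivation in each argument, of brackets `B p q` of the variables and of
`V p F` of variables and coefficients. -/
def polyBracket (V : κ → Derivation ℝ A A) (B : κ → κ → MvPolynomial κ A)
    (φ ψ : MvPolynomial κ A) : MvPolynomial κ A :=
  (∑ p, ∑ q, pderiv p φ * pderiv q ψ * B p q)
    + ∑ p, (pderiv p φ * coeffDer (V p) ψ - pderiv p ψ * coeffDer (V p) φ)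

variable (V : κ → Derivation ℝ A A) (B : κ → κ → MvPolynomial κ A)

/-- The derivation `{φ, ·}`. -/
def hamDer (φ : MvPolynomial κ A) : Derivation ℝ (MvPolynomial κ A) (MvPolynomial κ A) :=
  (∑ p, ∑ q, (pderiv p φ * B p q) • (pderiv q).restrictScalars ℝ)
    + ∑ p, (pderiv p φ • coeffDer (V p) - coeffDer (V p) φ • (pderiv p).restrictScalars ℝ)

theorem hamDer_apply (φ ψ : MvPolynomial κ A) : hamDer V B φ ψ = polyBracket V B φ ψ := by
  rw [hamDer, polyBracket]
  simp only [← Derivation.coeFnAddMonoidHom_apply, map_sum, map_add, Finset.sum_apply,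
    Pi.add_apply]
  simp only [Derivation.coeFnAddMonoidHom_apply, Derivation.coe_smul, Derivation.coe_sub,
    Pi.smul_apply, Pi.sub_apply, smul_eq_mul]
  congr 1
  · exact Finset.sum_congr rfl fun p _ => Finset.sum_congr rfl fun q _ => mul_right_comm _ _ _
  · exact Finset.sum_congr rfl fun p _ => by
      rw [mul_comm (coeffDer _ _)]
      rfl

variable {V B}

theorem polyBracket_swap (hB : ∀ p q, B p q = -B q p) (φ ψ : MvPolynomial κ A) :
    polyBracket V B φ ψ = -polyBracket V B ψ φ := by
  rw [polyBracket, polyBracket, neg_add, Finset.sum_comm]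
  simp only [← Finset.sum_neg_distrib]
  congr 1
  · exact Finset.sum_congr rfl fun p _ => Finset.sum_congr rfl fun q _ => by
      rw [hB q p]; ring
  · exact Finset.sum_congr rfl fun p _ => by ring

theorem polyBracket_X_X (p q : κ) : polyBracket V B (X p) (X q) = B p q := by
  classical
  simp [polyBracket, pderiv_X, Pi.single_apply]

theorem polyBracket_X_C (p : κ) (F : A) : polyBracket V B (X p) (C F) = C (V p F) := by
  classical
  simp [polyBracket, pderiv_X, Pi.single_apply]

theorem polyBracket_C_C (F F' : A) : polyBracket V B (C F) (C F') = 0 := by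
  simp [polyBracket]

/-- Both sides are derivations along `σ` in each argument, so they are determined by variables and
coefficients. The extension is made in the second argument and carried to the first by antisymmetry.
-/
theorem polyBracket_map (hB : ∀ p q, B p q = -B q p) (σ : MvPolynomial κ A →+* MvPolynomial κ A)
    (τ : A → A) (hσ : ∀ F, σ (C F) = C (τ F))
    (hXX : ∀ p q, σ (B p q) = polyBracket V B (σ (X p)) (σ (X q)))
    (hXC : ∀ p F, σ (C (V p F)) = polyBracket V B (σ (X p)) (C (τ F))) (φ ψ : MvPolynomial κ A) :
    σ (polyBracket V B φ ψ) = polyBracket V B (σ φ) (σ ψ) := by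
  have ext2 (φ : MvPolynomial κ A)
      (hC : ∀ F, σ (polyBracket V B φ (C F)) = polyBracket V B (σ φ) (σ (C F)))
      (hX : ∀ p, σ (polyBracket V B φ (X p)) = polyBracket V B (σ φ) (σ (X p)))
      (ψ : MvPolynomial κ A) :
      σ (polyBracket V B φ ψ) = polyBracket V B (σ φ) (σ ψ) := by
    simp only [← hamDer_apply] at hC hX ⊢
    exact derivationAlong_ext σ (D := fun ψ => σ (hamDer V B φ ψ))
      (D' := fun ψ => hamDer V B (σ φ) (σ ψ)) (by simp) (by simp) (by simp) (by simp) hC hX ψ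
  have swap {φ ψ : MvPolynomial κ A}
      (h : σ (polyBracket V B φ ψ) = polyBracket V B (σ φ) (σ ψ)) :
      σ (polyBracket V B ψ φ) = polyBracket V B (σ ψ) (σ φ) := by
    rw [polyBracket_swap hB, map_neg, h, ← polyBracket_swap hB]
  have hx (p) (ψ) : σ (polyBracket V B (X p) ψ) = polyBracket V B (σ (X p)) (σ ψ) :=
    ext2 _ (fun F => by rw [polyBracket_X_C, hσ F, hXC]) (fun q => by rw [polyBracket_X_X, hXX]) ψ
  refine ext2 φ (fun F => swap ?_) (fun p => swap (hx p φ)) ψ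
  exact ext2 _ (fun F' => by rw [polyBracket_C_C, hσ, hσ, polyBracket_C_C, map_zero])
    (fun p => swap (hx p _)) φ

end PolyBracket

/-! ### The abstract flower bracket, shifts by a function, and symmetries. -/

namespace FlowerCalculus
open MvPolynomial

variable {A : Type*} [CommRing A] [Algebra ℝ A] {n g : ℕ} {ι : Type*}
    [Fintype ι] [DecidableEq ι] (𝓒 : FlowerCalculus A n g ι)

/-- The linear element `∑_a x_a j_a^X`. -/
def lin {A ι : Type*} [CommRing A] [Fintype ι] (X : Curve n g) :
    (ι → A) →ₗ[A] MvPolynomial (Curve n g × ι) A :=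
  ∑ a, (LinearMap.proj a).smulRight (MvPolynomial.X (X, a))

theorem lin_apply {A ι : Type*} [CommRing A] [Fintype ι] (X : Curve n g) (x : ι → A) :
    lin X x = ∑ a, C (x a) * MvPolynomial.X (X, a) := by
  simp [lin, LinearMap.sum_apply, MvPolynomial.smul_eq_C_mul]

theorem lin_single {A ι : Type*} [CommRing A] [Fintype ι] [DecidableEq ι] (X : Curve n g) (a : ι) :
    lin X (Pi.single a (1 : A)) = MvPolynomial.X (X, a) := by
  rw [lin_apply, Finset.sum_eq_single a]
  · simp
  · intro c _ hc; simp [hc]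
  · simp

/-- The curve carrying the bracket of the generators of two curves of the same rank. -/
def meet (X Y : Curve n g) : Curve n g :=
  match X with
  | .B k => .B k
  | _ => Y

theorem meet_comm {X Y : Curve n g} (h : X.rank = Y.rank) : meet X Y = meet Y X := by
  cases X <;> cases Y <;> simp [Curve.rank, Fin.val_inj] at h <;> simp [meet] <;> omega

/-- The `A`-bilinear extension of the bracket of the generators. -/
def linBracket (X Y : Curve n g) :
    (ι → A) →ₗ[A] (ι → A) →ₗ[A] MvPolynomial (Curve n g × ι) A :=
  if X.rank < Y.rank then -(𝓒.lie ∘ₗ (1 - 𝓒.adL X)).compr₂ (lin Y)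
  else if Y.rank < X.rank then ((𝓒.lie ∘ₗ (1 - 𝓒.adL Y)).compr₂ (lin X)).flip
  else -𝓒.lie.compr₂ (lin (meet X Y))

theorem linBracket_of_lt {X Y : Curve n g} (h : X.rank < Y.rank) (x y : ι → A) :
    𝓒.linBracket X Y x y = -lin Y (𝓒.lie ((1 - 𝓒.adL X) x) y) := by
  rw [linBracket, if_pos h]; rfl

theorem linBracket_of_gt {X Y : Curve n g} (h : Y.rank < X.rank) (x y : ι → A) :
    𝓒.linBracket X Y x y = lin X (𝓒.lie ((1 - 𝓒.adL Y) y) x) := by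
  rw [linBracket, if_neg h.not_gt, if_pos h]; rfl

theorem linBracket_of_eq {X Y : Curve n g} (h : X.rank = Y.rank) (x y : ι → A) :
    𝓒.linBracket X Y x y = -lin (meet X Y) (𝓒.lie x y) := by
  rw [linBracket, if_neg h.not_lt, if_neg h.not_gt]; rfl

theorem linBracket_swap (X Y : Curve n g) (x y : ι → A) :
    𝓒.linBracket X Y x y = -𝓒.linBracket Y X y x := by
  rcases lt_trichotomy X.rank Y.rank with h | h | h
  · rw [linBracket_of_lt _ h, linBracket_of_gt _ h]
  · rw [linBracket_of_eq _ h, linBracket_of_eq _ h.symm, meet_comm h, 𝓒.lie_swap x, map_neg]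
  · rw [linBracket_of_lt _ h, linBracket_of_gt _ h, neg_neg]

/-- The bracket of the flower algebra. -/
def bra (φ ψ : MvPolynomial (Curve n g × ι) A) : MvPolynomial (Curve n g × ι) A :=
  polyBracket (fun p => 𝓒.anchorField p.1 (Pi.single p.2 1))
    (fun p q => 𝓒.linBracket p.1 q.1 (Pi.single p.2 1) (Pi.single q.2 1)) φ ψ

/-- The derivation `{φ, ·}` of the flower algebra. -/
def ham (φ : MvPolynomial (Curve n g × ι) A) :
    Derivation ℝ (MvPolynomial (Curve n g × ι) A) (MvPolynomial (Curve n g × ι) A) :=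
  hamDer (fun p => 𝓒.anchorField p.1 (Pi.single p.2 1))
    (fun p q => 𝓒.linBracket p.1 q.1 (Pi.single p.2 1) (Pi.single q.2 1)) φ

theorem ham_apply (φ ψ : MvPolynomial (Curve n g × ι) A) : 𝓒.ham φ ψ = 𝓒.bra φ ψ :=
  hamDer_apply _ _ _ _

theorem bra_swap (φ ψ : MvPolynomial (Curve n g × ι) A) : 𝓒.bra φ ψ = -𝓒.bra ψ φ :=
  polyBracket_swap (fun _ _ => 𝓒.linBracket_swap _ _ _ _) _ _

theorem bra_add_right (φ ψ ψ' : MvPolynomial (Curve n g × ι) A) :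
    𝓒.bra φ (ψ + ψ') = 𝓒.bra φ ψ + 𝓒.bra φ ψ' := by
  simp only [← ham_apply, map_add]

theorem bra_add_left (φ φ' ψ : MvPolynomial (Curve n g × ι) A) :
    𝓒.bra (φ + φ') ψ = 𝓒.bra φ ψ + 𝓒.bra φ' ψ := by
  rw [bra_swap, bra_add_right, neg_add, ← bra_swap, ← bra_swap]

theorem bra_sum_left {κ : Type*} (s : Finset κ) (φ : κ → MvPolynomial (Curve n g × ι) A)
    (ψ : MvPolynomial (Curve n g × ι) A) :
    𝓒.bra (∑ k ∈ s, φ k) ψ = ∑ k ∈ s, 𝓒.bra (φ k) ψ := by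
  simp only [𝓒.bra_swap _ ψ, ← ham_apply, map_sum, Finset.sum_neg_distrib]

theorem bra_X_C (p : Curve n g × ι) (F : A) :
    𝓒.bra (MvPolynomial.X p) (C F) = C (𝓒.anchorField p.1 (Pi.single p.2 1) F) :=
  polyBracket_X_C _ _

theorem bra_C_C (F F' : A) : 𝓒.bra (C F) (C F') = 0 := polyBracket_C_C _ _

theorem anchorField_apply_eq_sum (X : Curve n g) (x : ι → A) (F : A) :
    𝓒.anchorField X x F = ∑ a, x a * 𝓒.anchorField X (Pi.single a 1) F := by
  conv_lhs => rw [eq_sum_single x]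
  simp only [map_sum, map_smul]
  rw [← Derivation.coeFnAddMonoidHom_apply, map_sum, Finset.sum_apply]
  rfl

theorem bra_lin_C (X : Curve n g) (x : ι → A) (F : A) :
    𝓒.bra (lin X x) (C F) = C (𝓒.anchorField X x F) := by
  rw [bra_swap, ← ham_apply, lin_apply, map_sum, anchorField_apply_eq_sum, map_sum,
    ← Finset.sum_neg_distrib]
  refine Finset.sum_congr rfl fun a _ => ?_
  rw [Derivation.leibniz, ham_apply, ham_apply, bra_C_C, bra_swap, bra_X_C]
  simp

theorem bra_X_lin (p : Curve n g × ι) (Y : Curve n g) (y : ι → A) :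
    𝓒.bra (MvPolynomial.X p) (lin Y y) = 𝓒.linBracket p.1 Y (Pi.single p.2 1) y
      + lin Y (vecDer (𝓒.anchorField p.1 (Pi.single p.2 1)) y) := by
  conv_rhs => enter [1]; rw [eq_sum_single y]
  rw [← ham_apply, lin_apply, lin_apply]
  simp only [map_sum, map_smul, Derivation.leibniz, Finset.sum_add_distrib, smul_eq_mul]
  congr 1
  · refine Finset.sum_congr rfl fun a _ => ?_
    rw [ham_apply, MvPolynomial.smul_eq_C_mul]
    congr 1
    exact polyBracket_X_X _ _
  · refine Finset.sum_congr rfl fun a _ => ?_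
    rw [ham_apply, bra_X_C, mul_comm]
    rfl

/-- The bracket of generators extends bilinearly over `A`; the last two terms record that each
generator also differentiates the coefficients of the other element. -/
theorem bra_lin_lin (X : Curve n g) (x : ι → A) (Y : Curve n g) (y : ι → A) :
    𝓒.bra (lin X x) (lin Y y) = 𝓒.linBracket X Y x y + lin Y (vecDer (𝓒.anchorField X x) y)
      - lin X (vecDer (𝓒.anchorField Y y) x) := by
  have e1 : lin Y (vecDer (𝓒.anchorField X x) y) =
      ∑ a, C (x a) * lin Y (vecDer (𝓒.anchorField X (Pi.single a 1)) y) := by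
    have : vecDer (𝓒.anchorField X x) y =
        ∑ a, x a • vecDer (𝓒.anchorField X (Pi.single a 1)) y := by
      ext c
      rw [vecDer_apply, anchorField_apply_eq_sum]
      simp [Finset.sum_apply]
    rw [this]
    simp [MvPolynomial.smul_eq_C_mul]
  have e2 : 𝓒.linBracket X Y x y = ∑ a, C (x a) * 𝓒.linBracket X Y (Pi.single a 1) y := by
    conv_lhs => rw [eq_sum_single x]
    simp [MvPolynomial.smul_eq_C_mul, LinearMap.sum_apply]
  rw [e1, e2, bra_swap, ← ham_apply, lin_apply X x, lin_apply X, map_sum,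
    ← Finset.sum_neg_distrib, ← Finset.sum_add_distrib, ← Finset.sum_sub_distrib]
  refine Finset.sum_congr rfl fun a _ => ?_
  rw [Derivation.leibniz, ham_apply, ham_apply, bra_swap, bra_X_lin, bra_lin_C, smul_eq_mul,
    smul_eq_mul, vecDer_apply]
  ring

theorem bra_map (σ : MvPolynomial (Curve n g × ι) A →+* MvPolynomial (Curve n g × ι) A)
    (τ : A → A) (hσ : ∀ F, σ (C F) = C (τ F))
    (hXX : ∀ X a Y c, σ (𝓒.linBracket X Y (Pi.single a 1) (Pi.single c 1)) =
      𝓒.bra (σ (MvPolynomial.X (X, a))) (σ (MvPolynomial.X (Y, c))))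
    (hXC : ∀ X a F, σ (C (𝓒.anchorField X (Pi.single a 1) F)) =
      𝓒.bra (σ (MvPolynomial.X (X, a))) (C (τ F))) (φ ψ : MvPolynomial (Curve n g × ι) A) :
    σ (𝓒.bra φ ψ) = 𝓒.bra (σ φ) (σ ψ) :=
  polyBracket_map (fun _ _ => 𝓒.linBracket_swap _ _ _ _) σ τ hσ (fun _ _ => hXX _ _ _ _)
    (fun _ _ => hXC _ _ _) φ ψ

theorem commAt_of_rank_eq {X Y : Curve n g} (h : X.rank = Y.rank) {x y : ι → A}
    (hx : IsConstVec x) (hy : IsConstVec y) (Z : Curve n g) :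
    𝓒.commAt X x Y y Z = -𝓒.anchor (meet X Y) Z (𝓒.lie x y) := by
  cases X with
  | M i =>
    cases Y with
    | M j =>
      obtain rfl : i = j := Fin.ext h
      exact 𝓒.commAt_M i hx hy Z
    | A k => simp [Curve.rank] at h; omega
    | B k => simp [Curve.rank] at h; omega
  | A k =>
    cases Y with
    | M j => simp [Curve.rank] at h; omega
    | A l =>
      obtain rfl : k = l := Fin.ext (by simpa [Curve.rank] using h)
      exact 𝓒.commAt_handle _ _ k (by simp) hx hy Z
    | B l =>
      obtain rfl : k = l := Fin.ext (by simpa [Curve.rank] using h)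
      exact 𝓒.commAt_handle _ _ k (by simp) hx hy Z
  | B k =>
    cases Y with
    | M j => simp [Curve.rank] at h; omega
    | A l =>
      obtain rfl : k = l := Fin.ext (by simpa [Curve.rank] using h)
      rw [commAt_swap, 𝓒.commAt_handle (.A k) (.B k) k (by simp) hy hx Z, 𝓒.lie_swap x, map_neg]
      rfl
    | B l =>
      obtain rfl : k = l := Fin.ext (by simpa [Curve.rank] using h)
      exact 𝓒.commAt_handle _ _ k (by simp) hx hy Z

/-- The Jacobi identity for two generators and a coefficient. -/
theorem map_linBracket (X Y : Curve n g) {x y : ι → A} (hx : IsConstVec x)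
    (hy : IsConstVec y) (F : A)
    (σ : MvPolynomial (Curve n g × ι) A →+* MvPolynomial (Curve n g × ι) A)
    (hσ : ∀ X x, σ (lin X x) = lin X x + C (𝓒.anchorField X x F)) :
    σ (𝓒.linBracket X Y x y) = 𝓒.linBracket X Y x y +
      C (𝓒.anchorField X x (𝓒.anchorField Y y F) - 𝓒.anchorField Y y (𝓒.anchorField X x F)) := by
  -- `field` is linear and depends only on the components, so the componentwise formulas identify
  -- the commutator with minus an anchor field.
  have key {X Y : Curve n g} {x y : ι → A} {Z : Curve n g} {z : ι → A}
      (h : ∀ W, 𝓒.commAt X x Y y W = -𝓒.anchor Z W z) :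
      𝓒.anchorField X x (𝓒.anchorField Y y F) - 𝓒.anchorField Y y (𝓒.anchorField X x F) =
        -𝓒.anchorField Z z F := by
    rw [anchorField_comm, funext h]
    exact congrArg (fun D : Derivation ℝ A A => D F)
      (map_neg 𝓒.field fun W => 𝓒.anchor Z W z)
  rcases lt_trichotomy X.rank Y.rank with h | h | h
  · rw [linBracket_of_lt _ h, map_neg, hσ, key (𝓒.commAt_of_lt h hx hy), map_neg, neg_add]
  · rw [linBracket_of_eq _ h, map_neg, hσ, key (𝓒.commAt_of_rank_eq h hx hy), map_neg, neg_add]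
  · rw [linBracket_of_gt _ h, hσ, ← neg_sub (𝓒.anchorField Y y _), key (𝓒.commAt_of_lt h hy hx),
      neg_neg]

/-- The shift `j_a^X ↦ j_a^X + {j_a^X, F}`. -/
def shift (F : A) : MvPolynomial (Curve n g × ι) A →ₐ[A] MvPolynomial (Curve n g × ι) A :=
  aeval fun p => MvPolynomial.X p + C (𝓒.anchorField p.1 (Pi.single p.2 1) F)

theorem shift_X (F : A) (p : Curve n g × ι) : 𝓒.shift F (MvPolynomial.X p) =
    MvPolynomial.X p + C (𝓒.anchorField p.1 (Pi.single p.2 1) F) := aeval_X _ _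

theorem shift_C (F F' : A) : 𝓒.shift F (C F') = C F' := aeval_C _ _

theorem shift_lin (F : A) (X : Curve n g) (x : ι → A) :
    𝓒.shift F (lin X x) = lin X x + C (𝓒.anchorField X x F) := by
  rw [lin_apply, map_sum, anchorField_apply_eq_sum, map_sum, ← Finset.sum_add_distrib]
  refine Finset.sum_congr rfl fun a _ => ?_
  rw [map_mul, shift_C, shift_X, mul_add, map_mul]

/-- On two generators the right side expands to `{j, j'} + {j, {j', F}} - {j', {j, F}}`, with no
second-order term since functions commute; the left side is `{j, j'} + {{j, j'}, F}`. They agree by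
`map_linBracket`. -/
theorem shift_bra (F : A) (φ ψ : MvPolynomial (Curve n g × ι) A) :
    𝓒.shift F (𝓒.bra φ ψ) = 𝓒.bra (𝓒.shift F φ) (𝓒.shift F ψ) := by
  refine 𝓒.bra_map (𝓒.shift F : MvPolynomial (Curve n g × ι) A →+* _) id (fun F' => 𝓒.shift_C F F')
    (fun X a Y c => ?_) (fun X a F' => ?_) φ ψ
  · refine (𝓒.map_linBracket X Y (isConstVec_single a) (isConstVec_single c) F
      (𝓒.shift F : MvPolynomial (Curve n g × ι) A →+* _) (𝓒.shift_lin F)).trans ?_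
    change _ = 𝓒.bra (𝓒.shift F (MvPolynomial.X (X, a))) (𝓒.shift F (MvPolynomial.X (Y, c)))
    rw [shift_X, shift_X, bra_add_left, bra_add_right, bra_add_right, bra_C_C, bra_X_C,
      bra_swap _ (C _) (MvPolynomial.X _), bra_X_C, map_sub]
    have : 𝓒.bra (MvPolynomial.X (X, a)) (MvPolynomial.X (Y, c)) =
        𝓒.linBracket X Y (Pi.single a 1) (Pi.single c 1) := polyBracket_X_X _ _
    rw [this]
    ring
  · change 𝓒.shift F (C _) = 𝓒.bra (𝓒.shift F (MvPolynomial.X (X, a))) (C F')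
    rw [shift_C, shift_X, bra_add_left, bra_C_C, add_zero, bra_X_C]

/-- A symmetry of the coefficients: an automorphism `τ` of `A` with a compatible action on
vectors. -/
structure Symm (τ : A →+* A) (T : (ι → A) →+ (ι → A)) : Prop where
  map_smul : ∀ (r : A) (x : ι → A), T (r • x) = τ r • T x
  map_ad : ∀ w x, T (𝓒.ad w x) = 𝓒.ad w (T x)
  map_lie : ∀ x y, T (𝓒.lie x y) = 𝓒.lie (T x) (T y)
  map_der : ∀ Y a F, τ (𝓒.der Y a F) = ∑ c, T (Pi.single a 1) c * 𝓒.der Y c (τ F)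
  const : ∀ a, IsConstVec (T (Pi.single a 1))

namespace Symm

variable {𝓒} {τ : A →+* A} {T : (ι → A) →+ (ι → A)}

theorem map_field (h : 𝓒.Symm τ T) (s : Curve n g → ι → A) (F : A) :
    τ (𝓒.field s F) = 𝓒.field (fun Y => T (s Y)) (τ F) := by
  rw [field_apply, field_apply, map_sum]
  refine Finset.sum_congr rfl fun Y _ => ?_
  have e : T (s Y) = ∑ a, τ (s Y a) • T (Pi.single a 1) := by
    conv_lhs => rw [eq_sum_single (s Y), map_sum]
    simp only [h.map_smul]
  rw [map_sum, e]
  simp only [map_mul, h.map_der, Finset.sum_apply, Pi.smul_apply, smul_eq_mul, Finset.sum_mul,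
    Finset.mul_sum]
  rw [Finset.sum_comm]
  simp only [mul_assoc]

theorem map_anchor (h : 𝓒.Symm τ T) (X Y : Curve n g) (x : ι → A) :
    T (𝓒.anchor X Y x) = 𝓒.anchor X Y (T x) := by
  rw [anchor]
  split_ifs
  · simp [h.map_ad]
  · cases X <;> cases Y <;> simp only [ownAnchor] <;> (try split_ifs) <;> simp [h.map_ad]

theorem map_anchorField (h : 𝓒.Symm τ T) (X : Curve n g) (x : ι → A) (F : A) :
    τ (𝓒.anchorField X x F) = 𝓒.anchorField X (T x) (τ F) :=
  (h.map_field _ F).trans (congrArg (fun s => 𝓒.field s (τ F))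
    (funext fun Y => h.map_anchor X Y x))

theorem map_lin (h : 𝓒.Symm τ T)
    (σ : MvPolynomial (Curve n g × ι) A →+* MvPolynomial (Curve n g × ι) A)
    (hC : ∀ F, σ (C F) = C (τ F))
    (hX : ∀ X a, σ (MvPolynomial.X (X, a)) = lin X (T (Pi.single a 1))) (X : Curve n g)
    (x : ι → A) : σ (lin X x) = lin X (T x) := by
  conv_rhs => rw [eq_sum_single x, map_sum]
  rw [lin_apply]
  simp only [map_sum, map_mul, hC, hX, h.map_smul, _root_.map_smul, MvPolynomial.smul_eq_C_mul]

/-- The bracket of generators and their anchors are built from `ad`, `lie` and `der`, which the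
symmetry intertwines. The image of a basis vector has constant coefficients, so no derivative terms
appear. -/
theorem map_bra (h : 𝓒.Symm τ T)
    (σ : MvPolynomial (Curve n g × ι) A →+* MvPolynomial (Curve n g × ι) A)
    (hC : ∀ F, σ (C F) = C (τ F))
    (hX : ∀ X a, σ (MvPolynomial.X (X, a)) = lin X (T (Pi.single a 1)))
    (φ ψ : MvPolynomial (Curve n g × ι) A) : σ (𝓒.bra φ ψ) = 𝓒.bra (σ φ) (σ ψ) := by
  have hl := h.map_lin σ hC hX
  refine 𝓒.bra_map σ τ hC (fun X a Y c => ?_) (fun X a F' => ?_) φ ψ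
  · rw [hX, hX, bra_lin_lin, h.const, h.const, map_zero, map_zero, add_zero, sub_zero]
    rcases lt_trichotomy X.rank Y.rank with hr | hr | hr
    · rw [linBracket_of_lt _ hr, linBracket_of_lt _ hr, map_neg, hl, h.map_lie]
      simp [h.map_ad]
    · rw [linBracket_of_eq _ hr, linBracket_of_eq _ hr, map_neg, hl, h.map_lie]
    · rw [linBracket_of_gt _ hr, linBracket_of_gt _ hr, hl, h.map_lie]
      simp [h.map_ad]
  · rw [hX, hC, bra_lin_C, h.map_anchorField]

end Symm

end FlowerCalculus

/-! ### Blocks of curves of equal rank and their words. -/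

namespace Curve
variable {n g : ℕ}

theorem sum_eq {N : Type*} [AddCommMonoid N] (f : Curve n g → N) :
    ∑ X, f X = (∑ i, f (M i)) + ((∑ k, f (A k)) + ∑ k, f (B k)) := by
  let e : Fin n ⊕ (Fin g ⊕ Fin g) ≃ Curve n g :=
    { toFun := Sum.elim M (Sum.elim A B)
      invFun := fun X => match X with
        | M i => Sum.inl i
        | A k => Sum.inr (Sum.inl k)
        | B k => Sum.inr (Sum.inr k)
      left_inv := by rintro (i | k | k) <;> rfl
      right_inv := by rintro (i | k | k) <;> rfl }
  rw [← e.sum_comp, Fintype.sum_sum_type, Fintype.sum_sum_type]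
  rfl

/-- The word of the `r`-th block: the punctures come first, then the handles. -/
def block (n g r : ℕ) : FreeGroup (Curve n g) :=
  if h : r < n then word (M ⟨r, h⟩)
  else if h : r - n < g then wordK n ⟨r - n, h⟩ else 1

/-- The product of the words of the first `r` blocks. -/
def pre (n g : ℕ) : ℕ → FreeGroup (Curve n g)
  | 0 => 1
  | r + 1 => block n g r * pre n g r

theorem block_M (i : Fin n) : block n g i = word (M i) := by simp [block]

theorem block_K (k : Fin g) : block n g (n + k) = wordK n k := by simp [block]

theorem rank_lt (X : Curve n g) : X.rank < n + g := by
  cases X <;> simp [rank]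
  omega

/-- The sum over the curves of a given rank. -/
theorem sum_rank_eq {N : Type*} [AddCommMonoid N] (f : Curve n g → N) (X : Curve n g) :
    ∑ Y with Y.rank = X.rank, f Y = match X with
      | M i => f (M i)
      | A k => f (A k) + f (B k)
      | B k => f (A k) + f (B k) := by
  rw [Finset.sum_filter, sum_eq]
  cases X with
  | M i =>
    have h (k : Fin g) : ¬ (n + k = (i : ℕ)) := by omega
    simp [rank, h, Fin.val_inj]
  | A k =>
    have h (i : Fin n) : ¬ ((i : ℕ) = n + k) := by omega
    simp [rank, h, Fin.val_inj]
  | B k =>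
    have h (i : Fin n) : ¬ ((i : ℕ) = n + k) := by omega
    simp [rank, h, Fin.val_inj]

theorem exists_rank_eq {r : ℕ} (h : r < n + g) : ∃ X : Curve n g, X.rank = r := by
  by_cases hr : r < n
  · exact ⟨M ⟨r, hr⟩, rfl⟩
  · exact ⟨A ⟨r - n, by omega⟩, by simp [rank]; omega⟩

end Curve

/-! ### The total generator generates global conjugation. -/

namespace FlowerCalculus
open MvPolynomial

variable {A : Type*} [CommRing A] [Algebra ℝ A] {n g : ℕ} {ι : Type*}
    [Fintype ι] [DecidableEq ι] (𝓒 : FlowerCalculus A n g ι)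

/-- The word `A_k⁻¹ B_k⁻¹ A_k`. -/
abbrev wordABA (n : ℕ) (k : Fin g) : FreeGroup (Curve n g) :=
  (Curve.word (.A k))⁻¹ * (Curve.word (.B k))⁻¹ * Curve.word (.A k)

/-- The word `B_k⁻¹ A_k`. -/
abbrev wordBA (n : ℕ) (k : Fin g) : FreeGroup (Curve n g) :=
  (Curve.word (.B k))⁻¹ * Curve.word (.A k)

/-- The coefficients of the generators in `j^{M_i}` and `j^{H_k}`. -/
def handleCoeff : Curve n g → Module.End A (ι → A)
  | .M _ => 1
  | .A k => 1 - 𝓒.ad (wordABA n k)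
  | .B k => 𝓒.ad (wordABA n k) - 𝓒.ad (wordBA n k)

/-- The coefficients of the generators in `j^{tot}`. -/
def totCoeff (X : Curve n g) : Module.End A (ι → A) :=
  𝓒.handleCoeff X * 𝓒.ad (Curve.pre n g X.rank)

/-- The total generator `j^{tot}`. -/
def tot : (ι → A) →ₗ[A] MvPolynomial (Curve n g × ι) A :=
  ∑ X, lin X ∘ₗ 𝓒.totCoeff X

theorem tot_apply (x : ι → A) : 𝓒.tot x = ∑ X, lin X (𝓒.totCoeff X x) := by
  simp [tot, LinearMap.sum_apply]

theorem ad_mul_inv (w : FreeGroup (Curve n g)) (y : ι → A) : 𝓒.ad w (𝓒.ad w⁻¹ y) = y := by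
  rw [← Module.End.mul_apply, ← map_mul, mul_inv_cancel, map_one]; rfl

theorem ad_inv_mul (w : FreeGroup (Curve n g)) (y : ι → A) : 𝓒.ad w⁻¹ (𝓒.ad w y) = y := by
  rw [← Module.End.mul_apply, ← map_mul, inv_mul_cancel, map_one]; rfl

theorem ad_mul_apply (v w : FreeGroup (Curve n g)) (y : ι → A) :
    𝓒.ad (v * w) y = 𝓒.ad v (𝓒.ad w y) := by
  rw [map_mul]; rfl

/-- This identity explains the coefficients of `j^{H_k}`: they factor `1 - Ad(u_K)` through `1 -
Ad(u_A)` and `1 - Ad(u_B)`. -/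
theorem sum_rank_eq_handleCoeff (X : Curve n g) (v : ι → A) :
    ∑ Y : Curve n g with Y.rank = X.rank, (1 - 𝓒.adL Y) (𝓒.handleCoeff Y v) =
      v - 𝓒.ad (Curve.block n g X.rank) v := by
  rw [Curve.sum_rank_eq]
  cases X with
  | M i => simp [handleCoeff, Curve.rank, Curve.block_M]
  | A k | B k =>
    simp only [handleCoeff, Curve.rank, Curve.block_K, Curve.wordK, ad_mul_apply,
      LinearMap.sub_apply, Module.End.one_apply, map_sub, ad_mul_inv]
    abel

/-- Applied to `Ad` of the preceding prefix, the block identity is the difference of two consecutive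
prefixes, so the sum telescopes. -/
theorem sum_rank_lt_totCoeff (r : ℕ) (hr : r ≤ n + g) (x : ι → A) :
    ∑ Y : Curve n g with Y.rank < r, (1 - 𝓒.adL Y) (𝓒.totCoeff Y x) =
      x - 𝓒.ad (Curve.pre n g r) x := by
  induction r with
  | zero => simp [Curve.pre]
  | succ r ih =>
    obtain ⟨X, hX⟩ := Curve.exists_rank_eq (n := n) (g := g) (r := r) (by omega)
    have e : (Finset.univ.filter fun Y : Curve n g => Y.rank < r + 1) =
        (Finset.univ.filter fun Y : Curve n g => Y.rank < r) ∪
        (Finset.univ.filter fun Y : Curve n g => Y.rank = X.rank) := by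
      ext Y; simp; omega
    rw [e, Finset.sum_union, ih (by omega)]
    · have := 𝓒.sum_rank_eq_handleCoeff X (𝓒.ad (Curve.pre n g r) x)
      have e2 : ∑ Y : Curve n g with Y.rank = X.rank, (1 - 𝓒.adL Y) (𝓒.totCoeff Y x) =
          ∑ Y : Curve n g with Y.rank = X.rank,
            (1 - 𝓒.adL Y) (𝓒.handleCoeff Y (𝓒.ad (Curve.pre n g r) x)) := by
        refine Finset.sum_congr rfl fun Y hY => ?_
        rw [totCoeff, (Finset.mem_filter.1 hY).2, hX]
        rfl
      rw [e2, this, hX, Curve.pre, ad_mul_apply]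
      abel
    · rw [Finset.disjoint_filter]
      intro Y _ h1 h2
      omega

/-- Within its own block, the combination with handle coefficients moves each letter exactly by
conjugation, the asymmetric terms between `A_k` and `B_k` cancelling. -/
theorem sum_ownAnchor_handleCoeff (Z : Curve n g) (v : ι → A) :
    ∑ Y : Curve n g with Y.rank = Z.rank, 𝓒.ownAnchor Y Z (𝓒.handleCoeff Y v) =
      (1 - 𝓒.adL Z) v := by
  rw [Curve.sum_rank_eq]
  cases Z with
  | M i => simp [handleCoeff, ownAnchor]
  | A k | B k =>
    simp only [handleCoeff, ownAnchor, if_true, ad_mul_apply,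
      LinearMap.sub_apply, Module.End.one_apply, map_sub, ad_mul_inv]
    abel

theorem sum_rank_split {N : Type*} [AddCommMonoid N] (Z : Curve n g) (f : Curve n g → N) :
    ∑ Y, f Y = (∑ Y with Y.rank < Z.rank, f Y) + (∑ Y with Y.rank = Z.rank, f Y)
      + ∑ Y with Z.rank < Y.rank, f Y := by
  simp only [Finset.sum_filter, ← Finset.sum_add_distrib]
  refine Finset.sum_congr rfl fun Y _ => ?_
  rcases lt_trichotomy Y.rank Z.rank with h | h | h
  · simp [h, h.ne, h.not_gt]
  · simp [h]
  · simp [h, h.ne', h.not_gt]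

/-- Earlier blocks conjugate `u_Z` by `x - Ad(prefix)x`, its own block conjugates it by
`Ad(prefix)x`, and later blocks do not move it. -/
theorem sum_anchor_totCoeff (Z : Curve n g) (x : ι → A) :
    ∑ Y, 𝓒.anchor Y Z (𝓒.totCoeff Y x) = (1 - 𝓒.adL Z) x := by
  rw [sum_rank_split Z]
  have h1 : ∑ Y with Y.rank < Z.rank, 𝓒.anchor Y Z (𝓒.totCoeff Y x) =
      (1 - 𝓒.adL Z) (x - 𝓒.ad (Curve.pre n g Z.rank) x) := by
    rw [← 𝓒.sum_rank_lt_totCoeff _ Z.rank_lt.le, map_sum]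
    refine Finset.sum_congr rfl fun Y hY => ?_
    rw [𝓒.anchor_of_lt (Finset.mem_filter.1 hY).2]
    rfl
  have h2 : ∑ Y with Y.rank = Z.rank, 𝓒.anchor Y Z (𝓒.totCoeff Y x) =
      (1 - 𝓒.adL Z) (𝓒.ad (Curve.pre n g Z.rank) x) := by
    rw [← sum_ownAnchor_handleCoeff]
    refine Finset.sum_congr rfl fun Y hY => ?_
    have hY := (Finset.mem_filter.1 hY).2
    rw [𝓒.anchor_of_le hY.ge, totCoeff, hY]
    rfl
  have h3 : ∑ Y with Z.rank < Y.rank, 𝓒.anchor Y Z (𝓒.totCoeff Y x) = 0 := by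
    refine Finset.sum_eq_zero fun Y hY => ?_
    rw [𝓒.anchor_of_gt (Finset.mem_filter.1 hY).2]
    rfl
  rw [h1, h2, h3, ← map_add]
  simp

theorem bra_tot_C (x : ι → A) (F : A) :
    𝓒.bra (𝓒.tot x) (C F) = C (𝓒.field (fun Z => (1 - 𝓒.adL Z) x) F) := by
  rw [tot_apply, bra_sum_left]
  simp only [bra_lin_C, ← map_sum]
  congr 1
  simp only [← Derivation.coeFnAddMonoidHom_apply, ← Finset.sum_apply, ← map_sum]
  simp only [anchorField, LinearMap.comp_apply, ← map_sum]
  have : (∑ Y, LinearMap.pi (fun Z => 𝓒.anchor Y Z) (𝓒.totCoeff Y x)) =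
      fun Z => (1 - 𝓒.adL Z) x := by
    funext Z
    rw [Finset.sum_apply]
    exact 𝓒.sum_anchor_totCoeff Z x
  rw [this]

theorem vecDer_ad_inv (s : Curve n g → ι → A) (X : Curve n g) (y : ι → A) :
    vecDer (𝓒.field s) (𝓒.ad (FreeGroup.of X)⁻¹ y) =
      𝓒.ad (FreeGroup.of X)⁻¹ (vecDer (𝓒.field s) y - 𝓒.lie (s X) y) := by
  have h := 𝓒.vecDer_field_adL s X (𝓒.ad (FreeGroup.of X)⁻¹ y)
  rw [adL, ad_mul_inv] at h
  rw [h, add_sub_cancel_left, ad_inv_mul]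

/-- Under the field of `A_k` the combinations `u_A⁻¹ u_B⁻¹ u_A` and `u_B⁻¹ u_A` are translated from
the left by `x` alone, although the individual letters move in a more complicated way. -/
theorem vecDer_handle_A (k : Fin g) (x v : ι → A)
    (hv : vecDer (𝓒.anchorField (.A k) x) v = 0) :
    vecDer (𝓒.anchorField (.A k) x) (𝓒.ad (wordABA n k) v) = 𝓒.lie x (𝓒.ad (wordABA n k) v) ∧
    vecDer (𝓒.anchorField (.A k) x) (𝓒.ad (wordBA n k) v) = 𝓒.lie x (𝓒.ad (wordBA n k) v) := by
  have hAA : 𝓒.anchor (.A k) (.A k) = 1 - 𝓒.adL (.A k) := by simp [anchor, ownAnchor]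
  have hAB : 𝓒.anchor (.A k) (.B k) = 1 - 𝓒.adL (.A k) - 𝓒.adL (.B k) := by
    simp [anchor, Curve.rank, ownAnchor]
  have hA := fun y => 𝓒.vecDer_anchorField_adL (.A k) (.A k) x y
  have hA' := fun y => 𝓒.vecDer_ad_inv (fun Y => 𝓒.anchor (.A k) Y x) (.A k) y
  have hB' := fun y => 𝓒.vecDer_ad_inv (fun Y => 𝓒.anchor (.A k) Y x) (.B k) y
  change ∀ y, vecDer (𝓒.anchorField (.A k) x) _ = 𝓒.ad _ (vecDer (𝓒.anchorField (.A k) x) y - _)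
    at hA'
  change ∀ y, vecDer (𝓒.anchorField (.A k) x) _ = 𝓒.ad _ (vecDer (𝓒.anchorField (.A k) x) y - _)
    at hB'
  simp only [hAA, hAB] at hA hA' hB'
  constructor <;>
  · simp only [ad_mul_apply, hA, hA', hB', hv, LinearMap.sub_apply, Module.End.one_apply, map_sub,
      map_add, map_zero, 𝓒.ad_lie, ad_inv_mul]
    abel

theorem vecDer_handle_B (k : Fin g) (x v : ι → A)
    (hv : vecDer (𝓒.anchorField (.B k) x) v = 0) :
    vecDer (𝓒.anchorField (.B k) x) (𝓒.ad (wordABA n k) v) = 0 ∧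
    vecDer (𝓒.anchorField (.B k) x) (𝓒.ad (wordBA n k) v) = 𝓒.lie x (𝓒.ad (wordBA n k) v) := by
  have hBB : 𝓒.anchor (.B k) (.B k) = 1 - 𝓒.adL (.B k) := by simp [anchor, ownAnchor]
  have hBA : 𝓒.anchor (.B k) (.A k) = 1 := by
    simp [anchor, Curve.rank, ownAnchor]
  have hA := fun y => 𝓒.vecDer_anchorField_adL (.B k) (.A k) x y
  have hA' := fun y => 𝓒.vecDer_ad_inv (fun Y => 𝓒.anchor (.B k) Y x) (.A k) y
  have hB' := fun y => 𝓒.vecDer_ad_inv (fun Y => 𝓒.anchor (.B k) Y x) (.B k) y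
  change ∀ y, vecDer (𝓒.anchorField (.B k) x) _ = 𝓒.ad _ (vecDer (𝓒.anchorField (.B k) x) y - _)
    at hA'
  change ∀ y, vecDer (𝓒.anchorField (.B k) x) _ = 𝓒.ad _ (vecDer (𝓒.anchorField (.B k) x) y - _)
    at hB'
  simp only [hBB, hBA] at hA hA' hB'
  constructor <;>
  · simp only [ad_mul_apply, hA, hA', hB', hv, LinearMap.sub_apply, Module.End.one_apply, map_sub,
      map_add, map_zero, 𝓒.ad_lie, ad_inv_mul]
    abel

/-- The field of a generator translates the word of its own block from the left by the same vector
by which it conjugates all later letters. -/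
theorem vecDer_block (X : Curve n g) (x v : ι → A)
    (hv : vecDer (𝓒.anchorField X x) v = 0) :
    vecDer (𝓒.anchorField X x) (𝓒.ad (Curve.block n g X.rank) v) =
      𝓒.lie ((1 - 𝓒.adL X) x) (𝓒.ad (Curve.block n g X.rank) v) := by
  cases X with
  | M i =>
    have hM : 𝓒.anchor (.M i) (.M i) = 1 - 𝓒.adL (.M i) := by simp [anchor, ownAnchor]
    rw [Curve.rank, Curve.block_M]
    exact (𝓒.vecDer_anchorField_adL (.M i) (.M i) x v).trans (by rw [hv, map_zero, add_zero, hM])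
  | A k =>
    have h := (𝓒.vecDer_handle_A k x v hv).1
    have hAB : 𝓒.anchor (.A k) (.B k) = 1 - 𝓒.adL (.A k) - 𝓒.adL (.B k) := by
      simp [anchor, Curve.rank, ownAnchor]
    have e : Curve.wordK n k = Curve.word (.B k) * wordABA n k := by
      simp [Curve.wordK, mul_assoc]
    rw [Curve.rank, Curve.block_K, e, ad_mul_apply]
    refine (𝓒.vecDer_anchorField_adL (.A k) (.B k) x _).trans ?_
    rw [h, 𝓒.ad_lie, hAB]
    simp only [LinearMap.sub_apply, Module.End.one_apply, map_sub]
    abel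
  | B k =>
    have h := (𝓒.vecDer_handle_B k x v hv).1
    have hBB : 𝓒.anchor (.B k) (.B k) = 1 - 𝓒.adL (.B k) := by simp [anchor, ownAnchor]
    have e : Curve.wordK n k = Curve.word (.B k) * wordABA n k := by
      simp [Curve.wordK, mul_assoc]
    rw [Curve.rank, Curve.block_K, e, ad_mul_apply]
    refine (𝓒.vecDer_anchorField_adL (.B k) (.B k) x _).trans ?_
    rw [h, map_zero, add_zero, hBB]

theorem twisted_block {δ : Derivation ℝ A A} {z : ι → A} {r : ℕ}
    (h : ∀ Z : Curve n g, Z.rank = r → 𝓒.Twisted δ z (𝓒.adL Z)) :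
    𝓒.Twisted δ z (𝓒.ad (Curve.block n g r)) := by
  rw [Curve.block]
  split_ifs with h1 h2
  · exact h _ rfl
  · have hA := h (.A ⟨r - n, h2⟩) (by simp [Curve.rank]; omega)
    have hB := h (.B ⟨r - n, h2⟩) (by simp [Curve.rank]; omega)
    exact ((hB.ad_mul hA.inv).ad_mul hB.inv).ad_mul hA
  · rw [map_one]; exact Twisted.one

theorem twisted_handleCoeff {δ : Derivation ℝ A A} {z : ι → A} {X : Curve n g}
    (h : ∀ Z : Curve n g, Z.rank = X.rank → 𝓒.Twisted δ z (𝓒.adL Z)) :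
    𝓒.Twisted δ z (𝓒.handleCoeff X) := by
  cases X with
  | M i => exact Twisted.one
  | A k | B k =>
    have hA := h (.A k) rfl
    have hB := h (.B k) rfl
    first
    | exact Twisted.one.sub ((hA.inv.ad_mul hB.inv).ad_mul hA)
    | exact ((hA.inv.ad_mul hB.inv).ad_mul hA).sub (hB.inv.ad_mul hA)

theorem vecDer_pre_of_le (X : Curve n g) (x : ι → A) {y : ι → A} (hy : IsConstVec y) (r : ℕ)
    (hr : r ≤ X.rank) : vecDer (𝓒.anchorField X x) (𝓒.ad (Curve.pre n g r) y) = 0 := by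
  induction r with
  | zero => rw [Curve.pre, map_one]; exact hy _
  | succ r ih =>
    rw [Curve.pre, ad_mul_apply]
    exact (𝓒.twisted_block fun Z hZ => 𝓒.twisted_zero_of_gt (by omega) x).apply_zero (ih (by omega))

/-- Once the block of `X` has been passed, the prefix is translated from the left by `z`, and each
further block is conjugated by `z`. A conjugated factor times a translated one is again translated
by `z`. -/
theorem vecDer_pre_of_lt (X : Curve n g) (x : ι → A) {y : ι → A} (hy : IsConstVec y) (r : ℕ)
    (hr : X.rank < r) : vecDer (𝓒.anchorField X x) (𝓒.ad (Curve.pre n g r) y) =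
      𝓒.lie ((1 - 𝓒.adL X) x) (𝓒.ad (Curve.pre n g r) y) := by
  induction r with
  | zero => omega
  | succ r ih =>
    rw [Curve.pre, ad_mul_apply]
    rcases (Nat.lt_succ_iff.1 hr).lt_or_eq with h | h
    · rw [(𝓒.twisted_block fun Z hZ => 𝓒.twisted_of_lt (hZ ▸ h) x) _, ih h]
      abel
    · subst h
      exact 𝓒.vecDer_block X x _ (𝓒.vecDer_pre_of_le X x hy _ le_rfl)

/-- Blocks before `Z` contribute only brackets of generators, which telescope to `y - Ad(prefix)y`.
In the block of `Z` the derivatives of the handle coefficients cancel all but the term with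
`Ad(prefix)y`. In later blocks the bracket of generators cancels the derivative of the coefficient.
-/
theorem bra_X_tot (Z : Curve n g) (c : ι) {y : ι → A} (hy : IsConstVec y) :
    𝓒.bra (MvPolynomial.X (Z, c)) (𝓒.tot y) = lin Z (𝓒.lie y (Pi.single c 1)) := by
  set x : ι → A := Pi.single c 1 with hx
  have h0 : 𝓒.bra (MvPolynomial.X (Z, c)) (𝓒.tot y) =
      ∑ Y, (𝓒.linBracket Z Y x (𝓒.totCoeff Y y) +
        lin Y (vecDer (𝓒.anchorField Z x) (𝓒.totCoeff Y y))) := by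
    rw [tot_apply, ← ham_apply, map_sum]
    exact Finset.sum_congr rfl fun Y _ => (𝓒.ham_apply _ _).trans (𝓒.bra_X_lin _ _ _)
  rw [h0, sum_rank_split Z]
  have h1 : ∑ Y with Y.rank < Z.rank, (𝓒.linBracket Z Y x (𝓒.totCoeff Y y) +
        lin Y (vecDer (𝓒.anchorField Z x) (𝓒.totCoeff Y y))) =
      lin Z (𝓒.lie (y - 𝓒.ad (Curve.pre n g Z.rank) y) x) := by
    rw [← 𝓒.sum_rank_lt_totCoeff _ Z.rank_lt.le]
    simp only [map_sum, LinearMap.sum_apply]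
    refine Finset.sum_congr rfl fun Y hY => ?_
    have hY := (Finset.mem_filter.1 hY).2
    have : vecDer (𝓒.anchorField Z x) (𝓒.totCoeff Y y) = 0 :=
      (𝓒.twisted_handleCoeff fun W hW => 𝓒.twisted_zero_of_gt (hW ▸ hY) x).apply_zero
        (𝓒.vecDer_pre_of_le Z x hy _ hY.le)
    rw [this, map_zero, add_zero, linBracket_of_gt _ hY]
  have h3 : ∑ Y with Z.rank < Y.rank, (𝓒.linBracket Z Y x (𝓒.totCoeff Y y) +
        lin Y (vecDer (𝓒.anchorField Z x) (𝓒.totCoeff Y y))) = 0 := by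
    refine Finset.sum_eq_zero fun Y hY => ?_
    have hY := (Finset.mem_filter.1 hY).2
    have : vecDer (𝓒.anchorField Z x) (𝓒.totCoeff Y y) =
        𝓒.lie ((1 - 𝓒.adL Z) x) (𝓒.totCoeff Y y) := by
      refine ((𝓒.twisted_handleCoeff fun W hW => 𝓒.twisted_of_lt (hW ▸ hY) x) _).trans ?_
      rw [𝓒.vecDer_pre_of_lt Z x hy _ hY, totCoeff, Module.End.mul_apply]
      abel
    rw [this, linBracket_of_lt _ hY, neg_add_cancel]
  have h2 : ∑ Y with Y.rank = Z.rank, (𝓒.linBracket Z Y x (𝓒.totCoeff Y y) +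
        lin Y (vecDer (𝓒.anchorField Z x) (𝓒.totCoeff Y y))) =
      lin Z (𝓒.lie (𝓒.ad (Curve.pre n g Z.rank) y) x) := by
    have hv := 𝓒.vecDer_pre_of_le Z x hy _ le_rfl
    set v := 𝓒.ad (Curve.pre n g Z.rank) y
    have e : ∑ Y with Y.rank = Z.rank, (𝓒.linBracket Z Y x (𝓒.totCoeff Y y) +
        lin Y (vecDer (𝓒.anchorField Z x) (𝓒.totCoeff Y y))) =
        ∑ Y with Y.rank = Z.rank, (-lin (meet Z Y) (𝓒.lie x (𝓒.handleCoeff Y v)) +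
        lin Y (vecDer (𝓒.anchorField Z x) (𝓒.handleCoeff Y v))) := by
      refine Finset.sum_congr rfl fun Y hY => ?_
      have hY := (Finset.mem_filter.1 hY).2
      rw [linBracket_of_eq _ hY.symm, totCoeff, hY]
      rfl
    rw [e, Curve.sum_rank_eq, 𝓒.lie_swap v x]
    cases Z with
    | M i => simp [meet, handleCoeff, hv]
    | A k =>
      obtain ⟨e1, e2⟩ := 𝓒.vecDer_handle_A k x v hv
      simp only [meet, handleCoeff, LinearMap.sub_apply, Module.End.one_apply, map_sub, hv, e1, e2,
        map_neg, map_zero]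
      abel
    | B k =>
      obtain ⟨e1, e2⟩ := 𝓒.vecDer_handle_B k x v hv
      simp only [meet, handleCoeff, LinearMap.sub_apply, Module.End.one_apply, map_sub, hv, e1, e2,
        map_neg, map_zero]
      abel
  rw [h1, h2, h3, add_zero, ← map_add, ← LinearMap.add_apply, ← map_add, sub_add_cancel]

theorem bra_tot_X (Z : Curve n g) (c : ι) {y : ι → A} (hy : IsConstVec y) :
    𝓒.bra (𝓒.tot y) (MvPolynomial.X (Z, c)) = -lin Z (𝓒.lie y (Pi.single c 1)) := by
  rw [bra_swap, bra_X_tot _ _ _ hy]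

end FlowerCalculus

/-! ### Ordered products over segments of indices, and telescoping sums. -/

section Segments

/-- The product `f_{hi-1} ⋯ f_{lo+1} f_lo`. -/
def segProd {m : ℕ} {H : Type*} [Monoid H] (f : Fin m → H) (lo hi : ℕ) : H :=
  ((((List.finRange m).filter fun i => lo ≤ i.val ∧ i.val < hi).map f).reverse).prod

variable {m : ℕ} {H : Type*} [Monoid H] (f : Fin m → H)

theorem segProd_self (lo : ℕ) : segProd f lo lo = 1 := by
  have : (List.finRange m).filter (fun i => lo ≤ i.val ∧ i.val < lo) = [] := by
    rw [List.filter_eq_nil_iff]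
    intro i _
    simp
  rw [segProd, this]
  simp

theorem eq_of_sortedLT_of_mem_iff {l l' : List (Fin m)} (h : l.Pairwise (· < ·))
    (h' : l'.Pairwise (· < ·)) (hm : ∀ i, i ∈ l ↔ i ∈ l') : l = l' := by
  have hp : l.Perm l' := (List.perm_ext_iff_of_nodup (h.imp fun h => h.ne) (h'.imp fun h => h.ne)).2 hm
  exact hp.eq_of_pairwise (fun a b _ _ h1 h2 => absurd h1 h2.not_gt) h h'

theorem pairwise_filter_finRange (p : Fin m → Bool) :
    ((List.finRange m).filter p).Pairwise (· < ·) :=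
  (List.pairwise_lt_finRange m).filter _

/-- The increasing list of indices is reversed before multiplying, so a new largest index appears as
the leftmost factor. -/
theorem segProd_succ_right {lo : ℕ} (k : Fin m) (h : lo ≤ k) :
    segProd f lo (k + 1) = f k * segProd f lo k := by
  have : (List.finRange m).filter (fun i => lo ≤ i.val ∧ i.val < k.val + 1) =
      (List.finRange m).filter (fun i => lo ≤ i.val ∧ i.val < k.val) ++ [k] := by
    refine eq_of_sortedLT_of_mem_iff (pairwise_filter_finRange _) ?_ fun i => ?_
    · rw [List.pairwise_append]
      refine ⟨pairwise_filter_finRange _, List.pairwise_singleton _ _, fun a ha c hc => ?_⟩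
      simp at ha hc
      subst hc
      exact Fin.lt_def.2 ha.2
    · simp [Fin.ext_iff]
      omega
  rw [segProd, this, segProd]
  simp

theorem segProd_succ_left {hi : ℕ} (k : Fin m) (h : (k : ℕ) < hi) :
    segProd f k hi = segProd f (k + 1) hi * f k := by
  have : (List.finRange m).filter (fun i => k.val ≤ i.val ∧ i.val < hi) =
      k :: (List.finRange m).filter (fun i => k.val + 1 ≤ i.val ∧ i.val < hi) := by
    refine eq_of_sortedLT_of_mem_iff (pairwise_filter_finRange _) ?_ fun i => ?_
    · rw [List.pairwise_cons]
      refine ⟨fun a ha => ?_, pairwise_filter_finRange _⟩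
      simp at ha
      exact Fin.lt_def.2 (by omega)
    · simp [Fin.ext_iff]
      omega
  rw [segProd, this, segProd]
  simp

/-- A telescoping sum. -/
theorem sum_lt_sub {N : Type*} [AddCommGroup N] (F : ℕ → N) (l : Fin m) :
    ∑ k : Fin m with k < l, (F (k + 1) - F k) = F l - F 0 := by
  have e : ∑ k : Fin m with k < l, (F (k + 1) - F k) =
      ∑ k ∈ Finset.range l, (F (k + 1) - F k) := by
    refine Finset.sum_bij (fun k _ => (k : ℕ)) (fun k hk =>
        Finset.mem_range.2 (Fin.lt_def.1 (Finset.mem_filter.1 hk).2))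
      (fun _ _ _ _ h => Fin.ext h) (fun k hk => ?_) fun _ _ => rfl
    have := Finset.mem_range.1 hk
    exact ⟨⟨k, by omega⟩, Finset.mem_filter.2 ⟨Finset.mem_univ _, Fin.lt_def.2 this⟩, rfl⟩
  rw [e, Finset.sum_range_sub]

theorem sum_sub_succ {N : Type*} [AddCommGroup N] (F : ℕ → N) :
    ∑ k : Fin m, (F (k + 1) - F k) = F m - F 0 := by
  rw [Fin.sum_univ_eq_sum_range (fun k => F (k + 1) - F k), Finset.sum_range_sub]

end Segments

namespace Curve
variable {n g : ℕ}

theorem prodM_zero_eq_pre (i : ℕ) (hi : i ≤ n) : prodM n g 0 i = pre n g i := by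
  induction i with
  | zero => exact segProd_self _ _
  | succ i ih =>
    have h : prodM n g 0 (i + 1) = word (M ⟨i, hi⟩) * prodM n g 0 i :=
      segProd_succ_right (fun i => word (M i)) ⟨i, hi⟩ (Nat.zero_le i)
    rw [h, ih (by omega), pre, ← block_M]

theorem prodK_zero_eq_pre (k : ℕ) (hk : k ≤ g) :
    prodK n g 0 k * prodM n g 0 n = pre n g (n + k) := by
  induction k with
  | zero =>
    rw [prodM_zero_eq_pre n le_rfl]
    have : prodK n g 0 0 = 1 := segProd_self _ _
    rw [this, one_mul, add_zero]
  | succ k ih =>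
    have h : prodK n g 0 (k + 1) = wordK n ⟨k, by omega⟩ * prodK n g 0 k :=
      segProd_succ_right (wordK n) ⟨k, by omega⟩ (Nat.zero_le k)
    rw [h, mul_assoc, ih (by omega), ← add_assoc, pre, ← block_K]

end Curve

/-! ### The total generator in terms of the decoupled generators. -/

namespace FlowerCalculus

variable {A : Type*} [CommRing A] [Algebra ℝ A] {n g : ℕ} {ι : Type*}
    [Fintype ι] [DecidableEq ι] (𝓒 : FlowerCalculus A n g ι)

/-- The linear element `j^{H_k}`. -/
def linH (k : Fin g) : (ι → A) →ₗ[A] MvPolynomial (Curve n g × ι) A :=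
  lin (.A k) ∘ₗ (1 - 𝓒.ad (wordABA n k)) + lin (.B k) ∘ₗ (𝓒.ad (wordABA n k) - 𝓒.ad (wordBA n k))

theorem tot_eq (x : ι → A) : 𝓒.tot x =
    (∑ i : Fin n, lin (.M i) (𝓒.ad (Curve.prodM n g 0 i) x)) +
    ∑ k : Fin g, 𝓒.linH k (𝓒.ad (Curve.prodK n g 0 k * Curve.prodM n g 0 n) x) := by
  rw [tot_apply, Curve.sum_eq, ← Finset.sum_add_distrib]
  congr 1
  · refine Finset.sum_congr rfl fun i _ => ?_
    rw [Curve.prodM_zero_eq_pre _ i.2.le, totCoeff]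
    rfl
  · refine Finset.sum_congr rfl fun k _ => ?_
    rw [Curve.prodK_zero_eq_pre _ k.2.le]
    rfl

/-- The sum over the handles after the `k`-th one. -/
def linTail (k : Fin g) : (ι → A) →ₗ[A] MvPolynomial (Curve n g × ι) A :=
  ∑ l with k < l, 𝓒.linH l ∘ₗ 𝓒.ad (Curve.prodK n g (k + 1) l)

/-- The decoupled generator `j^{M_i'}`. -/
def linM' (i : Fin n) (x : ι → A) : MvPolynomial (Curve n g × ι) A :=
  lin (.M i) x - ((∑ k with i < k, lin (.M k) (𝓒.ad (Curve.prodM n g (i + 1) k)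
      ((1 - 𝓒.adL (.M i)) x)))
    + ∑ k : Fin g, 𝓒.linH k (𝓒.ad (Curve.prodK n g 0 k * Curve.prodM n g (i + 1) n)
      ((1 - 𝓒.adL (.M i)) x)))

/-- The decoupled generator `j^{A_k'}`. -/
def linA' (k : Fin g) : (ι → A) →ₗ[A] MvPolynomial (Curve n g × ι) A :=
  lin (.A k) + (lin (.A k) - lin (.B k)) ∘ₗ 𝓒.ad (Curve.word (.A k))⁻¹
    + 𝓒.linTail k ∘ₗ (𝓒.ad (Curve.word (.A k))
      - 𝓒.ad (Curve.word (.B k) * (Curve.word (.A k))⁻¹))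

/-- The decoupled generator `j^{B_k'}`. -/
def linB' (k : Fin g) : (ι → A) →ₗ[A] MvPolynomial (Curve n g × ι) A :=
  lin (.B k) + (lin (.A k) - lin (.B k)) ∘ₗ 𝓒.ad (Curve.word (.A k))⁻¹
    + 𝓒.linTail k ∘ₗ (𝓒.ad (Curve.word (.B k))
      - 𝓒.ad (Curve.word (.B k) * (Curve.word (.A k))⁻¹))

/-- The terms with `Ad(u_A)⁻²` cancel between the two primed generators. What remains is `j^{H_k}`,
and the coefficient of the tail collapses to `Ad(u_K) - 1`. -/
theorem linA'_add_linB' (k : Fin g) (x : ι → A) :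
    𝓒.linA' k (x - 𝓒.ad (Curve.word (.A k))⁻¹ x)
      + 𝓒.linB' k (𝓒.ad (Curve.word (.A k))⁻¹ x
        - 𝓒.ad ((Curve.word (.B k))⁻¹ * Curve.word (.A k)) x) =
      𝓒.linH k x + 𝓒.linTail k (𝓒.ad (Curve.wordK n k) x - x) := by
  simp only [linA', linB', linH, Curve.wordK, ad_mul_apply, LinearMap.add_apply,
    LinearMap.comp_apply, LinearMap.sub_apply, Module.End.one_apply, map_sub, ad_mul_inv]
  abel

/-- For a fixed handle `l`, the tails of all `k < l` contribute consecutive differences of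
`Ad(u_{K_{l-1}} ⋯ u_{K_k})x`, which sum to the full product minus `x`. -/
theorem sum_linTail (x : ι → A) :
    ∑ k : Fin g, (𝓒.linH k x + 𝓒.linTail k (𝓒.ad (Curve.wordK n k) x - x)) =
      ∑ k : Fin g, 𝓒.linH k (𝓒.ad (Curve.prodK n g 0 k) x) := by
  have e : ∑ k : Fin g, 𝓒.linTail k (𝓒.ad (Curve.wordK n k) x - x) =
      ∑ l : Fin g, ∑ k : Fin g with k < l, 𝓒.linH l
        (𝓒.ad (Curve.prodK n g k l) x - 𝓒.ad (Curve.prodK n g (k + 1) l) x) := by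
    simp only [linTail, LinearMap.sum_apply, LinearMap.comp_apply]
    rw [Finset.sum_comm' (t' := Finset.univ)
      (s' := fun l => Finset.univ.filter fun k => k < l) (by simp)]
    refine Finset.sum_congr rfl fun l _ => Finset.sum_congr rfl fun k hk => ?_
    have h : Curve.prodK n g k l = Curve.prodK n g (k + 1) l * Curve.wordK n k :=
      segProd_succ_left (Curve.wordK n) k (by simpa using hk)
    rw [h, ad_mul_apply, map_sub]
  rw [Finset.sum_add_distrib, e, ← Finset.sum_add_distrib]
  refine Finset.sum_congr rfl fun l _ => ?_
  rw [← map_sum, ← map_add]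
  have t := sum_lt_sub (fun k => -𝓒.ad (Curve.prodK n g k l) x) l
  have hl : Curve.prodK n g l l = 1 := segProd_self _ _
  simp only [neg_sub_neg, hl, map_one, Module.End.one_apply] at t
  rw [t]
  congr 1
  abel

/-- The factor `1 - Ad(u_{M_i})` lengthens each product by one letter, so the sums over `i`
telescope. The subtracted handle terms are exactly the sum that the decoupled handles contribute by
`sum_linTail`. -/
theorem sum_linM' (x : ι → A) :
    ∑ i : Fin n, 𝓒.linM' i x = (∑ i : Fin n, lin (.M i) (𝓒.ad (Curve.prodM n g 0 i) x)) +
      ∑ k : Fin g, (𝓒.linH k (𝓒.ad (Curve.prodK n g 0 k * Curve.prodM n g 0 n) x)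
        - 𝓒.linH k (𝓒.ad (Curve.prodK n g 0 k) x)) := by
  have hs {i : Fin n} {hi : ℕ} (h : (i : ℕ) < hi) :
      𝓒.ad (Curve.prodM n g (i + 1) hi) ((1 - 𝓒.adL (.M i)) x) =
        𝓒.ad (Curve.prodM n g (i + 1) hi) x - 𝓒.ad (Curve.prodM n g i hi) x := by
    have h : Curve.prodM n g i hi = Curve.prodM n g (i + 1) hi * Curve.word (.M i) :=
      segProd_succ_left (fun i => Curve.word (.M i)) i h
    rw [h, ad_mul_apply, LinearMap.sub_apply, map_sub]
    rfl
  have e1 : ∑ i : Fin n, ∑ k : Fin n with i < k, lin (.M k : Curve n g)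
      (𝓒.ad (Curve.prodM n g (i + 1) k) ((1 - 𝓒.adL (.M i)) x)) =
      ∑ k : Fin n, lin (.M k : Curve n g) (x - 𝓒.ad (Curve.prodM n g 0 k) x) := by
    rw [Finset.sum_comm' (t' := Finset.univ)
      (s' := fun l => Finset.univ.filter fun k => k < l) (by simp)]
    refine Finset.sum_congr rfl fun k _ => ?_
    rw [← map_sum]
    congr 1
    have t := sum_lt_sub (fun i => 𝓒.ad (Curve.prodM n g i k) x) k
    have hl : Curve.prodM n g k k = 1 := segProd_self _ _
    simp only [hl, map_one, Module.End.one_apply] at t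
    rw [← t]
    exact Finset.sum_congr rfl fun i hi => hs (by simpa using hi)
  have e2 : ∑ i : Fin n, ∑ k : Fin g, 𝓒.linH k (𝓒.ad (Curve.prodK n g 0 k *
      Curve.prodM n g (i + 1) n) ((1 - 𝓒.adL (.M i)) x)) =
      ∑ k : Fin g, 𝓒.linH k (𝓒.ad (Curve.prodK n g 0 k)
        (x - 𝓒.ad (Curve.prodM n g 0 n) x)) := by
    rw [Finset.sum_comm]
    refine Finset.sum_congr rfl fun k _ => ?_
    simp only [ad_mul_apply]
    rw [← map_sum, ← map_sum]
    congr 2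
    have t := sum_sub_succ (m := n) (fun i => 𝓒.ad (Curve.prodM n g i n) x)
    have hl : Curve.prodM n g n n = 1 := segProd_self _ _
    simp only [hl, map_one, Module.End.one_apply] at t
    rw [← t]
    exact Finset.sum_congr rfl fun i _ => hs i.2
  simp only [linM', Finset.sum_sub_distrib, Finset.sum_add_distrib]
  rw [e1, e2]
  simp only [map_sub, Finset.sum_sub_distrib, ad_mul_apply]
  abel

theorem tot_eq_decoupled (x : ι → A) : 𝓒.tot x = (∑ i : Fin n, 𝓒.linM' i x) +
    ∑ k : Fin g, (𝓒.linA' k (x - 𝓒.ad (Curve.word (.A k))⁻¹ x)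
      + 𝓒.linB' k (𝓒.ad (Curve.word (.A k))⁻¹ x
        - 𝓒.ad ((Curve.word (.B k))⁻¹ * Curve.word (.A k)) x)) := by
  simp only [linA'_add_linB']
  rw [sum_linTail, sum_linM', tot_eq, Finset.sum_sub_distrib]
  abel

end FlowerCalculus

/-! ### Left translations on `G^{n+2g}` as derivations of smooth functions. -/

section Translations

variable {E : Type*} [NormedAddCommGroup E] [NormedSpace ℝ E] {n g : ℕ}
  {G : Type*} [TopologicalSpace G] [ChartedSpace E G] [Group G] [LieGroup 𝓘(ℝ, E) ∞ G]

open Function (update)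

theorem contMDiff_update_of {F' : Type*} [NormedAddCommGroup F'] [NormedSpace ℝ F'] {H : Type*}
    [TopologicalSpace H] {J : ModelWithCorners ℝ F' H} {N : Type*} [TopologicalSpace N]
    [ChartedSpace H N] {v : N → Curve n g → G} (hv : ContMDiff J (piModel E (Curve n g)) ∞ v)
    (X : Curve n g) {k : N → G} (hk : ContMDiff J 𝓘(ℝ, E) ∞ k) :
    ContMDiff J (piModel E (Curve n g)) ∞ fun p => update (v p) X (k p) := by
  refine contMDiff_pi_of fun Y => ?_
  by_cases hY : Y = X
  · subst hY
    simpa only [Function.update_self] using hk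
  · simpa only [Function.update_of_ne hY] using! (contMDiff_proj Y).comp hv

theorem contMDiff_translate (F : Coeff E n g G) (X : Curve n g) (u : Curve n g → G) (z : G) :
    ContMDiff 𝓘(ℝ, E) 𝓘(ℝ, ℝ) ∞ fun x : G => F (update u X (x * z)) := by
  have := contMDiffMul (E := E) (G := G)
  exact F.contMDiff.comp (contMDiff_update_of contMDiff_const X
    (contMDiff_id.mul contMDiff_const))

/-- The derivation of `C^∞(G^{n+2g})` that translates the holonomy `u_X` from the left by `ξ`. -/
def transl (X : Curve n g) (ξ : GroupLieAlgebra 𝓘(ℝ, E) G) :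
    Derivation ℝ (Coeff E n g G) (Coeff E n g G) :=
  Derivation.mk'
    { toFun := fun F => -JL X ξ F
      map_add' := fun F F' => by
        ext u
        change - -dirDeriv _ ξ = - -dirDeriv _ ξ + - -dirDeriv _ ξ
        simp only [neg_neg]
        exact dirDeriv_add (contMDiff_translate F X u _) (contMDiff_translate F' X u _) ξ
      map_smul' := fun r F => by
        ext u
        change - -dirDeriv _ ξ = r * (- -dirDeriv _ ξ)
        simp only [neg_neg]
        refine (dirDeriv_mul (f := fun _ : G => r) contMDiff_const
          (contMDiff_translate F X u _) ξ).trans ?_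
        rw [dirDeriv_const, zero_mul, add_zero] }
    fun F F' => by
      ext u
      change - -dirDeriv _ ξ = F u * (- -dirDeriv _ ξ) + F' u * (- -dirDeriv _ ξ)
      simp only [neg_neg]
      refine (dirDeriv_mul (contMDiff_translate F X u _) (contMDiff_translate F' X u _) ξ).trans ?_
      rw [one_mul, Function.update_eq_self, mul_comm (F' u)]

theorem transl_apply (X : Curve n g) (ξ : GroupLieAlgebra 𝓘(ℝ, E) G) (F : Coeff E n g G)
    (u : Curve n g → G) :
    transl X ξ F u = dirDeriv (fun x : G => F (update u X (x * u X))) ξ := by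
  change - -dirDeriv _ ξ = _
  rw [neg_neg]

theorem JL_eq_neg_transl (X : Curve n g) (ξ : GroupLieAlgebra 𝓘(ℝ, E) G) (F : Coeff E n g G) :
    JL X ξ F = -transl X ξ F := (neg_neg _).symm

/-- Moving a factor across `u_X` conjugates it: `u e^{tξ} = e^{t Ad(u)ξ} u`. -/
theorem JR_apply_eq_transl (X : Curve n g) (ξ : GroupLieAlgebra 𝓘(ℝ, E) G) (F : Coeff E n g G)
    (u : Curve n g → G) : JR X ξ F u = transl X (Ad (u X) ξ) F u := by
  rw [transl_apply, ← dirDeriv_mul_right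
    (f := fun z => F (update u X z)) (by simpa using contMDiff_translate F X u 1)]
  rfl

theorem transl_comm_of_ne {X Y : Curve n g} (hXY : X ≠ Y) (ξ η : GroupLieAlgebra 𝓘(ℝ, E) G)
    (F : Coeff E n g G) : transl X ξ (transl Y η F) = transl Y η (transl X ξ F) := by
  have := contMDiffMul (E := E) (G := G)
  ext u
  rw [transl_apply, transl_apply]
  simp only [transl_apply, Function.update_of_ne hXY.symm, Function.update_of_ne hXY]
  rw [dirDeriv_comm]
  · simp only [Function.update_comm hXY]
  · exact F.contMDiff.comp (contMDiff_update_of (contMDiff_update_of contMDiff_const X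
      (contMDiff_fst.mul contMDiff_const)) Y (contMDiff_snd.mul contMDiff_const))

/-- Successive left translations multiply in reversed order, so the commutator formula of
left-invariant fields reappears with the opposite sign. -/
theorem transl_comm_self [FiniteDimensional ℝ E] (X : Curve n g)
    (ξ η : GroupLieAlgebra 𝓘(ℝ, E) G) (F : Coeff E n g G) :
    transl X ξ (transl X η F) - transl X η (transl X ξ F) = -transl X ⁅ξ, η⁆ F := by
  have := FiniteDimensional.complete ℝ E
  ext u
  change transl X ξ (transl X η F) u - transl X η (transl X ξ F) u = -transl X ⁅ξ, η⁆ F u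
  have hf := contMDiff_translate F X u (u X)
  have e (ξ η : GroupLieAlgebra 𝓘(ℝ, E) G) : transl X ξ (transl X η F) u =
      dirDeriv (fun x : G => dirDeriv (fun y : G => F (update u X (x * y * u X))) ξ) η := by
    rw [transl_apply]
    simp only [transl_apply, Function.update_idem, Function.update_self, ← mul_assoc]
    exact dirDeriv_comm (contMDiff_uncurry_swap (contMDiff_uncurry_mul hf)) ξ η
  rw [e, e, transl_apply X ⁅ξ, η⁆, dirDeriv_lie hf]
  ring

end Translations

/-! ### The smooth functions on `G^{n+2g}` form a flower calculus. -/

section ConcreteCalculus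

variable {E : Type*} [NormedAddCommGroup E] [NormedSpace ℝ E] {n g : ℕ}
  {G : Type*} [TopologicalSpace G] [ChartedSpace E G] [Group G] [LieGroup 𝓘(ℝ, E) ∞ G]
  {ι : Type*} [Fintype ι] (b : Module.Basis ι ℝ (GroupLieAlgebra 𝓘(ℝ, E) G))

theorem Ad_basis (h : G) (a : ι) : Ad h (b a) = ∑ c, adCoeff b a c h • b c :=
  (b.sum_repr _).symm

/-- The value at `u` of a vector of functions, as an element of the Lie algebra. -/
def vecAt (u : Curve n g → G) (x : ι → Coeff E n g G) : GroupLieAlgebra 𝓘(ℝ, E) G :=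
  ∑ a, x a u • b a

theorem repr_vecAt (u : Curve n g → G) (x : ι → Coeff E n g G) (a : ι) :
    b.repr (vecAt b u x) a = x a u := by
  rw [vecAt, b.repr_sum_self]

/-- Reduces identities between vectors of functions to identities in the Lie algebra at each point
`u`, free of indices. -/
theorem vecAt_ext {x y : ι → Coeff E n g G} (h : ∀ u, vecAt b u x = vecAt b u y) : x = y := by
  funext a
  ext u
  rw [← repr_vecAt b, h, repr_vecAt]

/-- `Ad h` as a linear map. -/
def AdLin (h : G) : GroupLieAlgebra 𝓘(ℝ, E) G →ₗ[ℝ] GroupLieAlgebra 𝓘(ℝ, E) G where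
  toFun := Ad h
  map_add' ξ η := map_add (mfderiv 𝓘(ℝ, E) 𝓘(ℝ, E) (fun x : G => h * x * h⁻¹) (1 : G)) ξ η
  map_smul' r ξ := map_smul (mfderiv 𝓘(ℝ, E) 𝓘(ℝ, E) (fun x : G => h * x * h⁻¹) (1 : G)) r ξ

theorem Ad_sum_smul (h : G) (r : ι → ℝ) (ξ : ι → GroupLieAlgebra 𝓘(ℝ, E) G) :
    Ad h (∑ a, r a • ξ a) = ∑ a, r a • Ad h (ξ a) := by
  refine (map_sum (AdLin h) _ _).trans (Finset.sum_congr rfl fun a _ => ?_)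
  exact map_smul (AdLin h) _ _

/-- The action of `Ad^*(w(u))` on vectors. -/
def adVec (w : FreeGroup (Curve n g)) : Module.End (Coeff E n g G) (ι → Coeff E n g G) where
  toFun x c := ∑ a, x a * adW b w a c
  map_add' x y := by
    funext c
    simp [add_mul, Finset.sum_add_distrib]
  map_smul' r x := by
    funext c
    simp [mul_assoc, Finset.mul_sum]

theorem coeff_sum_apply {κ : Type*} (s : Finset κ) (F : κ → Coeff E n g G) (u : Curve n g → G) :
    (∑ k ∈ s, F k) u = ∑ k ∈ s, F k u :=
  map_sum (ContMDiffMap.evalRingHom u) F s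

theorem vecAt_adVec (w : FreeGroup (Curve n g)) (u : Curve n g → G) (x : ι → Coeff E n g G) :
    vecAt b u (adVec b w x) = Ad (FreeGroup.lift u w) (vecAt b u x) := by
  rw [vecAt, vecAt, Ad_sum_smul]
  have h1 (c : ι) : adVec b w x c u = ∑ a, x a u * adCoeff b a c (FreeGroup.lift u w) :=
    coeff_sum_apply _ _ _
  simp only [h1, Ad_basis b, Finset.smul_sum, Finset.sum_smul, mul_smul]
  exact Finset.sum_comm

variable [FiniteDimensional ℝ E]

theorem vecAt_lieVec (u : Curve n g → G) (x y : ι → Coeff E n g G) :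
    vecAt b u (lieVec (strConst b) x y) = ⁅vecAt b u x, vecAt b u y⁆ := by
  have := FiniteDimensional.complete ℝ E
  have : LieGroup 𝓘(ℝ, E) (minSmoothness ℝ 3) G := LieGroup.of_le (n := ∞) (by
    rw [minSmoothness_of_isRCLikeNormedField]; exact WithTop.coe_le_coe.2 (le_top : (3 : ℕ∞) ≤ ⊤))
  have h1 (e : ι) : lieVec (strConst b) x y e u =
      ∑ a, ∑ c, strConst b a c e * (x a u * y c u) := by
    rw [lieVec_apply, coeff_sum_apply]
    exact Finset.sum_congr rfl fun a _ => coeff_sum_apply _ _ _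
  have h2 (a c : ι) : ⁅b a, b c⁆ = ∑ e, strConst b a c e • b e := (b.sum_repr _).symm
  simp only [vecAt, sum_lie, lie_sum, smul_lie, lie_smul, h1, h2]
  simp only [Finset.smul_sum, Finset.sum_smul, smul_smul]
  conv_rhs => rw [Finset.sum_comm]
  rw [Finset.sum_comm]
  refine Finset.sum_congr rfl fun a _ => ?_
  rw [Finset.sum_comm]
  refine Finset.sum_congr rfl fun c _ => Finset.sum_congr rfl fun e _ => ?_
  congr 1
  ring

variable [T2Space G]

/-- This is `dirDeriv_Ad` read in the basis; it supplies the axiom `der_ad`. -/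
theorem sum_dirDeriv_adCoeff (u : G) (a : ι) (ξ : GroupLieAlgebra 𝓘(ℝ, E) G) :
    ∑ c, dirDeriv (fun x => adCoeff b a c (x * u)) ξ • b c = ⁅ξ, Ad u (b a)⁆ := by
  refine dirDeriv_ext fun f hf => ?_
  rw [dirDeriv_vec_sum, ← dirDeriv_Ad hf]
  have h (x : G) : dirDeriv f (Ad (x * u) (b a)) =
      ∑ c, adCoeff b a c (x * u) * dirDeriv f (b c) := by
    rw [Ad_basis b, dirDeriv_vec_sum]
  have hs (c : ι) := contMDiff_comp_mul_right (adCoeff b a c).contMDiff u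
  simp only [h]
  rw [dirDeriv_sum _ (f := fun c x => adCoeff b a c (x * u) * dirDeriv f (b c))
    fun c => (hs c).mul contMDiff_const]
  refine Finset.sum_congr rfl fun c _ => ?_
  rw [dirDeriv_mul (hs c) contMDiff_const, dirDeriv_const, mul_zero, zero_add]

variable [DecidableEq ι]

theorem adVec_single (w : FreeGroup (Curve n g)) (a : ι) :
    adVec b w (Pi.single a 1) = adW b w a := by
  funext c
  change ∑ e, (Pi.single a 1 : ι → Coeff E n g G) e * adW b w e c = _
  rw [Finset.sum_eq_single a]
  · rw [Pi.single_eq_same, one_mul]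
  · intro e _ he
    rw [Pi.single_eq_of_ne he, zero_mul]
  · simp

theorem vecAt_single (u : Curve n g → G) (a : ι) : vecAt b u (Pi.single a 1) = b a := by
  rw [vecAt, Finset.sum_eq_single a]
  · rw [Pi.single_eq_same]
    exact one_smul _ _
  · intro e _ he
    rw [Pi.single_eq_of_ne he]
    exact zero_smul _ _
  · simp

variable (n g) in
/-- The calculus on `C^∞(G^{n+2g})`. -/
def calculus : FlowerCalculus (Coeff E n g G) n g ι where
  str := strConst b
  str_swap a c e := by
    have := FiniteDimensional.complete ℝ E
    have : LieGroup 𝓘(ℝ, E) (minSmoothness ℝ 3) G := LieGroup.of_le (n := ∞) (by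
      rw [minSmoothness_of_isRCLikeNormedField]
      exact WithTop.coe_le_coe.2 (le_top : (3 : ℕ∞) ≤ ⊤))
    rw [strConst, ← lie_skew, map_neg]
    rfl
  ad :=
    { toFun := adVec b
      map_one' := by
        refine LinearMap.ext fun x => vecAt_ext b fun u => ?_
        rw [vecAt_adVec, map_one, Ad_one]
        rfl
      map_mul' := fun v w => by
        refine LinearMap.ext fun x => vecAt_ext b fun u => ?_
        rw [Module.End.mul_apply, vecAt_adVec, vecAt_adVec, vecAt_adVec, map_mul, Ad_mul] }
  der X a := transl X (b a)
  ad_lie w x y := by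
    refine vecAt_ext b fun u => ?_
    refine (vecAt_adVec b w u _).trans ?_
    rw [vecAt_lieVec, vecAt_lieVec, Ad_lie]
    exact congrArg₂ _ (vecAt_adVec b w u x).symm (vecAt_adVec b w u y).symm
  der_comm X a Y c F := by
    split_ifs with h
    · subst h
      rw [transl_comm_self]
      ext u
      change -transl X ⁅b a, b c⁆ F u = -(∑ e, strConst b a c e • transl X (b e) F) u
      rw [coeff_sum_apply, transl_apply]
      have h2 : ⁅b a, b c⁆ = ∑ e, strConst b a c e • b e := (b.sum_repr _).symm
      rw [h2, dirDeriv_vec_sum]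
      refine congrArg _ (Finset.sum_congr rfl fun e _ => ?_)
      rw [← transl_apply]
      rfl
    · rw [transl_comm_of_ne h, sub_self]
  der_ad Y d X a := by
    change vecDer _ (adVec b _ _) = ite _ (lieVec _ _ (adVec b _ _)) 0
    refine vecAt_ext b fun u => ?_
    have h (c : ι) : vecDer (transl Y (b d)) (adVec b (FreeGroup.of X) (Pi.single a 1)) c u =
        dirDeriv (fun x => adCoeff b a c (Function.update u Y (x * u Y) X)) (b d) := by
      rw [adVec_single, vecDer_apply, transl_apply]
      refine congrArg (fun F => dirDeriv F (b d)) (funext fun x => ?_)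
      exact congrArg (adCoeff b a c) FreeGroup.lift_apply_of
    rw [vecAt]
    simp only [h]
    split_ifs with hXY
    · subst hXY
      rw [vecAt_lieVec, vecAt_adVec, vecAt_single, vecAt_single, FreeGroup.lift_apply_of]
      simp only [Function.update_self]
      exact sum_dirDeriv_adCoeff b (u X) a (b d)
    · simp only [Function.update_of_ne hXY, dirDeriv_const, zero_smul]
      exact Finset.sum_congr rfl fun c _ => (zero_smul ℝ (b c)).symm

end ConcreteCalculus

/-! ### Coordinate expressions for fields and brackets. -/

theorem sum_smul_single {A ι N : Type*} [CommRing A] [Fintype ι] [DecidableEq ι] [AddCommGroup N]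
    [Module A N] (L : (ι → A) →ₗ[A] N) (x : ι → A) : ∑ c, x c • L (Pi.single c 1) = L x := by
  conv_rhs => rw [eq_sum_single x, map_sum]
  simp only [map_smul]

namespace FlowerCalculus

variable {A : Type*} [CommRing A] [Algebra ℝ A] {n g : ℕ} {ι : Type*}
    [Fintype ι] [DecidableEq ι] (𝓒 : FlowerCalculus A n g ι)

/-- The derivative of `F` along the translation of `u_Y` from the left, as a linear form. -/
def leftForm (Y : Curve n g) (F : A) : (ι → A) →ₗ[A] A :=
  ∑ a, (LinearMap.proj a).smulRight (𝓒.der Y a F)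

theorem leftForm_apply (Y : Curve n g) (F : A) (x : ι → A) :
    𝓒.leftForm Y F x = ∑ a, x a * 𝓒.der Y a F := by
  simp [leftForm, LinearMap.sum_apply]

theorem leftForm_single (Y : Curve n g) (F : A) (a : ι) :
    𝓒.leftForm Y F (Pi.single a 1) = 𝓒.der Y a F := by
  rw [leftForm_apply, Finset.sum_eq_single a]
  · simp
  · intro c _ hc; simp [hc]
  · simp

theorem field_eq_sum_leftForm (s : Curve n g → ι → A) (F : A) :
    𝓒.field s F = ∑ Y, 𝓒.leftForm Y F (s Y) := by
  simp only [field_apply, leftForm_apply]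

theorem anchorField_eq_add (X : Curve n g) (x : ι → A) (F : A) :
    𝓒.anchorField X x F = (∑ Y, 𝓒.leftForm Y F (𝓒.ownAnchor X Y x)) +
      ∑ Y with X.rank < Y.rank, 𝓒.leftForm Y F ((1 - 𝓒.adL Y) ((1 - 𝓒.adL X) x)) := by
  refine (𝓒.field_eq_sum_leftForm _ F).trans ?_
  rw [Finset.sum_filter, ← Finset.sum_add_distrib]
  refine Finset.sum_congr rfl fun Y _ => ?_
  change 𝓒.leftForm Y F (𝓒.anchor X Y x) = _
  split_ifs with h
  · rw [𝓒.anchor_of_lt h, 𝓒.ownAnchor_of_rank_ne h.ne, LinearMap.zero_apply, map_zero, zero_add]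
    rfl
  · rw [𝓒.anchor_of_le (not_lt.1 h), add_zero]

theorem lin_lie_single (Y : Curve n g) (x : ι → A) (c : ι) :
    lin Y (𝓒.lie x (Pi.single c 1)) =
      ∑ d, ∑ e, 𝓒.str d c e • (MvPolynomial.X (Y, e) * MvPolynomial.C (x d)) := by
  have h (e : ι) : 𝓒.lie x (Pi.single c 1) e = ∑ d, 𝓒.str d c e • x d := by
    rw [lieVec_apply]
    refine Finset.sum_congr rfl fun d _ => ?_
    rw [Finset.sum_eq_single c]
    · simp
    · intro d _ hd; simp [hd]
    · simp
  have hC (r : ℝ) (F : A) : (MvPolynomial.C (r • F) : MvPolynomial (Curve n g × ι) A) =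
      r • MvPolynomial.C F := by
    rw [Algebra.smul_def, map_mul, Algebra.smul_def]
    rfl
  rw [lin_apply, Finset.sum_comm]
  refine Finset.sum_congr rfl fun e _ => ?_
  rw [h, map_sum, Finset.sum_mul]
  refine Finset.sum_congr rfl fun d _ => ?_
  rw [hC, smul_mul_assoc, mul_comm]

theorem lin_lie_single_single (Y : Curve n g) (a c : ι) :
    lin Y (𝓒.lie (Pi.single a 1) (Pi.single c 1)) =
      ∑ e, 𝓒.str a c e • (MvPolynomial.X (Y, e) : MvPolynomial (Curve n g × ι) A) := by
  rw [lin_lie_single, Finset.sum_eq_single a]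
  · simp
  · intro d _ hd; simp [hd]
  · simp

end FlowerCalculus

/-! ### The bracket of the flower algebra is the abstract one. -/

section Comparison

variable {E : Type*} [NormedAddCommGroup E] [NormedSpace ℝ E] {n g : ℕ}
  {G : Type*} [TopologicalSpace G] [ChartedSpace E G] [Group G] [LieGroup 𝓘(ℝ, E) ∞ G]
  {ι : Type*} [Fintype ι] [DecidableEq ι] [FiniteDimensional ℝ E] [T2Space G]
  (b : Module.Basis ι ℝ (GroupLieAlgebra 𝓘(ℝ, E) G))

theorem ad_single (w : FreeGroup (Curve n g)) (a : ι) :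
    (calculus n g b).ad w (Pi.single a 1) = adW b w a := adVec_single b w a

theorem one_sub_ad_single (w : FreeGroup (Curve n g)) (a : ι) :
    (1 - (calculus n g b).ad w) (Pi.single a 1) = oneSubAdW b w a := by
  rw [LinearMap.sub_apply, ad_single, Module.End.one_apply]
  funext c
  rw [Pi.sub_apply, oneSubAdW, Pi.single_apply]
  simp only [eq_comm]

theorem JL_eq_leftForm (Y : Curve n g) (c : ι) (F : Coeff E n g G) :
    JL Y (b c) F = -(calculus n g b).leftForm Y F (Pi.single c 1) := by
  rw [FlowerCalculus.leftForm_single]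
  exact JL_eq_neg_transl _ _ _

theorem JR_eq_leftForm (Y : Curve n g) (c : ι) (F : Coeff E n g G) :
    JR Y (b c) F = (calculus n g b).leftForm Y F ((calculus n g b).adL Y (Pi.single c 1)) := by
  rw [FlowerCalculus.adL, ad_single, FlowerCalculus.leftForm_apply]
  ext u
  rw [JR_apply_eq_transl, Ad_basis b, transl_apply, dirDeriv_vec_sum, coeff_sum_apply]
  refine Finset.sum_congr rfl fun e _ => ?_
  rw [← transl_apply]
  refine congrArg (· * _) (congrArg (adCoeff b c e) ?_)
  exact (FreeGroup.lift_apply_of (f := u)).symm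

theorem JR_add_JL_eq_leftForm (Y : Curve n g) (c : ι) (F : Coeff E n g G) :
    JR Y (b c) F + JL Y (b c) F =
      -(calculus n g b).leftForm Y F ((1 - (calculus n g b).adL Y) (Pi.single c 1)) := by
  rw [JR_eq_leftForm, JL_eq_leftForm, LinearMap.sub_apply, map_sub, Module.End.one_apply]
  abel

/-- With `J^R` rewritten as a left translation, `J^R_ξ + J^L_ξ` on the copy `Y` is minus the
translation by `(1 - Ad u_Y)ξ`, and the defining formulas become the anchors term by term. -/
theorem jField_eq_anchorField (X : Curve n g) (a : ι) (F : Coeff E n g G) :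
    jField b X a F = (calculus n g b).anchorField X (Pi.single a 1) F := by
  have later : ∑ c, oneSubAdW b X.word a c *
      ∑ Y : Curve n g with X.rank < Y.rank, (JR Y (b c) F + JL Y (b c) F) =
      -∑ Y with X.rank < Y.rank, (calculus n g b).leftForm Y F
        ((1 - (calculus n g b).adL Y) ((1 - (calculus n g b).adL X) (Pi.single a 1))) := by
    simp only [JR_add_JL_eq_leftForm, Finset.mul_sum, Finset.sum_neg_distrib, mul_neg]
    rw [Finset.sum_comm]
    refine congrArg _ (Finset.sum_congr rfl fun Y _ => ?_)
    rw [FlowerCalculus.adL, FlowerCalculus.adL, one_sub_ad_single]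
    exact sum_smul_single ((calculus n g b).leftForm Y F ∘ₗ (1 - (calculus n g b).adL Y)) _
  rw [FlowerCalculus.anchorField_eq_add, Curve.sum_eq]
  -- The factor `Ad(u_B)` from `J^{R_B}` cancels the `u_B⁻¹` in `Ad^*(u_B⁻¹ u_A)`, leaving
  -- translation of `u_B` by `Ad(u_A)x`.
  have hR (k : Fin g) : ∑ c, adW b ((Curve.word (.B k))⁻¹ * Curve.word (.A k)) a c *
      JR (.B k) (b c) F = (calculus n g b).leftForm (.B k) F
        ((calculus n g b).adL (.A k) (Pi.single a 1)) := by
    simp only [JR_eq_leftForm, ← ad_single b]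
    refine (sum_smul_single ((calculus n g b).leftForm (.B k) F ∘ₗ (calculus n g b).adL (.B k))
      _).trans ?_
    rw [LinearMap.comp_apply, FlowerCalculus.ad_mul_apply, FlowerCalculus.adL,
      FlowerCalculus.ad_mul_inv]
  have key {m : ℕ} (f : Fin m → Curve n g) (i : Fin m)
      (T : Module.End (Coeff E n g G) (ι → Coeff E n g G)) (x : ι → Coeff E n g G) :
      ∑ j, (calculus n g b).leftForm (f j) F ((if i = j then T else 0) x) =
        (calculus n g b).leftForm (f i) F (T x) := by
    rw [Finset.sum_eq_single i]
    · rw [if_pos rfl]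
    · intro j _ hj
      rw [if_neg hj.symm, LinearMap.zero_apply, map_zero]
    · simp
  have rest : jField b X a F = (∑ i, (calculus n g b).leftForm (.M i) F
      ((calculus n g b).ownAnchor X (.M i) (Pi.single a 1))) +
      ((∑ k, (calculus n g b).leftForm (.A k) F
        ((calculus n g b).ownAnchor X (.A k) (Pi.single a 1))) +
      ∑ k, (calculus n g b).leftForm (.B k) F
        ((calculus n g b).ownAnchor X (.B k) (Pi.single a 1))) -
      ∑ c, oneSubAdW b X.word a c *
        ∑ Y : Curve n g with X.rank < Y.rank, (JR Y (b c) F + JL Y (b c) F) := by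
    cases X with
    | M i =>
      simp only [jField, FlowerCalculus.ownAnchor, key Curve.M,
        LinearMap.zero_apply, map_zero, Finset.sum_const_zero]
      rw [JR_add_JL_eq_leftForm b (.M i) a, neg_neg, add_zero, add_zero]
    | A k =>
      simp only [jField, hR, FlowerCalculus.ownAnchor, key Curve.A,
        key Curve.B, LinearMap.zero_apply, map_zero, Finset.sum_const_zero]
      rw [JR_add_JL_eq_leftForm b (.A k) a, JR_add_JL_eq_leftForm b (.B k) a,
        sub_right_comm (1 : Module.End _ _), LinearMap.sub_apply (1 - _), map_sub]
      abel
    | B k =>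
      simp only [jField, FlowerCalculus.ownAnchor, key Curve.A, key Curve.B,
        LinearMap.zero_apply, map_zero, Finset.sum_const_zero, Module.End.one_apply]
      rw [JR_add_JL_eq_leftForm b (.B k) a, JL_eq_leftForm b (.A k) a]
      abel
  rw [rest, later, sub_neg_eq_add]

theorem genBracket_eq_linBracket (X : Curve n g) (a : ι) (Y : Curve n g) (c : ι) :
    genBracket b X a Y c =
      (calculus n g b).linBracket X Y (Pi.single a 1) (Pi.single c 1) := by
  have mixed (X : Curve n g) (a : ι) (Y : Curve n g) (c : ι) :
      ∑ d, ∑ e, strConst b d c e • (gen E G Y e * fn ι (oneSubAdW b X.word a d)) =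
      FlowerCalculus.lin Y ((calculus n g b).lie ((1 - (calculus n g b).adL X) (Pi.single a 1))
        (Pi.single c 1)) := by
    rw [FlowerCalculus.lin_lie_single, FlowerCalculus.adL, one_sub_ad_single]
    rfl
  simp only [genBracket, mixed]
  split_ifs with h1 h2
  · rw [FlowerCalculus.linBracket_of_lt _ h1]
  · rw [FlowerCalculus.linBracket_of_gt _ h2, neg_neg]
  · rw [FlowerCalculus.linBracket_of_eq _ (le_antisymm (not_lt.1 h2) (not_lt.1 h1)),
      FlowerCalculus.lin_lie_single_single]
    cases X <;> rfl

theorem bracket_eq_bra (φ ψ : Flower E n g G ι) :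
    bracket b φ ψ = (calculus n g b).bra φ ψ := by
  have h (X : Curve n g) (a : ι) (φ : Flower E n g G ι) : mapCoeff (jField b X a) φ =
      coeffDer ((calculus n g b).anchorField X (Pi.single a 1)) φ :=
    congrArg (fun V => mapCoeff V φ) (funext (jField_eq_anchorField b X a))
  simp only [bracket, FlowerCalculus.bra, polyBracket, genBracket_eq_linBracket, h]

end Comparison

/-! ### The action of the semidirect product. -/

section Conjugation

variable {E : Type*} [NormedAddCommGroup E] [NormedSpace ℝ E] {n g : ℕ}
  {G : Type*} [TopologicalSpace G] [ChartedSpace E G] [Group G] [LieGroup 𝓘(ℝ, E) ∞ G]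
  {ι : Type*} [Fintype ι] (b : Module.Basis ι ℝ (GroupLieAlgebra 𝓘(ℝ, E) G))

theorem lift_conjAll (h : G) (u : Curve n g → G) (w : FreeGroup (Curve n g)) :
    FreeGroup.lift (conjAll (E := E) h u) w = h * FreeGroup.lift u w * h⁻¹ := by
  have : FreeGroup.lift (conjAll (E := E) h u) =
      (MulAut.conj h).toMonoidHom.comp (FreeGroup.lift u) := by
    ext X
    rw [MonoidHom.comp_apply, FreeGroup.lift_apply_of, FreeGroup.lift_apply_of]
    rfl
  rw [this]
  rfl

/-- The pullback of functions along the global conjugation by `h⁻¹`. -/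
def conjPull (h : G) : Coeff E n g G →ₐ[ℝ] Coeff E n g G where
  toFun F := F.comp (conjAll h⁻¹)
  map_one' := rfl
  map_mul' _ _ := rfl
  map_zero' := rfl
  map_add' _ _ := rfl
  commutes' _ := rfl

/-- Evaluation of a word is a homomorphism and hence commutes with simultaneous conjugation of all
letters. -/
theorem conjPull_comp_PhiInf (h : G) (f : SmoothFn E G) :
    conjPull h (f.comp (PhiInf E n g G)) = (f.comp (conj h⁻¹)).comp (PhiInf E n g G) := by
  ext u
  exact congrArg f (lift_conjAll h⁻¹ u _)

theorem conjPull_one (F : Coeff E n g G) : conjPull 1 F = F := by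
  ext u
  exact congrArg F (funext fun X => (by simp : (1 : G)⁻¹ * u X * (1 : G)⁻¹⁻¹ = u X))

theorem conjPull_mul (h k : G) (F : Coeff E n g G) :
    conjPull (h * k) F = conjPull h (conjPull k F) := by
  ext u
  exact congrArg F (funext fun X => (by group :
    (h * k)⁻¹ * u X * (h * k)⁻¹⁻¹ = k⁻¹ * (h⁻¹ * u X * h⁻¹⁻¹) * k⁻¹⁻¹))

/-- The action of `h` on vectors of functions. -/
def conjVec (h : G) : (ι → Coeff E n g G) →+ (ι → Coeff E n g G) where
  toFun x c := ∑ a, adCoeff b a c h • conjPull h (x a)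
  map_zero' := by
    funext c
    simp
  map_add' x y := by
    funext c
    simp [Finset.sum_add_distrib]

theorem conjVec_apply (h : G) (x : ι → Coeff E n g G) (c : ι) :
    conjVec b h x c = ∑ a, adCoeff b a c h • conjPull h (x a) := rfl

theorem vecAt_conjVec (h : G) (u : Curve n g → G) (x : ι → Coeff E n g G) :
    vecAt b u (conjVec b h x) = Ad h (vecAt b (conjAll (E := E) h⁻¹ u) x) := by
  rw [vecAt, vecAt, Ad_sum_smul]
  have h1 (c : ι) : conjVec b h x c u =
      ∑ a, x a (conjAll (E := E) h⁻¹ u) * adCoeff b a c h := by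
    rw [conjVec_apply, coeff_sum_apply]
    exact Finset.sum_congr rfl fun a _ => mul_comm _ _
  simp only [h1, Ad_basis b, Finset.smul_sum, Finset.sum_smul, mul_smul]
  exact Finset.sum_comm

variable [DecidableEq ι]

theorem conjVec_single (h : G) (a c : ι) :
    conjVec b h (Pi.single a 1) c = adCoeff b a c h • (1 : Coeff E n g G) := by
  rw [conjVec_apply, Finset.sum_eq_single a]
  · rw [Pi.single_eq_same, map_one]
  · intro e _ he
    rw [Pi.single_eq_of_ne he, map_zero, smul_zero]
  · simp

variable [FiniteDimensional ℝ E] [T2Space G]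

theorem conjVec_one (x : ι → Coeff E n g G) : conjVec b 1 x = x := by
  refine vecAt_ext b fun u => ?_
  rw [vecAt_conjVec, Ad_one]
  exact congrArg (fun v => vecAt b v x)
    (funext fun X => (by simp : (1 : G)⁻¹ * u X * (1 : G)⁻¹⁻¹ = u X))

theorem conjVec_mul (h k : G) (x : ι → Coeff E n g G) :
    conjVec b (h * k) x = conjVec b h (conjVec b k x) := by
  refine vecAt_ext b fun u => ?_
  rw [vecAt_conjVec, vecAt_conjVec, vecAt_conjVec, Ad_mul]
  exact congrArg (fun v => Ad h (Ad k (vecAt b v x))) (funext fun X => (by group :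
    (h * k)⁻¹ * u X * (h * k)⁻¹⁻¹ = k⁻¹ * (h⁻¹ * u X * h⁻¹⁻¹) * k⁻¹⁻¹))

/-- At a point `u`, the action on vectors is `Ad(h)` applied to the value at `h⁻¹uh`. Each axiom
then follows from `Ad_mul`, `Ad_lie`, equivariance of words, or the substitution `x ↦ hxh⁻¹` in a
derivative. -/
theorem symm_conj (h : G) : (calculus n g b).Symm
    (conjPull (E := E) (n := n) (g := g) h).toRingHom (conjVec b h) where
  map_smul r x := by
    funext c
    change ∑ a, adCoeff b a c h • conjPull h (r * x a) =
      conjPull h r * ∑ a, adCoeff b a c h • conjPull h (x a)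
    simp only [map_mul, Finset.mul_sum, mul_smul_comm]
  map_ad w x := by
    refine vecAt_ext b fun u => ?_
    refine (vecAt_conjVec b h u _).trans ?_
    refine Eq.trans ?_ (vecAt_adVec b w u _).symm
    refine (congrArg (Ad h) (vecAt_adVec b w _ x)).trans ?_
    rw [vecAt_conjVec, ← Ad_mul, ← Ad_mul, lift_conjAll]
    simp [mul_assoc]
  map_lie x y := by
    refine vecAt_ext b fun u => ?_
    refine (vecAt_conjVec b h u _).trans ?_
    refine Eq.trans ?_ (vecAt_lieVec b u _ _).symm
    refine (congrArg (Ad h) (vecAt_lieVec b _ x y)).trans ?_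
    rw [Ad_lie, vecAt_conjVec, vecAt_conjVec]
  map_der Y a F := by
    ext u
    have h1 (c : ι) : (calculus n g b).der Y c ((conjPull h).toRingHom F) u =
        dirDeriv (fun x : G => F (conjAll (E := E) h⁻¹ (Function.update u Y (x * u Y)))) (b c) :=
      transl_apply _ _ _ _
    have h2 : (conjPull (E := E) h).toRingHom ((calculus n g b).der Y a F) u =
        dirDeriv (fun x : G => F (Function.update (conjAll (E := E) h⁻¹ u) Y
          (x * conjAll (E := E) h⁻¹ u Y))) (b a) := transl_apply _ _ _ _
    have h3 (c : ι) : conjVec b h (Pi.single a 1) c u = adCoeff b a c h := by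
      rw [conjVec_single]
      exact mul_one _
    rw [h2, coeff_sum_apply]
    change _ = ∑ c, conjVec b h (Pi.single a 1) c u *
      (calculus n g b).der Y c ((conjPull h).toRingHom F) u
    simp only [h1, h3]
    have hs : ContMDiff 𝓘(ℝ, E) 𝓘(ℝ, ℝ) ∞ fun x : G =>
        F (conjAll (E := E) h⁻¹ (Function.update u Y (x * u Y))) :=
      contMDiff_translate (conjPull h F) Y u (u Y)
    rw [← dirDeriv_vec_sum, ← Ad_basis b, ← dirDeriv_conj hs]
    refine congrArg (fun k => dirDeriv k (b a)) (funext fun x => congrArg F (funext fun Z => ?_))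
    change _ = h⁻¹ * Function.update u Y (h * x * h⁻¹ * u Y) Z * h⁻¹⁻¹
    by_cases hZ : Z = Y
    · subst hZ
      rw [Function.update_self, Function.update_self]
      change x * (h⁻¹ * u Z * h⁻¹⁻¹) = _
      group
    · rw [Function.update_of_ne hZ, Function.update_of_ne hZ]
      rfl
  const a δ := by
    funext c
    rw [vecDer_apply, conjVec_single, Derivation.map_smul, Derivation.map_one_eq_zero, smul_zero]
    rfl

open MvPolynomial FlowerCalculus in
/-- The action of `h` on the flower algebra. -/
def conjHom (h : G) : Flower E n g G ι →ₐ[ℝ] Flower E n g G ι where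
  toRingHom := eval₂Hom (C.comp (conjPull h).toRingHom)
    fun p => lin p.1 (conjVec b h (Pi.single p.2 1))
  commutes' r := by
    refine (eval₂_C _ _ _).trans ?_
    exact congrArg C ((conjPull h).commutes r)

theorem conjHom_C (h : G) (F : Coeff E n g G) :
    conjHom b h (MvPolynomial.C F) = MvPolynomial.C (conjPull h F) :=
  MvPolynomial.eval₂_C _ _ _

theorem conjHom_X (h : G) (X : Curve n g) (a : ι) :
    conjHom b h (MvPolynomial.X (X, a)) =
      FlowerCalculus.lin X (conjVec b h (Pi.single a 1)) :=
  MvPolynomial.eval₂_X _ _ _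

theorem conjHom_lin (h : G) (X : Curve n g) (x : ι → Coeff E n g G) :
    conjHom b h (FlowerCalculus.lin X x) = FlowerCalculus.lin X (conjVec b h x) :=
  (symm_conj b h).map_lin (conjHom b h).toRingHom (conjHom_C b h) (conjHom_X b h) X x

theorem conjHom_bra (h : G) (φ ψ : Flower E n g G ι) :
    conjHom b h ((calculus n g b).bra φ ψ) =
      (calculus n g b).bra (conjHom b h φ) (conjHom b h ψ) :=
  (symm_conj b h).map_bra (conjHom b h).toRingHom (conjHom_C b h) (conjHom_X b h) φ ψ

/-- The endomorphism of the flower algebra given by an element of `G ⋉ C^∞(G)`. -/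
def act (x : SymmGroup E G) : Flower E n g G ι →ₐ[ℝ] Flower E n g G ι :=
  (((calculus n g b).shift (x.left.toAdd.comp (PhiInf E n g G))).restrictScalars ℝ).comp
    (conjHom b x.right)

theorem act_apply (x : SymmGroup E G) (φ : Flower E n g G ι) : act b x φ =
    (calculus n g b).shift (x.left.toAdd.comp (PhiInf E n g G)) (conjHom b x.right φ) := rfl

theorem act_C (x : SymmGroup E G) (F : Coeff E n g G) :
    act b x (MvPolynomial.C F) = MvPolynomial.C (conjPull x.right F) := by
  rw [act_apply, conjHom_C, FlowerCalculus.shift_C]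

theorem act_lin (x : SymmGroup E G) (X : Curve n g) (v : ι → Coeff E n g G) :
    act b x (FlowerCalculus.lin X v) = FlowerCalculus.lin X (conjVec b x.right v) +
      MvPolynomial.C ((calculus n g b).anchorField X (conjVec b x.right v)
        (x.left.toAdd.comp (PhiInf E n g G))) := by
  rw [act_apply, conjHom_lin, FlowerCalculus.shift_lin]

theorem act_bra (x : SymmGroup E G) (φ ψ : Flower E n g G ι) :
    act b x ((calculus n g b).bra φ ψ) = (calculus n g b).bra (act b x φ) (act b x ψ) := by
  rw [act_apply, conjHom_bra, FlowerCalculus.shift_bra]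
  rfl

theorem act_ext {σ σ' : Flower E n g G ι →ₐ[ℝ] Flower E n g G ι}
    (hC : ∀ F, σ (MvPolynomial.C F) = σ' (MvPolynomial.C F))
    (hX : ∀ (X : Curve n g) (a : ι), σ (FlowerCalculus.lin X (Pi.single a 1)) =
      σ' (FlowerCalculus.lin X (Pi.single a 1))) : σ = σ' := by
  have : σ.toRingHom = σ'.toRingHom := by
    refine MvPolynomial.ringHom_ext hC fun p => ?_
    have := hX p.1 p.2
    rwa [FlowerCalculus.lin_single] at this
  exact AlgHom.ext fun φ => congrArg (fun s : Flower E n g G ι →+* Flower E n g G ι => s φ) this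

variable (n g) in
/-- The action of `G ⋉ C^∞(G)` on the flower algebra by endomorphisms. -/
def actHom : SymmGroup E G →* (Flower E n g G ι →ₐ[ℝ] Flower E n g G ι) where
  toFun := act b
  map_one' := by
    refine act_ext (fun F => ?_) fun X a => ?_
    · rw [act_C]
      exact congrArg MvPolynomial.C (conjPull_one F)
    · rw [act_lin]
      have h0 : (1 : SymmGroup E G).left.toAdd.comp (PhiInf E n g G) = 0 := rfl
      rw [h0, map_zero, map_zero, add_zero]
      exact congrArg _ (conjVec_one b _)
  map_mul' x y := by
    refine act_ext (fun F => ?_) fun X a => ?_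
    · rw [AlgHom.mul_apply, act_C, act_C, act_C]
      exact congrArg MvPolynomial.C (conjPull_mul _ _ F)
    · have h0 : (x * y).left.toAdd.comp (PhiInf E n g G) =
          x.left.toAdd.comp (PhiInf E n g G) +
            conjPull x.right (y.left.toAdd.comp (PhiInf E n g G)) := by
        rw [conjPull_comp_PhiInf]
        rfl
      have h1 := (symm_conj (n := n) (g := g) b x.right).map_anchorField X
        (conjVec b y.right (Pi.single a 1)) (y.left.toAdd.comp (PhiInf E n g G))
      rw [AlgHom.mul_apply, act_lin, act_lin, map_add, act_lin, act_C, h0, map_add, map_add]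
      have h2 : conjVec b (x * y).right (Pi.single a 1 : ι → Coeff E n g G) =
          conjVec b x.right (conjVec b y.right (Pi.single a 1)) := conjVec_mul b _ _ _
      rw [h2, add_assoc]
      exact congrArg (fun F => _ + (_ + MvPolynomial.C F)) h1.symm

variable (n g) in
/-- The action of `G ⋉ C^∞(G)` on the flower algebra. -/
def actAut : SymmGroup E G →* (Flower E n g G ι ≃ₐ[ℝ] Flower E n g G ι) :=
  -- A monoid homomorphism out of a group has values in the units, so the endomorphisms are
  -- automorphisms.
  (AlgEquiv.algHomUnitsEquiv ℝ (Flower E n g G ι)).toMonoidHom.comp (actHom n g b).toHomUnits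

theorem actAut_apply (x : SymmGroup E G) (φ : Flower E n g G ι) :
    actAut n g b x φ = act b x φ := rfl

theorem actAut_gen (h : G) (f : SmoothFn E G) (X : Curve n g) (a : ι) :
    actAut n g b (SymmGroup.mk h f) (gen E G X a) =
      (∑ c, adCoeff b a c h • gen E G X c) +
      (∑ c, adCoeff b a c h • bracket b (gen E G X c) (fn ι (f.comp (PhiInf E n g G)))) := by
  have hC (r : ℝ) (F : Coeff E n g G) : (MvPolynomial.C (r • F) : Flower E n g G ι) =
      r • MvPolynomial.C F := by
    rw [Algebra.smul_def, map_mul, Algebra.smul_def]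
    rfl
  rw [actAut_apply, gen, ← FlowerCalculus.lin_single, act_lin, FlowerCalculus.lin_apply,
    FlowerCalculus.anchorField_apply_eq_sum, map_sum]
  congr 1
  · refine Finset.sum_congr rfl fun c _ => ?_
    rw [conjVec_single, hC, map_one, smul_mul_assoc, one_mul]
    rfl
  · refine Finset.sum_congr rfl fun c _ => ?_
    rw [conjVec_single, smul_mul_assoc, one_mul, hC, bracket_gen_fn, jField_eq_anchorField]
    rfl

end Conjugation

/-! ### Index formulas for the total and decoupled generators. -/

section Decoupling
open FlowerCalculus

variable {E : Type*} [NormedAddCommGroup E] [NormedSpace ℝ E] {n g : ℕ}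
  {G : Type*} [TopologicalSpace G] [ChartedSpace E G] [Group G] [LieGroup 𝓘(ℝ, E) ∞ G]
  {ι : Type*} [Fintype ι] [DecidableEq ι]

/-- Absorbs a sum over an index into a linear map, so that nested index formulas become compositions
of operators. -/
theorem sum_fn_mul (L : (ι → Coeff E n g G) →ₗ[Coeff E n g G] Flower E n g G ι)
    (x : ι → Coeff E n g G) : ∑ c, fn ι (x c) * L (Pi.single c 1) = L x := by
  rw [← sum_smul_single L x]
  exact Finset.sum_congr rfl fun c _ => (MvPolynomial.smul_eq_C_mul _ _).symm

theorem gen_eq_lin (X : Curve n g) (a : ι) :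
    gen E G X a = lin X (Pi.single a (1 : Coeff E n g G)) := (lin_single X a).symm

variable [FiniteDimensional ℝ E] [T2Space G]
  (b : Module.Basis ι ℝ (GroupLieAlgebra 𝓘(ℝ, E) G))

theorem sum_fn_adW_mul (L : (ι → Coeff E n g G) →ₗ[Coeff E n g G] Flower E n g G ι)
    (w : FreeGroup (Curve n g)) (a : ι) : ∑ c, fn ι (adW b w a c) * L (Pi.single c 1) =
      L ((calculus n g b).ad w (Pi.single a 1)) := by
  rw [ad_single]
  exact sum_fn_mul L _

theorem sum_fn_oneSubAdW_mul (L : (ι → Coeff E n g G) →ₗ[Coeff E n g G] Flower E n g G ι)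
    (w : FreeGroup (Curve n g)) (a : ι) : ∑ c, fn ι (oneSubAdW b w a c) * L (Pi.single c 1) =
      L ((1 - (calculus n g b).ad w) (Pi.single a 1)) := by
  rw [one_sub_ad_single]
  exact sum_fn_mul L _

theorem sum_fn_sub_adW_mul (L : (ι → Coeff E n g G) →ₗ[Coeff E n g G] Flower E n g G ι)
    (v w : FreeGroup (Curve n g)) (a : ι) :
    ∑ c, fn ι (adW b v a c - adW b w a c) * L (Pi.single c 1) =
      L (((calculus n g b).ad v - (calculus n g b).ad w) (Pi.single a 1)) := by
  rw [LinearMap.sub_apply, ad_single, ad_single]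
  exact sum_fn_mul L _

theorem jH_eq_linH (k : Fin g) (a : ι) :
    jH b k a = (calculus n g b).linH k (Pi.single a 1) := by
  simp only [jH, gen_eq_lin, sum_fn_oneSubAdW_mul, sum_fn_sub_adW_mul]
  rfl

theorem jTot_eq_tot (a : ι) : jTot b n g a = (calculus n g b).tot (Pi.single a 1) := by
  simp only [jTot, jH_eq_linH, gen_eq_lin, mul_comm (lin _ _), sum_fn_adW_mul, tot_eq]

theorem handleTail_eq_linTail (k : Fin g) (a : ι) :
    handleTail b k a = (calculus n g b).linTail k (Pi.single a 1) := by
  simp only [handleTail, jH_eq_linH, sum_fn_adW_mul, linTail, LinearMap.sum_apply]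
  rfl

theorem jM'_eq_linM' (i : Fin n) (a : ι) :
    jM' b i a = (calculus n g b).linM' i (Pi.single a 1) := by
  have h := sum_fn_oneSubAdW_mul b
    ((∑ k : Fin n with i < k, lin (.M k) ∘ₗ (calculus n g b).ad (Curve.prodM n g (i + 1) k))
      + ∑ k : Fin g, (calculus n g b).linH k ∘ₗ
        (calculus n g b).ad (Curve.prodK n g 0 k * Curve.prodM n g (i + 1) n))
    (Curve.word (.M i)) a
  simp only [LinearMap.add_apply, LinearMap.sum_apply, LinearMap.comp_apply] at h
  simp only [jM', jH_eq_linH, gen_eq_lin, sum_fn_adW_mul, h]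
  rfl

theorem jA'_eq_linA' (k : Fin g) (a : ι) :
    jA' b k a = (calculus n g b).linA' k (Pi.single a 1) := by
  simp only [jA', handleTail_eq_linTail, gen_eq_lin, ← LinearMap.sub_apply, sum_fn_adW_mul,
    sum_fn_sub_adW_mul]
  rfl

theorem jB'_eq_linB' (k : Fin g) (a : ι) :
    jB' b k a = (calculus n g b).linB' k (Pi.single a 1) := by
  simp only [jB', handleTail_eq_linTail, gen_eq_lin, ← LinearMap.sub_apply, sum_fn_adW_mul,
    sum_fn_sub_adW_mul]
  rfl

theorem jTot_eq_decoupled (a : ι) : jTot b n g a =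
    (∑ i : Fin n, jM' b i a) +
    (∑ k : Fin g, (
      (∑ c, fn ι (oneSubAdW b (Curve.word (.A k))⁻¹ a c) * jA' b k c) +
      (∑ c, fn ι (adW b (Curve.word (.A k))⁻¹ a c
        - adW b ((Curve.word (.B k))⁻¹ * Curve.word (.A k)) a c) * jB' b k c))) := by
  simp only [jA'_eq_linA', jB'_eq_linB', jM'_eq_linM', sum_fn_oneSubAdW_mul, sum_fn_sub_adW_mul,
    jTot_eq_tot, tot_eq_decoupled]
  rfl

end Decoupling

/-! ### Infinitesimal generators of the action. -/

section Generators
open FlowerCalculus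

variable {E : Type*} [NormedAddCommGroup E] [NormedSpace ℝ E] {n g : ℕ}
  {G : Type*} [TopologicalSpace G] [ChartedSpace E G] [Group G] [LieGroup 𝓘(ℝ, E) ∞ G]
  {ι : Type*}

/-- Separating the two occurrences of `x`, the right factor gives `J^R` and the inverse left factor
gives `J^L`, whose definition contains the same sign. -/
theorem dirDeriv_conj_coord (F : Coeff E n g G) (u : Curve n g → G) (Z : Curve n g)
    (ξ : GroupLieAlgebra 𝓘(ℝ, E) G) :
    dirDeriv (fun x : G => F (Function.update u Z (x⁻¹ * u Z * x))) ξ =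
      JR Z ξ F u + JL Z ξ F u := by
  have := contMDiffMul (E := E) (G := G)
  have := isManifold_lieGroup E G
  have hΦ : ContMDiff (𝓘(ℝ, E).prod 𝓘(ℝ, E)) 𝓘(ℝ, ℝ) ∞
      (Function.uncurry fun x y : G => F (Function.update u Z (x⁻¹ * u Z * y))) :=
    F.contMDiff.comp (contMDiff_update_of contMDiff_const Z
      ((contMDiff_fst.inv.mul contMDiff_const).mul contMDiff_snd))
  rw [dirDeriv_diag (Φ := fun x y : G => F (Function.update u Z (x⁻¹ * u Z * y))) hΦ, add_comm]
  simp only [inv_one, one_mul, mul_one]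
  rw [dirDeriv_inv (f := fun x : G => F (Function.update u Z (x * u Z)))
    (contMDiff_translate F Z u _)]
  rfl

theorem dirDeriv_conjAll_inv (F : Coeff E n g G) (u : Curve n g → G)
    (ξ : GroupLieAlgebra 𝓘(ℝ, E) G) :
    dirDeriv (fun x : G => F (conjAll (E := E) x⁻¹ u)) ξ = ∑ Z, (JR Z ξ F u + JL Z ξ F u) := by
  have := contMDiffMul (E := E) (G := G)
  have := isManifold_lieGroup E G
  -- Induction on the set of conjugated coordinates: one more is split off by giving it its own
  -- variable and applying `dirDeriv_diag`.
  have key (s : Finset (Curve n g)) :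
      dirDeriv (fun x : G => F (fun Z => if Z ∈ s then x⁻¹ * u Z * x else u Z)) ξ =
        ∑ Z ∈ s, (JR Z ξ F u + JL Z ξ F u) := by
    induction s using Finset.induction_on with
    | empty =>
      simp only [Finset.notMem_empty, if_false, Finset.sum_empty]
      exact dirDeriv_const _ ξ
    | insert Z s hZ ih =>
      have hs : ContMDiff 𝓘(ℝ, E) (piModel E (Curve n g)) ∞
          fun (x : G) (W : Curve n g) => if W ∈ s then x⁻¹ * u W * x else u W := by
        refine contMDiff_pi_of fun W => ?_
        split_ifs
        · exact (contMDiff_id.inv.mul contMDiff_const).mul contMDiff_id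
        · exact contMDiff_const
      have hΦ : ContMDiff (𝓘(ℝ, E).prod 𝓘(ℝ, E)) 𝓘(ℝ, ℝ) ∞ (Function.uncurry fun x y : G =>
          F (Function.update (fun W => if W ∈ s then x⁻¹ * u W * x else u W) Z
            (y⁻¹ * u Z * y))) :=
        F.contMDiff.comp (contMDiff_update_of (hs.comp contMDiff_fst) Z
          ((contMDiff_snd.inv.mul contMDiff_const).mul contMDiff_snd))
      have h1 (x : G) : (fun W => if W ∈ insert Z s then x⁻¹ * u W * x else u W) =
          Function.update (fun W => if W ∈ s then x⁻¹ * u W * x else u W) Z (x⁻¹ * u Z * x) := by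
        funext W
        by_cases hW : W = Z
        · subst hW; simp
        · simp [hW]
      have h2 (x : G) : Function.update (fun W => if W ∈ s then x⁻¹ * u W * x else u W) Z (u Z) =
          fun W => if W ∈ s then x⁻¹ * u W * x else u W := by
        rw [Function.update_eq_self_iff, if_neg hZ]
      simp only [h1]
      rw [dirDeriv_diag (Φ := fun x y : G => F (Function.update
        (fun W => if W ∈ s then x⁻¹ * u W * x else u W) Z (y⁻¹ * u Z * y))) hΦ,
        Finset.sum_insert hZ, ← dirDeriv_conj_coord, ← ih, add_comm]
      simp only [inv_one, one_mul, mul_one, h2, ite_self]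
  rw [← key]
  refine congrArg (fun k => dirDeriv k ξ) (funext fun x => congrArg F (funext fun Z => ?_))
  rw [if_pos (Finset.mem_univ Z)]
  exact congrArg (_ * ·) (inv_inv x)

/-- Along an integral curve the derivative is that of `f` along the field, here the left-invariant
one at the unit. -/
theorem hasDerivAt_comp_expCurve [FiniteDimensional ℝ E] [T2Space G] {f : G → ℝ}
    (hf : ContMDiff 𝓘(ℝ, E) 𝓘(ℝ, ℝ) ∞ f) (ξ : GroupLieAlgebra 𝓘(ℝ, E) G) :
    HasDerivAt (fun t => f (expCurve ξ t)) (dirDeriv f ξ) 0 := by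
  have h1 := isMIntegralCurve_expCurve ξ 0
  have h2 := (hf.mdifferentiable (by simp) (expCurve ξ 0)).hasMFDerivAt.comp 0 h1
  have h3 := (show HasFDerivAt (𝕜 := ℝ) (E := ℝ) (F := ℝ) _ _ _ from
    hasMFDerivAt_iff_hasFDerivAt.1 h2).hasDerivAt
  refine h3.congr_deriv ?_
  have h4 := dirDeriv_mul_left hf 1 ξ
  simp only [one_mul] at h4
  rw [h4]
  refine Eq.trans ?_ (congrArg (fun x => mfderiv 𝓘(ℝ, E) 𝓘(ℝ, ℝ) f x
    (mulInvariantVectorField ξ x)) (expCurve_zero ξ))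
  refine congrArg (mfderiv 𝓘(ℝ, E) 𝓘(ℝ, ℝ) f (expCurve ξ 0)) ?_
  exact one_smul ℝ _

theorem hasDerivAt_comp_expCurve_neg [FiniteDimensional ℝ E] [T2Space G] {f : G → ℝ}
    (hf : ContMDiff 𝓘(ℝ, E) 𝓘(ℝ, ℝ) ∞ f) (ξ : GroupLieAlgebra 𝓘(ℝ, E) G) :
    HasDerivAt (fun t => f (expCurve ξ (-t))) (-dirDeriv f ξ) 0 := by
  have h := (hasDerivAt_comp_expCurve hf ξ).comp_of_eq 0 (hasDerivAt_neg 0) neg_zero.symm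
  rw [mul_neg_one] at h
  exact h

variable [Fintype ι] [DecidableEq ι] [FiniteDimensional ℝ E] [T2Space G]
  (b : Module.Basis ι ℝ (GroupLieAlgebra 𝓘(ℝ, E) G))

theorem dirDeriv_adCoeff (a c e : ι) : dirDeriv (adCoeff b c e) (b a) = strConst b a c e := by
  have h := sum_dirDeriv_adCoeff b 1 c (b a)
  simp only [mul_one, Ad_one] at h
  rw [strConst, ← h, b.repr_sum_self]

/-- `evalAt u y` as a ring homomorphism. -/
def evalHom (u : Curve n g → G) (y : Curve n g × ι → ℝ) : Flower E n g G ι →+* ℝ :=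
  MvPolynomial.eval₂Hom (ContMDiffMap.evalRingHom u) y

theorem evalAt_C (u : Curve n g → G) (y : Curve n g × ι → ℝ) (F : Coeff E n g G) :
    evalAt u y (MvPolynomial.C F : Flower E n g G ι) = F u := MvPolynomial.eval₂_C _ _ _

theorem evalAt_add (u : Curve n g → G) (y : Curve n g × ι → ℝ) (φ ψ : Flower E n g G ι) :
    evalAt u y (φ + ψ) = evalAt u y φ + evalAt u y ψ := MvPolynomial.eval₂_add _ _

theorem evalAt_mul (u : Curve n g → G) (y : Curve n g × ι → ℝ) (φ ψ : Flower E n g G ι) :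
    evalAt u y (φ * ψ) = evalAt u y φ * evalAt u y ψ := MvPolynomial.eval₂_mul _ _

theorem evalAt_lin (u : Curve n g → G) (y : Curve n g × ι → ℝ) (X : Curve n g)
    (x : ι → Coeff E n g G) : evalAt u y (lin X x) = ∑ c, x c u * y (X, c) := by
  rw [lin_apply]
  refine (map_sum (evalHom u y) _ _).trans
    (Finset.sum_congr rfl fun c _ => ?_)
  refine (evalAt_mul u y _ _).trans ?_
  rw [evalAt_C]
  exact congrArg _ (MvPolynomial.eval₂_X _ _ _)

theorem evalAt_zero (u : Curve n g → G) (y : Curve n g × ι → ℝ) :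
    evalAt u y (0 : Flower E n g G ι) = 0 := MvPolynomial.eval₂_zero _ _

theorem evalAt_neg (u : Curve n g → G) (y : Curve n g × ι → ℝ) (φ : Flower E n g G ι) :
    evalAt u y (-φ) = -evalAt u y φ :=
  map_neg (evalHom u y) φ

/-- A curve of endomorphisms through the identity is generated by `ψ` if this holds on
coefficients and generators. -/
theorem hasDerivAt_evalAt {σ : ℝ → Flower E n g G ι →ₐ[ℝ] Flower E n g G ι}
    (h0 : ∀ φ, σ 0 φ = φ) {ψ : Flower E n g G ι} {u : Curve n g → G} {y : Curve n g × ι → ℝ}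
    (hC : ∀ F, HasDerivAt (fun t => evalAt u y (σ t (MvPolynomial.C F)))
      (evalAt u y ((calculus n g b).bra ψ (MvPolynomial.C F))) 0)
    (hX : ∀ X a, HasDerivAt (fun t => evalAt u y (σ t (MvPolynomial.X (X, a))))
      (evalAt u y ((calculus n g b).bra ψ (MvPolynomial.X (X, a)))) 0) (φ : Flower E n g G ι) :
    HasDerivAt (fun t => evalAt u y (σ t φ)) (evalAt u y ((calculus n g b).bra ψ φ)) 0 := by
  induction φ using MvPolynomial.induction_on with
  | C F => exact hC F
  | add φ φ' h h' =>
    rw [bra_add_right, evalAt_add]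
    simp only [map_add, evalAt_add]
    exact h.add h'
  | mul_X φ p h =>
    have h1 := h.mul (hX p.1 p.2)
    rw [← ham_apply, Derivation.leibniz, ham_apply, ham_apply, smul_eq_mul, smul_eq_mul,
      evalAt_add, evalAt_mul, evalAt_mul]
    simp only [map_mul, evalAt_mul]
    refine h1.congr_deriv ?_
    -- The product rule produces values at `t = 0`, where the endomorphism is the identity.
    rw [h0, h0]
    ring

theorem act_X (x : SymmGroup E G) (X : Curve n g) (a : ι) :
    act b x (MvPolynomial.X (X, a)) = lin X (conjVec b x.right (Pi.single a 1)) +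
      MvPolynomial.C ((calculus n g b).anchorField X (conjVec b x.right (Pi.single a 1))
        (x.left.toAdd.comp (PhiInf E n g G))) := by
  rw [← act_lin, lin_single]

/-- On functions the derivative is infinitesimal conjugation of all coordinates, equal to
`{j_a^{tot}, F}` by `bra_tot_C`. On generators it is that of `Ad^*(e^{-tJ_a})`, namely the structure
constants with a minus sign, as in `bra_tot_X`. -/
theorem hasDerivAt_act_expCurve (a : ι) (φ : Flower E n g G ι) (u : Curve n g → G)
    (y : Curve n g × ι → ℝ) :
    HasDerivAt (fun t : ℝ => evalAt u y (act b (SymmGroup.mk (expCurve (b a) (-t)) 0) φ))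
      (evalAt u y ((calculus n g b).bra ((calculus n g b).tot (Pi.single a 1)) φ)) 0 := by
  refine hasDerivAt_evalAt b (fun φ => ?_) (fun F => ?_) (fun X c => ?_) φ
  · rw [neg_zero, expCurve_zero]
    exact congrArg (fun σ : Flower E n g G ι →ₐ[ℝ] Flower E n g G ι => σ φ) (actHom n g b).map_one
  · simp only [act_C, bra_tot_C, evalAt_C]
    have hs : ContMDiff 𝓘(ℝ, E) 𝓘(ℝ, ℝ) ∞ fun x : G => F (conjAll (E := E) x⁻¹ u) := by
      have := contMDiffMul (E := E) (G := G)
      refine F.contMDiff.comp (contMDiff_pi_of fun Z => ?_)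
      exact (contMDiff_id.inv.mul contMDiff_const).mul contMDiff_id.inv.inv
    refine (hasDerivAt_comp_expCurve_neg hs (b a)).congr_deriv ?_
    rw [dirDeriv_conjAll_inv, field_eq_sum_leftForm, coeff_sum_apply, ← Finset.sum_neg_distrib]
    refine Finset.sum_congr rfl fun Z _ => ?_
    rw [neg_eq_iff_eq_neg]
    exact congrArg (fun F : Coeff E n g G => F u) (JR_add_JL_eq_leftForm b Z a F)
  · simp only [act_X, bra_tot_X _ _ _ (isConstVec_single a), evalAt_neg, evalAt_add, evalAt_lin,
      evalAt_C]
    have h1 (h : G) (e : ι) : conjVec b h (Pi.single c 1) e u = adCoeff b c e h := by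
      rw [conjVec_single]
      exact mul_one _
    have h2 (t : ℝ) : (calculus n g b).anchorField X
        (conjVec b (SymmGroup.mk (E := E) (expCurve (b a) (-t)) 0).right (Pi.single c 1))
        ((SymmGroup.mk (E := E) (expCurve (b a) (-t)) 0).left.toAdd.comp (PhiInf E n g G)) u
        = 0 :=
      congrArg (fun F : Coeff E n g G => F u) (map_zero _)
    have h3 (e : ι) : (calculus n g b).lie (Pi.single a 1) (Pi.single c 1) e u =
        strConst b a c e := by
      rw [← repr_vecAt b u, strConst]
      refine congrArg (fun v => b.repr v e) ((vecAt_lieVec b u _ _).trans ?_)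
      rw [vecAt_single, vecAt_single]
    simp only [h1, h2, h3, add_zero, ← Finset.sum_neg_distrib]
    refine HasDerivAt.fun_sum fun e _ => ?_
    rw [← neg_mul, ← dirDeriv_adCoeff]
    exact (hasDerivAt_comp_expCurve_neg (adCoeff b c e).contMDiff (b a)).mul_const _

/-- Functions stay fixed, and a generator moves affinely in `t` with slope `-{j, f ∘ Φ_∞} = {f ∘
Φ_∞, j}`; hence the sign in `-(t • f)`. -/
theorem hasDerivAt_act_smoothFn (f : SmoothFn E G) (φ : Flower E n g G ι) (u : Curve n g → G)
    (y : Curve n g × ι → ℝ) :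
    HasDerivAt (fun t : ℝ => evalAt u y (act b (SymmGroup.mk 1 (-(t • f))) φ))
      (evalAt u y ((calculus n g b).bra (MvPolynomial.C (f.comp (PhiInf E n g G))) φ)) 0 := by
  refine hasDerivAt_evalAt b (fun φ => ?_) (fun F => ?_) (fun X c => ?_) φ
  · rw [zero_smul, neg_zero]
    exact congrArg (fun σ : Flower E n g G ι →ₐ[ℝ] Flower E n g G ι => σ φ) (actHom n g b).map_one
  · rw [bra_C_C]
    have h1 (t : ℝ) : conjPull (SymmGroup.mk (1 : G) (-(t • f))).right F = F := conjPull_one F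
    simp only [act_C, h1]
    refine (hasDerivAt_const _ _).congr_deriv ?_
    exact (evalAt_zero u y).symm
  · rw [bra_swap, bra_X_C, evalAt_neg, evalAt_C]
    set V := (calculus n g b).anchorField X (Pi.single c 1)
    have h1 (t : ℝ) : conjVec b (SymmGroup.mk (1 : G) (-(t • f))).right
        (Pi.single c 1 : ι → Coeff E n g G) = Pi.single c 1 := conjVec_one b _
    have h2 (t : ℝ) : V ((SymmGroup.mk (1 : G) (-(t • f))).left.toAdd.comp (PhiInf E n g G)) u =
        -(t * V (f.comp (PhiInf E n g G)) u) := by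
      have : (SymmGroup.mk (1 : G) (-(t • f))).left.toAdd.comp (PhiInf E n g G) =
          -(t • f.comp (PhiInf E n g G)) := rfl
      rw [this, map_neg, Derivation.map_smul]
      rfl
    simp only [act_X, h1, evalAt_add, evalAt_C]
    change HasDerivAt (fun t => _ + V ((SymmGroup.mk (1 : G) (-(t • f))).left.toAdd.comp
      (PhiInf E n g G)) u) _ _
    simp only [h2]
    refine (((hasDerivAt_id (0 : ℝ)).mul_const _).neg.const_add _).congr_deriv ?_
    rw [one_mul]

end Generators

end FlowerAlgebra

end

/-! ### The theorem. -/

open FlowerAlgebra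
theorem mainTheorem5 {E : Type*} [NormedAddCommGroup E] [NormedSpace ℝ E] [FiniteDimensional ℝ E]
    {G : Type*} [TopologicalSpace G] [T2Space G] [ChartedSpace E G] [Group G]
    [LieGroup 𝓘(ℝ, E) ∞ G] {ι : Type*} [Fintype ι] [DecidableEq ι]
    (b : Module.Basis ι ℝ (GroupLieAlgebra 𝓘(ℝ, E) G)) (n g : ℕ) :
    ∃ ρ : SymmGroup E G →* (Flower E n g G ι ≃ₐ[ℝ] Flower E n g G ι),
      (∀ (h : G) (f : SmoothFn E G) (X : Curve n g) (a : ι),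
        ρ (SymmGroup.mk h f) (gen E G X a) =
          (∑ c, adCoeff b a c h • gen E G X c) +
          (∑ c, adCoeff b a c h • bracket b (gen E G X c) (fn ι (f.comp (PhiInf E n g G))))) ∧
      (∀ (h : G) (f : SmoothFn E G) (F : Coeff E n g G),
        ρ (SymmGroup.mk h f) (fn ι F) = fn ι (F.comp (conjAll h⁻¹))) ∧
      (∀ (x : SymmGroup E G) (φ ψ : Flower E n g G ι),
        ρ x (bracket b φ ψ) = bracket b (ρ x φ) (ρ x ψ)) ∧
      (∀ a : ι, jTot b n g a =
        (∑ i : Fin n, jM' b i a) +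
        (∑ k : Fin g, (
          (∑ c, fn ι (oneSubAdW b (Curve.word (.A k))⁻¹ a c) * jA' b k c) +
          (∑ c, fn ι (adW b (Curve.word (.A k))⁻¹ a c
            - adW b ((Curve.word (.B k))⁻¹ * Curve.word (.A k)) a c) * jB' b k c)))) ∧
      (∀ (a : ι) (φ : Flower E n g G ι) (u : Curve n g → G) (y : Curve n g × ι → ℝ),
        HasDerivAt (fun t : ℝ => evalAt u y (ρ (SymmGroup.mk (expCurve (b a) (-t)) 0) φ))
          (evalAt u y (bracket b (jTot b n g a) φ)) 0) ∧
      (∀ (f : SmoothFn E G) (φ : Flower E n g G ι) (u : Curve n g → G) (y : Curve n g × ι → ℝ),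
        HasDerivAt (fun t : ℝ => evalAt u y (ρ (SymmGroup.mk 1 (-(t • f))) φ))
          (evalAt u y (bracket b (fn ι (f.comp (PhiInf E n g G))) φ)) 0) := by
  refine ⟨actAut n g b, actAut_gen b, fun h f F => act_C b _ F, fun x φ ψ => ?_,
    jTot_eq_decoupled b, fun a φ u y => ?_, fun f φ u y => ?_⟩
  · rw [bracket_eq_bra, bracket_eq_bra]
    exact act_bra b x φ ψ
  · rw [bracket_eq_bra, jTot_eq_tot]
    exact hasDerivAt_act_expCurve b a φ u y
  · rw [bracket_eq_bra]
    exact hasDerivAt_act_smoothFn b f φ u y
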